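/- **Setting.** Let $F$ be a number field of degree $n$ over $\mathbb{Q}$. An *$L$-function $L(s,f)$ of degree $d\ge 1$ over $F$* is given by the following data. (i) For $\Re(s)>1$, $$L(s,f)=\sum_{\mathfrak n\ne 0}\lambda_f(\mathfrak n)N(\mathfrak n)^{-s}=\prod_{\mathfrak p}\prod_{i=1}^d\bigl(1-\alpha_i(\mathfrak p)N(\mathfrak p)^{-s}\bigr)^{-1}$$ with absolute convergence, where $\mathfrak n$ and $\mathfrak p$ run over the nonzero ideals and nonzero prime ideals of $\mathcal O_F$, $\lambda_f(\mathcal O_F)=1$ and $|\alpha_i(\mathfrak p)|<N(\mathfrak p)$; and there is a nonzero ideal $\mathcal C_f$ such that $\alpha_i(\mathfrak p)\neq 0$ whenever $\mathfrak p\nmid\mathcal C_f$. (ii) There are an integer $A_f\ge1$ and $\kappa_1,\dots,\kappa_{dn}\in\mathbb C$, real or in conjugate pairs, with $\Re(\kappa_j)>-1$, such that, with $\gamma(s,f)=\pi^{-dns/2}\prod_{j=1}^{dn}\Gamma\bigl(\frac{s+\kappa_j}{2}\bigr)$, the function $\Lambda(s,f)=A_f^{s/2}\gamma(s,f)L(s,f)$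 is holomorphic on $\Re(s)>1$, extends to a meromorphic function of order $1$ on $\mathbb C$ with no poles outside $\{0,1\}$, and satisfies $\Lambda(s,f)=W(f)\Lambda(1-s,\bar f)$ with $|W(f)|=1$. Here $\bar f$ is the dual of $f$, with $\lambda_{\bar f}(\mathfrak n)=\overline{\lambda_f(\mathfrak n)}$, the same gamma factor and $A_{\bar f}=A_f$; thus $\Lambda(s,\bar f)=\overline{\Lambda(\bar s,f)}$. Call $f$ *self-dual* if $\bar f=f$, i.e. all $\lambda_f(\mathfrak n)$ are real. Put $\Lambda_f(\mathfrak p^m)=\log N(\mathfrak p)\sum_{i=1}^d\alpha_i(\mathfrak p)^m$. The Ramanujan–Petersson conjecture for $f$ says that $|\alpha_i(\mathfrak p)|=1$ if $\mathfrak p\nmid\mathcal C_f$, and $|\alpha_i(\mathfrak p)|\le1$ otherwise. For a Schwartz function $\phi:\mathbb R\to\mathbb C$ let $\widehat\phi(y)=\int_{\mathbb R}\phi(x)e^{-2\pi ixy}\,dx$ and $\phi(z)=\int_{\mathbb R}\widehat\phi(x)e^{2\pi ixz}\,dx$. The latter agrees with $\phi$ for real $z$; it is used for non-real $z$ only if $\widehat\phi$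 has compact support, where it is the entire extension of $\phi$. **Proposition.** Fix $F$, $d$, an even Schwartz function $\phi$, and real numbers $K$, $c_0>e$, $\kappa_0>0$. There is a constant $C$, depending only on these, such that the following holds. Let $L(s,f)$ be a self-dual $L$-function of degree $d$ over $F$ that satisfies the Ramanujan–Petersson conjecture, and suppose that $\Lambda(s,f)$ has no poles and that $\Re(\kappa_j)>0$ and $|\kappa_j|\ge\kappa_0$ for all $j$. Let $\delta_f\in\mathbb Z$ and $c_f\ge c_0$ be such that $$\Bigl|\sum_{N(\mathfrak p)\le x}\Lambda_f(\mathfrak p^2)-\delta_f x\Bigr|\le K\,x^{1/2}\log^2(c_fx)\qquad\text{for all }x\ge2 .$$ Assume moreover that the Riemann hypothesis holds for $L(s,f)$ (all its zeros with $0\le\Re(s)\le1$ have $\Re(s)=\tfrac12$), or that $\widehat\phi$ has compact support. For $R\ge 2$ put $$D(f;\phi)=\sum_{\rho}\phi\Bigl(\frac{\gamma}{2\pi}\log R\Bigr),\qquad \rho=\tfrac12+i\gamma,$$ the sum being over all zeros $\rho$ of $L(s,f)$ with $0\le\Re(\rho)\le1$, counted with multiplicity; here $\gamma\in\mathbb C$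 is real when $\Re(\rho)=\frac12$. Then, for every $R\ge2$, this sum converges absolutely, the sum over primes below converges when ordered by norm, and $$D(f;\phi)=\frac{\widehat\phi(0)}{\log R}\log\Bigl(\pi^{-dn}A_f\prod_{j=1}^{dn}\kappa_j\Bigr)-\frac{\delta_f}{2}\phi(0)-\frac{2}{\log R}\sum_{\mathfrak p}\Lambda_f(\mathfrak p)\frac{\widehat\phi\bigl(\frac{\log N(\mathfrak p)}{\log R}\bigr)}{N(\mathfrak p)^{1/2}}+E,\qquad |E|\le C\,\frac{\log\log c_f}{\log R}.$$ -/

import Mathlib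

open Filter Topology NumberField IsDedekindDomain SchwartzMap
open scoped FourierTransform ComplexConjugate

noncomputable section

/-- The absolute norm `N(𝔭)` of a nonzero prime ideal. -/
def primeNorm {F : Type*} [Field F] [NumberField F] (p : HeightOneSpectrum (𝓞 F)) : ℕ :=
  Ideal.absNorm p.asIdeal

theorem finite_primes_le (F : Type*) [Field F] [NumberField F] (x : ℝ) :
    {p : HeightOneSpectrum (𝓞 F) | (primeNorm p : ℝ) ≤ x}.Finite := by
  have h := Ideal.finite_setOfPred_absNorm_le (S := 𝓞 F) ⌊x⌋₊
  refine Set.Finite.of_finite_image (f := HeightOneSpectrum.asIdeal) (h.subset ?_) ?_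
  · rintro _ ⟨p, hp, rfl⟩
    exact Nat.le_floor hp
  · intro p _ q _ hpq
    exact HeightOneSpectrum.ext hpq

/-- The nonzero prime ideals `𝔭` of `F` with `N(𝔭) ≤ x`. -/
def primesLE (F : Type*) [Field F] [NumberField F] (x : ℝ) : Finset (HeightOneSpectrum (𝓞 F)) :=
  (finite_primes_le F x).toFinset

/-- An `L`-function `L(s, f)` of degree `d` over the number field `F`, in the axiomatic sense. -/
structure NFLFunction (F : Type*) [Field F] [NumberField F] (d : ℕ) where
  one_le_degree : 1 ≤ d
  /-- The Dirichlet coefficients `λ_f(𝔫)`; only nonzero ideals `𝔫` matter. -/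
  coeff : Ideal (𝓞 F) → ℂ
  coeff_top : coeff ⊤ = 1
  /-- The local parameters `α_i(𝔭)`. -/
  α : Fin d → HeightOneSpectrum (𝓞 F) → ℂ
  norm_α_lt : ∀ i p, ‖α i p‖ < primeNorm p
  /-- The Dirichlet series converges absolutely on `Re s > 1`. -/
  summable_series : ∀ s : ℂ, 1 < s.re →
    Summable fun n : {n : Ideal (𝓞 F) // n ≠ ⊥} =>
      ‖coeff n * (Ideal.absNorm (n : Ideal (𝓞 F)) : ℂ) ^ (-s)‖
  /-- The Euler product converges absolutely on `Re s > 1`. -/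
  summable_euler : ∀ s : ℂ, 1 < s.re →
    Summable fun p : HeightOneSpectrum (𝓞 F) => ∑ i, ‖α i p * (primeNorm p : ℂ) ^ (-s)‖
  /-- The Euler product is equal to the Dirichlet series on `Re s > 1`. -/
  euler_product : ∀ s : ℂ, 1 < s.re →
    HasProd (fun p : HeightOneSpectrum (𝓞 F) =>
        ∏ i, (1 - α i p * (primeNorm p : ℂ) ^ (-s))⁻¹)
      (∑' n : {n : Ideal (𝓞 F) // n ≠ ⊥},
        coeff n * (Ideal.absNorm (n : Ideal (𝓞 F)) : ℂ) ^ (-s))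
  /-- The conductor `𝒞_f`, a nonzero integral ideal. -/
  conductor : Ideal (𝓞 F)
  conductor_ne_bot : conductor ≠ ⊥
  α_ne_zero : ∀ i p, ¬ p.asIdeal ∣ conductor → α i p ≠ 0
  /-- The parameters `κ_j` of the gamma factor. -/
  κ : Fin (d * Module.finrank ℚ F) → ℂ
  /-- The `κ_j` are real or occur in conjugate pairs. -/
  κ_conj : ∃ σ : Equiv.Perm (Fin (d * Module.finrank ℚ F)), ∀ j, κ (σ j) = conj (κ j)
  neg_one_lt_re_κ : ∀ j, -1 < (κ j).re
  /-- The integer `A_f`. -/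
  A : ℕ
  one_le_A : 1 ≤ A
  /-- The complete `L`-function `Λ(s, f)`, as a meromorphic function on `ℂ`. -/
  completed : ℂ → ℂ
  completed_eq : ∀ s : ℂ, 1 < s.re →
    completed s = (A : ℂ) ^ (s / 2) *
      ((Real.pi : ℂ) ^ (-((d * Module.finrank ℚ F : ℕ) : ℂ) * s / 2) *
        ∏ j, Complex.Gamma ((s + κ j) / 2)) *
      ∑' n : {n : Ideal (𝓞 F) // n ≠ ⊥},
        coeff n * (Ideal.absNorm (n : Ideal (𝓞 F)) : ℂ) ^ (-s)
  /-- `Λ(s, f)` is meromorphic on `ℂ` and its only possible poles are `0` and `1`. -/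
  meromorphic_completed : ∀ s : ℂ, MeromorphicAt completed s
  analyticAt_completed : ∀ s : ℂ, s ≠ 0 → s ≠ 1 → AnalyticAt ℂ completed s
  /-- `Λ(s, f)` has order of growth at most one (its gamma factor makes the order exactly one);
  the restriction to `|s| ≥ 2` removes the two possible poles. -/
  order_one : ∀ ε : ℝ, 0 < ε → ∃ B : ℝ, ∀ s : ℂ, 2 ≤ ‖s‖ →
    ‖completed s‖ ≤ B * Real.exp (‖s‖ ^ (1 + ε))
  /-- The root number `W(f)`. -/
  rootNumber : ℂ
  norm_rootNumber : ‖rootNumber‖ = 1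
  /-- The functional equation `Λ(s, f) = W(f) Λ(1 - s, f̄)`. The dual `f̄` has the coefficients
  `conj (λ_f(𝔫))` and the same `A` and gamma factor as `f`, hence
  `Λ(s, f̄) = conj (Λ(conj s, f))`. -/
  functional_equation : ∀ s : ℂ, s ≠ 0 → s ≠ 1 →
    completed s = rootNumber * conj (completed (conj (1 - s)))

namespace NFLFunction

variable {F : Type*} [Field F] [NumberField F] {d : ℕ}

/-- The gamma factor `γ(s, f) = π^(-dns/2) ∏_j Γ((s + κ_j)/2)`. -/
def gammaFactor (f : NFLFunction F d) (s : ℂ) : ℂ :=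
  (Real.pi : ℂ) ^ (-((d * Module.finrank ℚ F : ℕ) : ℂ) * s / 2) *
    ∏ j, Complex.Gamma ((s + f.κ j) / 2)

/-- The meromorphic continuation of `L(s, f)` to `ℂ`. -/
def L (f : NFLFunction F d) (s : ℂ) : ℂ :=
  (f.A : ℂ) ^ (-s / 2) * (f.gammaFactor s)⁻¹ * f.completed s

/-- `Λ_f(𝔭^m) = log N(𝔭) ∑_i α_i(𝔭)^m`, the coefficients of `-L'/L`; the coefficient is zero at
the ideals that are not prime powers. -/
def vonMangoldt (f : NFLFunction F d) (p : HeightOneSpectrum (𝓞 F)) (m : ℕ) : ℂ :=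
  (Real.log (primeNorm p) : ℂ) * ∑ i, f.α i p ^ m

/-- `f̄ = f`. -/
def IsSelfDual (f : NFLFunction F d) : Prop :=
  ∀ n : Ideal (𝓞 F), n ≠ ⊥ → conj (f.coeff n) = f.coeff n

/-- The Ramanujan–Petersson conjecture for `L(s, f)`. -/
def RamanujanPetersson (f : NFLFunction F d) : Prop :=
  ∀ i p, (¬ p.asIdeal ∣ f.conductor → ‖f.α i p‖ = 1) ∧ ‖f.α i p‖ ≤ 1

/-- `∑_{N(𝔭) ≤ x} Λ_f(𝔭²) = δ x + O(x^(1/2) log² (c x))` with implied constant `K`. -/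
def PrimeSquareAsymptotic (f : NFLFunction F d) (δ : ℤ) (c K : ℝ) : Prop :=
  ∀ x : ℝ, 2 ≤ x →
    ‖∑ p ∈ primesLE F x, f.vonMangoldt p 2 - (δ : ℂ) * (x : ℂ)‖
      ≤ K * (x ^ (1 / 2 : ℝ) * Real.log (c * x) ^ 2)

/-- The complete `L`-function has no pole. -/
def NoPoles (f : NFLFunction F d) : Prop :=
  ∀ s : ℂ, 0 ≤ meromorphicOrderAt f.completed s

/-- The zeros `ρ` of `L(s, f)` with `0 ≤ Re ρ ≤ 1`. -/
def stripZeros (f : NFLFunction F d) : Set ℂ :=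
  {ρ | 0 ≤ ρ.re ∧ ρ.re ≤ 1 ∧ 0 < meromorphicOrderAt f.L ρ}

/-- The multiplicity of `ρ` as a zero of `L(s, f)`. -/
def zeroMult (f : NFLFunction F d) (ρ : ℂ) : ℕ :=
  (meromorphicOrderAt f.L ρ).untop₀.toNat

/-- The Riemann hypothesis for `L(s, f)`. -/
def RiemannHypothesis (f : NFLFunction F d) : Prop :=
  ∀ ρ ∈ f.stripZeros, ρ.re = 1 / 2

end NFLFunction

/-- `φ` at complex arguments: `φ(z) = ∫ φ̂(x) e^(2πixz) dx`. By Fourier inversion this is `φ`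
itself on the real line; if `φ̂` has compact support, it is the entire extension of `φ`. -/
def complexExtension (φ : 𝓢(ℝ, ℂ)) (z : ℂ) : ℂ :=
  ∫ x : ℝ, (𝓕 φ : 𝓢(ℝ, ℂ)) x * Complex.exp (2 * Real.pi * Complex.I * x * z)

theorem complexExtension_ofReal (φ : 𝓢(ℝ, ℂ)) (t : ℝ) : complexExtension φ t = φ t := by
  have h : (𝓕⁻ (𝓕 φ : 𝓢(ℝ, ℂ)) : 𝓢(ℝ, ℂ)) t = φ t := by simp
  rw [← h, SchwartzMap.fourierInv_coe, Real.fourierInv_eq', complexExtension]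
  congr 1
  ext x
  rw [smul_eq_mul, mul_comm]
  congr 2
  simp only [RCLike.inner_apply, conj_trivial]
  push_cast
  ring

namespace NFLFunction

variable {F : Type*} [Field F] [NumberField F] {d : ℕ}

/-- The contribution `φ((γ/2π) log R)` of the zero `ρ = 1/2 + iγ`, with its multiplicity. If
`Re ρ = 1/2`, then `γ` is the imaginary part of `ρ`. -/
def densityTerm (f : NFLFunction F d) (φ : 𝓢(ℝ, ℂ)) (R : ℝ) (ρ : f.stripZeros) : ℂ :=
  (f.zeroMult ρ : ℂ) *
    complexExtension φ
      ((((ρ : ℂ) - 1 / 2) / Complex.I) / (2 * Real.pi : ℂ) * (Real.log R : ℂ))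

/-- The 1-level density `D(f; φ)`. -/
def oneLevelDensity (f : NFLFunction F d) (φ : 𝓢(ℝ, ℂ)) (R : ℝ) : ℂ :=
  ∑' ρ : f.stripZeros, f.densityTerm φ R ρ

/-- `∑_{N(𝔭) ≤ x} Λ_f(𝔭) φ̂(log N(𝔭) / log R) N(𝔭)^(-1/2)`. -/
def primeSum (f : NFLFunction F d) (φ : 𝓢(ℝ, ℂ)) (R x : ℝ) : ℂ :=
  ∑ p ∈ primesLE F x,
    f.vonMangoldt p 1 * (𝓕 φ : 𝓢(ℝ, ℂ)) (Real.log (primeNorm p) / Real.log R) /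
      (((primeNorm p : ℝ) ^ (1 / 2 : ℝ) : ℝ) : ℂ)

/-- `(φ̂(0) / log R) log (π^(-dn) A_f ∏_j κ_j)`. -/
def conductorTerm (f : NFLFunction F d) (φ : 𝓢(ℝ, ℂ)) (R : ℝ) : ℂ :=
  (𝓕 φ : 𝓢(ℝ, ℂ)) 0 / (Real.log R : ℂ) *
    Complex.log ((Real.pi : ℂ) ^ (-((d * Module.finrank ℚ F : ℕ) : ℤ)) * (f.A : ℂ) * ∏ j, f.κ j)

end NFLFunction

end

noncomputable section

/-! Put `l = log R` and `G(u) = φ̂(u/l)/l`. Then `φ(γl/2π) = ∫ G(u) e^{(ρ-1/2)u} du`, so the 1-level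
density is the zero side of Weil's explicit formula with test function `G`. The other side
(`NFLFunction.explicit_formula_schwartz`) consists of `G(0)(log A - dn log π)`, one gamma term for
each `κ_j`, and minus twice a sum over prime powers. Everything of size `O(1/l)` is an admissible
error, since `log log c ≥ log log c₀ > 0`.

The gamma term of `κ_j` is `G(0) log κ_j + O(1/l)`, because the digamma function is `log z + O(1)`
on a right half-plane (`exists_norm_gammaTerm_sub_le`). The first powers of primes form the prime
sum of the statement, and the powers from the cube on converge absolutely
(`NFLFunction.exists_norm_tsum_higher_powers_le`). For the squares
(`NFLFunction.exists_norm_tsum_prime_squares_sub_le`) the primes with norm below `2 log⁴ c` are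
bounded trivially, at the cost of `log log c`. Beyond that point Abel summation with the given
asymptotic costs only `O(1)`. The main term is `δ/2 ∫_0^∞ G = δ φ(0)/4`, which the factor `-2` turns
into `-δ φ(0)/2`.

The explicit formula for smooth `g` of compact support (`NFLFunction.explicit_formula`) needs
neither a contour shift nor a count of zeros. The functional equation and the growth of `Λ` give `2
ξ'/ξ(s) = ∑ (1/(s-ρ) + 1/(s-(1-ρ)))` with absolute convergence (`partial_fractions_of_symm`). Both
this expansion and the one of `ξ'/ξ` into digamma functions and prime powers hold on `Re s = 3/2`.
They are integrated there, term by term, against a rapidly decreasing kernel that inverts the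
Laplace transform of `g`.

A general `G` is truncated smoothly between `log X` and `log (X+1)`. No norm lies strictly between
`X` and `X+1`, so the truncated sum over first powers is exactly the sum over `N(𝔭) ≤ X`. The step
is steep, and the transform of the removed part is only `O((log X)^{-3} min(1/(1+|γ|), X/(1+γ²)))`.
Under the Riemann hypothesis the zeros sum this minimum to `O(log² X)`, by the positivity of `∑
T/(T²+γ²) = Re ξ'/ξ(1/2+T) = O(log T)` at dyadic `T`. So the loss tends to zero. If `φ̂` has compact
support, the truncation is eventually trivial. -/

/-! ### The digamma function: its series, and its comparison with the logarithm. -/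

theorem norm_nat_add_ge {z : ℂ} (n : ℕ) : (n : ℝ) + z.re ≤ ‖(n : ℂ) + z‖ := by
  have := Complex.re_le_norm ((n : ℂ) + z)
  simpa using this

theorem summable_inv_nat_add_sq {a : ℝ} (ha : 0 < a) :
    Summable fun n : ℕ => 1 / ((n : ℝ) + a) ^ 2 := by
  have h := (Real.summable_one_div_nat_add_rpow a 2).2 (by norm_num)
  refine h.congr fun n => ?_
  rw [abs_of_pos (by positivity)]
  norm_num

theorem norm_digamma_summand_le {z : ℂ} {a : ℝ} (ha : 0 < a) (ha1 : a ≤ 1) (hz : a ≤ z.re) (n : ℕ) :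
    ‖1 / ((n : ℂ) + 1) - 1 / ((n : ℂ) + z)‖ ≤ ‖z - 1‖ * (1 / ((n : ℝ) + a) ^ 2) := by
  have h1 : (n : ℝ) + a ≤ ‖(n : ℂ) + z‖ := le_trans (by linarith) (norm_nat_add_ge n)
  have h0 : (0 : ℝ) < n + a := by positivity
  have hz0 : (n : ℂ) + z ≠ 0 := norm_pos_iff.1 (h0.trans_le h1)
  have hn : (n : ℂ) + 1 ≠ 0 := Nat.cast_add_one_ne_zero n
  have : 1 / ((n : ℂ) + 1) - 1 / ((n : ℂ) + z) = (z - 1) / (((n : ℂ) + 1) * (n + z)) := by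
    field_simp
    ring
  rw [this, norm_div, norm_mul, mul_one_div]
  have h2 : ‖(n : ℂ) + 1‖ = n + 1 := by
    rw [← Nat.cast_add_one, Complex.norm_natCast]; push_cast; ring
  rw [h2, sq]
  gcongr

theorem summable_digamma_summand {z : ℂ} (hz : 0 < z.re) :
    Summable fun n : ℕ => 1 / ((n : ℂ) + 1) - 1 / ((n : ℂ) + z) := by
  have ha : 0 < min z.re 1 := lt_min hz one_pos
  exact Summable.of_norm_bounded ((summable_inv_nat_add_sq ha).mul_left ‖z - 1‖)
    fun n => norm_digamma_summand_le ha (min_le_right _ _) (min_le_left _ _) n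

theorem one_add_div_mem_slitPlane {z : ℂ} (hz : -1 < z.re) (n : ℕ) :
    1 + z / ((n : ℂ) + 1) ∈ Complex.slitPlane := by
  left
  have : z / ((n : ℂ) + 1) = z / ((n + 1 : ℝ) : ℂ) := by push_cast; rfl
  rw [this, Complex.add_re, Complex.div_ofReal_re, Complex.one_re]
  have h0 : (0 : ℝ) < n + 1 := by positivity
  have : -1 < z.re / (n + 1) := by
    rw [lt_div_iff₀ h0]
    nlinarith [(Nat.cast_nonneg n : (0 : ℝ) ≤ n)]
  linarith

theorem hasDerivAt_logGamma_summand {z : ℂ} (hz : -1 < z.re) (n : ℕ) :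
    HasDerivAt (fun z : ℂ => z / ((n : ℂ) + 1) - Complex.log (1 + z / ((n : ℂ) + 1)))
      (1 / ((n : ℂ) + 1) - 1 / ((n : ℂ) + (z + 1))) z := by
  have hm := one_add_div_mem_slitPlane hz n
  have hn : (n : ℂ) + 1 ≠ 0 := Nat.cast_add_one_ne_zero n
  have h1 : HasDerivAt (fun z : ℂ => z / ((n : ℂ) + 1)) (1 / ((n : ℂ) + 1)) z :=
    (hasDerivAt_id z).div_const _
  have h2 := (h1.const_add 1).clog hm
  refine (h1.sub h2).congr_deriv ?_
  have h3 : 1 + z / ((n : ℂ) + 1) ≠ 0 := Complex.slitPlane_ne_zero hm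
  have h4 : (n : ℂ) + (z + 1) = ((n : ℂ) + 1) * (1 + z / ((n : ℂ) + 1)) := by
    field_simp
    ring
  rw [h4]
  field_simp

/-- A partial Weierstrass product is Euler's `GammaSeq` up to an exponential factor. The factor
carries `harmonic N - log N`, which converges to the Euler–Mascheroni constant. -/
theorem exp_logGamma_partial {z : ℂ} (hz : -1 < z.re) (hz0 : z ≠ 0) {N : ℕ} (hN : N ≠ 0) :
    Complex.exp (∑ n ∈ Finset.range N,
      (z / ((n : ℂ) + 1) - Complex.log (1 + z / ((n : ℂ) + 1)))) =
      z * Complex.GammaSeq z N * Complex.exp (((harmonic N : ℝ) - Real.log N : ℝ) * z) := by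
  have h1 : ∀ n : ℕ, Complex.exp (Complex.log (1 + z / ((n : ℂ) + 1))) = (z + (n + 1 : ℕ)) / ((n : ℂ) + 1) := by
    intro n
    have hn : (n : ℂ) + 1 ≠ 0 := Nat.cast_add_one_ne_zero n
    rw [Complex.exp_log (Complex.slitPlane_ne_zero (one_add_div_mem_slitPlane hz n))]
    field_simp
    push_cast
    ring
  rw [Finset.sum_sub_distrib, Complex.exp_sub, Complex.exp_sum (Finset.range N) fun n : ℕ => Complex.log _]
  simp_rw [h1]
  rw [Finset.prod_div_distrib, Complex.GammaSeq, Finset.prod_range_succ']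
  have h2 : ∏ n ∈ Finset.range N, ((n : ℂ) + 1) = (N.factorial : ℂ) := by
    rw [← Finset.prod_range_add_one_eq_factorial]; push_cast; rfl
  rw [h2, Complex.cpow_def_of_ne_zero (by exact_mod_cast hN)]
  have h3 : (∑ n ∈ Finset.range N, z / ((n : ℂ) + 1)) = ((harmonic N : ℝ) : ℂ) * z := by
    rw [harmonic]
    push_cast
    rw [Finset.sum_mul]
    refine Finset.sum_congr rfl fun n _ => by rw [div_eq_mul_inv, mul_comm]
  rw [h3]
  have h4 : ((((harmonic N : ℝ) - Real.log N : ℝ)) : ℂ) * z = ((harmonic N : ℝ) : ℂ) * z - Complex.log N * z := by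
    rw [← Complex.natCast_log]; push_cast; ring
  rw [h4, Complex.exp_sub]
  have h5 : ∏ n ∈ Finset.range N, (z + (n + 1 : ℕ)) ≠ 0 := by
    refine Finset.prod_ne_zero_iff.2 fun n _ h => ?_
    have := congrArg Complex.re h
    simp at this
    nlinarith [(Nat.cast_nonneg n : (0 : ℝ) ≤ n)]
  have h6 : (N.factorial : ℂ) ≠ 0 := by exact_mod_cast N.factorial_ne_zero
  field_simp
  simp [hz0]

/-- The series for `log Γ(z + 1) + γ z`. -/
def logGammaSeries (z : ℂ) : ℂ :=
  ∑' n : ℕ, (z / ((n : ℂ) + 1) - Complex.log (1 + z / ((n : ℂ) + 1)))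

/-- All summands vanish at `0`, and on a convex bounded part of a half-plane `Re x > a - 1` their
derivatives have a common summable bound. Hence convergence and termwise differentiation spread from
`0` to `z`. -/
theorem logGammaSeries_hasDerivAt {z : ℂ} (hz : -1 < z.re) :
    (Summable fun n : ℕ => z / ((n : ℂ) + 1) - Complex.log (1 + z / ((n : ℂ) + 1))) ∧
    HasDerivAt logGammaSeries (∑' n : ℕ, (1 / ((n : ℂ) + 1) - 1 / ((n : ℂ) + (z + 1)))) z := by
  obtain ⟨a, ha0, ha⟩ : ∃ a : ℝ, 0 < a ∧ a < min (z.re + 1) 1 :=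
    exists_between (lt_min (by linarith) one_pos)
  have ha1 : a < 1 := ha.trans_le (min_le_right _ _)
  have haz : a < z.re + 1 := ha.trans_le (min_le_left _ _)
  set r : ℝ := ‖z‖ + 1
  set t : Set ℂ := {x | a - 1 < x.re} ∩ Metric.ball 0 r
  have ht : IsOpen t := (isOpen_lt continuous_const Complex.continuous_re).inter Metric.isOpen_ball
  have htp : IsPreconnected t :=
    ((convex_halfSpace_re_gt _).inter (convex_ball _ _)).isPreconnected
  have h0t : (0 : ℂ) ∈ t := ⟨by simpa using ha1, by simp; positivity⟩
  have hzt : z ∈ t := ⟨by rw [Set.mem_ofPred_eq]; linarith, by simp [r]⟩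
  have hg : ∀ (n : ℕ) y, y ∈ t → HasDerivAt (fun z : ℂ => z / ((n : ℂ) + 1) - Complex.log (1 + z / ((n : ℂ) + 1)))
      (1 / ((n : ℂ) + 1) - 1 / ((n : ℂ) + (y + 1))) y := fun n y hy => by
    have h1 : a - 1 < y.re := hy.1
    exact hasDerivAt_logGamma_summand (by linarith) n
  have hg' : ∀ (n : ℕ) y, y ∈ t → ‖1 / ((n : ℂ) + 1) - 1 / ((n : ℂ) + (y + 1))‖ ≤
      r * (1 / ((n : ℝ) + a) ^ 2) := fun n y hy => by
    have h1 : a - 1 < y.re := hy.1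
    have h2 : ‖y‖ < r := by simpa using hy.2
    have h3 : a ≤ (y + 1).re := by rw [Complex.add_re, Complex.one_re]; linarith
    refine (norm_digamma_summand_le ha0 ha1.le h3 n).trans ?_
    rw [add_sub_cancel_right]
    gcongr
  have hu := (summable_inv_nat_add_sq ha0).mul_left r
  have h00 : Summable fun n : ℕ => ((0 : ℂ) / ((n : ℂ) + 1) - Complex.log (1 + 0 / ((n : ℂ) + 1))) := by
    simp [summable_zero]
  have r1 := summable_of_summable_hasDerivAt_of_isPreconnected hu ht htp hg hg' h0t h00 hzt
  have r2 := hasDerivAt_tsum_of_isPreconnected hu ht htp hg hg' h0t h00 hzt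
  exact ⟨r1, r2⟩

theorem Gamma_add_one_eq_exp {y : ℂ} (hy : -1 < y.re) :
    Complex.Gamma (y + 1) = Complex.exp (logGammaSeries y - Real.eulerMascheroniConstant * y) := by
  by_cases hy0 : y = 0
  · subst hy0; simp [logGammaSeries]
  have l1 := (Complex.continuous_exp.tendsto _).comp
    (logGammaSeries_hasDerivAt hy).1.hasSum.tendsto_sum_nat
  have l2 : Tendsto (fun N : ℕ => y * Complex.GammaSeq y N *
      Complex.exp (((harmonic N : ℝ) - Real.log N : ℝ) * y)) atTop
      (𝓝 (y * Complex.Gamma y * Complex.exp (Real.eulerMascheroniConstant * y))) := by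
    refine ((Complex.GammaSeq_tendsto_Gamma y).const_mul y).mul ?_
    refine (Complex.continuous_exp.tendsto _).comp (Tendsto.mul_const y ?_)
    exact (Complex.continuous_ofReal.tendsto _).comp Real.tendsto_harmonic_sub_log
  have := tendsto_nhds_unique (l1.congr' ?_) l2
  · rw [Complex.Gamma_add_one y hy0, Complex.exp_sub, logGammaSeries, this]
    field_simp
  · filter_upwards [eventually_ne_atTop 0] with N hN
    exact exp_logGamma_partial hy hy0 hN

theorem digamma_eq_tsum {z : ℂ} (hz : 0 < z.re) :
    Complex.digamma z = -Real.eulerMascheroniConstant +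
      ∑' n : ℕ, (1 / ((n : ℂ) + 1) - 1 / ((n : ℂ) + z)) := by
  have hz1 : -1 < (z - 1).re := by simpa using hz
  have hd := (logGammaSeries_hasDerivAt hz1).2
  rw [sub_add_cancel] at hd
  have h1 := (hd.sub ((hasDerivAt_id (z - 1)).const_mul (Real.eulerMascheroniConstant : ℂ))).cexp
  have h2 : HasDerivAt (fun y => Complex.Gamma (y + 1)) _ (z - 1) :=
    h1.congr_of_eventuallyEq (by
      filter_upwards [(isOpen_lt continuous_const Complex.continuous_re).mem_nhds hz1] with y hy
        using Gamma_add_one_eq_exp hy)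
  have h3 := h2.comp_sub_const z 1
  have h4 := Gamma_add_one_eq_exp hz1
  simp only [sub_add_cancel] at h3 h4
  simp only [Pi.sub_apply, id, ← h4, mul_one] at h3
  have hne : Complex.Gamma z ≠ 0 := Complex.Gamma_ne_zero_of_re_pos hz
  rw [Complex.digamma_def, logDeriv_apply, h3.deriv, mul_div_cancel_left₀ _ hne]
  ring

/-- The mean value inequality for `t ↦ log (w + t) - t / w` on `[0, 1]`, whose derivative is `-t /
((w + t) w)`. -/
theorem norm_log_add_one_sub_log_sub_inv_le {w : ℂ} (hw : 0 < w.re) :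
    ‖Complex.log (w + 1) - Complex.log w - 1 / w‖ ≤ 1 / w.re ^ 2 := by
  have hw0 : w ≠ 0 := fun h => by simp [h] at hw
  have hd : ∀ t ∈ Set.Icc (0 : ℝ) 1, HasDerivWithinAt (fun t : ℝ => Complex.log (w + t) - t / w)
      (1 / (w + t) - 1 / w) (Set.Icc 0 1) t := by
    intro t ht
    have h1 : HasDerivAt (fun t : ℝ => w + (t : ℂ)) 1 t := (Complex.ofRealCLM.hasDerivAt).const_add w
    have h2 : w + (t : ℂ) ∈ Complex.slitPlane := by
      left; simp; linarith [ht.1]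
    have h3 : HasDerivAt (fun t : ℝ => (t : ℂ) / w) (1 / w) t :=
      (Complex.ofRealCLM.hasDerivAt (x := t)).div_const w
    exact ((h1.clog_real h2).sub h3).hasDerivWithinAt
  have hb : ∀ t ∈ Set.Ico (0 : ℝ) 1, ‖1 / (w + (t : ℂ)) - 1 / w‖ ≤ 1 / w.re ^ 2 := by
    intro t ht
    have h1 : w.re ≤ ‖w + t‖ := (by simpa using ht.1 : w.re ≤ (w + t).re).trans (Complex.re_le_norm _)
    have h2 : w + (t : ℂ) ≠ 0 := norm_pos_iff.1 (hw.trans_le h1)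
    have : 1 / (w + (t : ℂ)) - 1 / w = -t / ((w + t) * w) := by
      field_simp
      ring
    rw [this, norm_div, norm_neg, norm_mul, Complex.norm_real, Real.norm_eq_abs, abs_of_nonneg ht.1, sq]
    have := Complex.re_le_norm w
    gcongr
    exact ht.2.le
  have := norm_image_sub_le_of_norm_deriv_le_segment' hd hb 1 (by simp)
  simp only [Complex.ofReal_one, Complex.ofReal_zero, add_zero, zero_div, sub_zero, mul_one] at this
  rwa [sub_right_comm] at this

/-- The differences `log (n + z + 1) - log (n + z)` telescope to `log (N + z) - log z`. Trading them
for the harmonic sum consumes the Euler–Mascheroni constant. -/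
theorem digamma_eq_log_add_tsum {z : ℂ} (hz : 0 < z.re) :
    Complex.digamma z = Complex.log z +
      ∑' n : ℕ, (Complex.log ((n : ℂ) + z + 1) - Complex.log ((n : ℂ) + z) - 1 / ((n : ℂ) + z)) := by
  have hs : Summable fun n : ℕ =>
      (Complex.log ((n : ℂ) + z + 1) - Complex.log ((n : ℂ) + z) - 1 / ((n : ℂ) + z)) := by
    refine Summable.of_norm_bounded (summable_inv_nat_add_sq hz) fun n => ?_
    simpa using norm_log_add_one_sub_log_sub_inv_le (w := (n : ℂ) + z) (by simp; positivity)
  have l1 := hs.hasSum.tendsto_sum_nat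
  have l2 := (summable_digamma_summand hz).hasSum.tendsto_sum_nat
  have l3 : Tendsto (fun N : ℕ => Complex.log (1 + z / N)) atTop (𝓝 0) := by
    have h1 : Tendsto (fun N : ℕ => 1 + z / (N : ℂ)) atTop (𝓝 (1 + 0)) :=
      (tendsto_const_div_atTop_nhds_zero_nat (𝕜 := ℂ) z).const_add 1
    have h2 := h1.clog (by simp)
    simpa using h2
  have l4 : Tendsto (fun N : ℕ => (((harmonic N : ℝ) - Real.log N : ℝ) : ℂ)) atTop
      (𝓝 (Real.eulerMascheroniConstant : ℂ)) :=
    (Complex.continuous_ofReal.tendsto _).comp Real.tendsto_harmonic_sub_log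
  have key : ∀ᶠ N : ℕ in atTop, ∑ n ∈ Finset.range N,
      (Complex.log ((n : ℂ) + z + 1) - Complex.log ((n : ℂ) + z) - 1 / ((n : ℂ) + z)) =
      (∑ n ∈ Finset.range N, (1 / ((n : ℂ) + 1) - 1 / ((n : ℂ) + z)))
        - (((harmonic N : ℝ) - Real.log N : ℝ) : ℂ) + Complex.log (1 + z / N) - Complex.log z := by
    filter_upwards [eventually_gt_atTop 0] with N hN
    have t1 : ∑ n ∈ Finset.range N, (Complex.log ((n : ℂ) + z + 1) - Complex.log ((n : ℂ) + z)) =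
        Complex.log (N + z) - Complex.log z := by
      have := Finset.sum_range_sub (fun n : ℕ => Complex.log ((n : ℂ) + z)) N
      simp only [Nat.cast_add, Nat.cast_one, Nat.cast_zero, zero_add] at this
      rw [← this]
      refine Finset.sum_congr rfl fun n _ => by rw [add_right_comm]
    have t2 : ((harmonic N : ℝ) : ℂ) = ∑ n ∈ Finset.range N, 1 / ((n : ℂ) + 1) := by
      rw [harmonic]; push_cast
      exact Finset.sum_congr rfl fun n _ => by rw [one_div]
    have t3 : Complex.log (N + z) = Complex.log (1 + z / N) + Real.log N := by
      have hN0 : (0 : ℝ) < N := by exact_mod_cast hN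
      have hNc : (N : ℂ) ≠ 0 := by exact_mod_cast hN.ne'
      have h5 : 1 + z / (N : ℂ) ≠ 0 := by
        intro h
        have h6 : (N : ℂ) + z = 0 := by
          have : (N : ℂ) + z = N * (1 + z / N) := by field_simp
          rw [this, h, mul_zero]
        have := congrArg Complex.re h6
        simp at this
        linarith
      have := Complex.log_ofReal_mul hN0 h5
      rw [add_comm (Complex.log _), ← this]
      congr 1
      push_cast
      field_simp
    rw [Finset.sum_sub_distrib, t1, t3, Finset.sum_sub_distrib, ← t2]
    push_cast
    ring
  have l5 := ((l2.sub l4).add l3).sub_const (Complex.log z)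
  have := tendsto_nhds_unique (l1.congr' key) l5
  rw [this, digamma_eq_tsum hz]
  ring

/-- Each summand of the previous series is bounded in terms of the real part alone, so the bound is
uniform in the imaginary part. An error `O(1)` in place of Stirling's formula is enough here. -/
theorem exists_norm_digamma_sub_log_le {a : ℝ} (ha : 0 < a) :
    ∃ C : ℝ, ∀ z : ℂ, a ≤ z.re → ‖Complex.digamma z - Complex.log z‖ ≤ C := by
  refine ⟨∑' n : ℕ, 1 / ((n : ℝ) + a) ^ 2, fun z hz => ?_⟩
  rw [digamma_eq_log_add_tsum (ha.trans_le hz), add_sub_cancel_left]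
  refine tsum_of_norm_bounded (summable_inv_nat_add_sq ha).hasSum fun n => ?_
  have h1 : (0 : ℝ) < n + a := by positivity
  have h2 : (n : ℝ) + a ≤ ((n : ℂ) + z).re := by simpa using hz
  refine (norm_log_add_one_sub_log_sub_inv_le (h1.trans_le h2)).trans ?_
  gcongr

/-! ### Zeros of entire functions and partial fractions of the logarithmic derivative. -/

theorem Differentiable.exists_eq_pow_mul {f : ℂ → ℂ} (hf : Differentiable ℂ f) {ρ : ℂ}
    (h : analyticOrderAt f ρ ≠ ⊤) :
    ∃ g : ℂ → ℂ, Differentiable ℂ g ∧ g ρ ≠ 0 ∧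
      ∀ z, f z = (z - ρ) ^ analyticOrderNatAt f ρ * g z := by
  classical
  obtain ⟨g₀, hg₀, hne, heq⟩ := ((hf.analyticAt ρ).analyticOrderAt_ne_top).1 h
  set n := analyticOrderNatAt f ρ
  set g : ℂ → ℂ := Function.update (fun z => f z / (z - ρ) ^ n) ρ (g₀ ρ)
  have hgρ : g ρ = g₀ ρ := by simp [g]
  have hgz : ∀ z, z ≠ ρ → g z = f z / (z - ρ) ^ n := fun z hz => by simp [g, hz]
  have hloc : g =ᶠ[𝓝 ρ] g₀ := by
    filter_upwards [heq] with z hz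
    by_cases hzρ : z = ρ
    · rw [hzρ, hgρ]
    · rw [hgz z hzρ, hz, smul_eq_mul, mul_div_cancel_left₀]
      exact pow_ne_zero _ (sub_ne_zero.2 hzρ)
  refine ⟨g, fun z => ?_, by rwa [hgρ], fun z => ?_⟩
  · by_cases hzρ : z = ρ
    · rw [hzρ]
      exact (hg₀.differentiableAt).congr_of_eventuallyEq hloc
    · have h1 : DifferentiableAt ℂ (fun z => f z / (z - ρ) ^ n) z :=
        (hf z).div (by fun_prop) (pow_ne_zero _ (sub_ne_zero.2 hzρ))
      refine h1.congr_of_eventuallyEq ?_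
      filter_upwards [isOpen_ne.mem_nhds hzρ] with y hy using hgz y hy
  · by_cases hzρ : z = ρ
    · rw [hzρ, hgρ]
      simpa using heq.self_of_nhds
    · rw [hgz z hzρ, mul_div_cancel₀]
      exact pow_ne_zero _ (sub_ne_zero.2 hzρ)

theorem Differentiable.exists_eq_prod_mul {f : ℂ → ℂ} (hf : Differentiable ℂ f)
    (h : ∀ z, analyticOrderAt f z ≠ ⊤) (Z : Finset ℂ) :
    ∃ g : ℂ → ℂ, Differentiable ℂ g ∧ (∀ ρ ∈ Z, g ρ ≠ 0) ∧
      ∀ z, f z = (∏ ρ ∈ Z, (z - ρ) ^ analyticOrderNatAt f ρ) * g z := by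
  classical
  induction Z using Finset.induction_on with
  | empty => exact ⟨f, hf, by simp, by simp⟩
  | insert ρ Z hρ ih =>
    obtain ⟨g, hg, hgZ, hfg⟩ := ih
    set P : ℂ → ℂ := fun z => ∏ ρ ∈ Z, (z - ρ) ^ analyticOrderNatAt f ρ
    have hP : Differentiable ℂ P := by fun_prop
    have hord : analyticOrderAt f ρ = analyticOrderAt g ρ := by
      have h1 : f = P * g := funext hfg
      have h2 : analyticOrderAt P ρ = 0 := by
        rw [(hP.analyticAt ρ).analyticOrderAt_eq_zero]
        refine Finset.prod_ne_zero_iff.2 fun σ hσ => pow_ne_zero _ (sub_ne_zero.2 ?_)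
        rintro rfl
        exact hρ hσ
      conv_lhs => rw [h1]
      rw [analyticOrderAt_mul (hP.analyticAt ρ) (hg.analyticAt ρ), h2, zero_add]
    have hordN : analyticOrderNatAt f ρ = analyticOrderNatAt g ρ := by
      rw [analyticOrderNatAt, hord, analyticOrderNatAt]
    obtain ⟨k, hk, hkρ, hgk⟩ := hg.exists_eq_pow_mul (hord ▸ h ρ)
    refine ⟨k, hk, ?_, fun z => ?_⟩
    · intro σ hσ
      rcases Finset.mem_insert.1 hσ with rfl | hσ
      · exact hkρ
      · intro h0
        exact hgZ σ hσ (by rw [hgk, h0, mul_zero])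
    · rw [hfg, hgk, Finset.prod_insert hρ, hordN]
      ring

/-- On the disc, `g = g(0) e^k` with `Re k ≤ M`. Borel–Carathéodory bounds `k` by `2M` on radius
`R/2`. Two Cauchy estimates with radius `R/8` then bound `k''`, the derivative of `g'/g`, by `128 M
/ R²` on radius `R/4`. -/
theorem norm_logDeriv_sub_le_of_nonvanishing {g : ℂ → ℂ} {R M : ℝ} (hR : 0 < R) (hM : 0 < M)
    (hg : Differentiable ℂ g) (h0 : ∀ z ∈ Metric.ball (0 : ℂ) R, g z ≠ 0)
    (hb : ∀ z ∈ Metric.ball (0 : ℂ) R, ‖g z‖ ≤ Real.exp M * ‖g 0‖) {s s' : ℂ}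
    (hs : ‖s‖ ≤ R / 4) (hs' : ‖s'‖ ≤ R / 4) :
    ‖logDeriv g s - logDeriv g s'‖ ≤ 128 * M / R ^ 2 * ‖s - s'‖ := by
  have hg0 : g 0 ≠ 0 := h0 0 (by simpa using hR)
  have hdl : DifferentiableOn ℂ (logDeriv g) (Metric.ball 0 R) := by
    have hd' : Differentiable ℂ (deriv g) := fun z => (hg.analyticAt z).deriv.differentiableAt
    intro z hz
    exact ((hd' z).div (hg z) (h0 z hz)).differentiableWithinAt
  obtain ⟨k, hk0, hk⟩ := (hdl.isExactOn_ball).with_val_at 0 0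
  have hkd : DifferentiableOn ℂ k (Metric.ball 0 R) := fun z hz =>
    (hk z hz).differentiableAt.differentiableWithinAt
  have hexp : ∀ z ∈ Metric.ball (0 : ℂ) R, g z = g 0 * Complex.exp (k z) := by
    intro z hz
    have hder : ∀ x ∈ Metric.ball (0 : ℂ) R, HasDerivAt (fun z => g z * Complex.exp (-k z)) 0 x := by
      intro x hx
      have h1 := (hg x).hasDerivAt.mul ((hk x hx).neg.cexp)
      refine h1.congr_deriv ?_
      rw [logDeriv_apply]
      have := h0 x hx
      field_simp
      ring
    have := (convex_ball (0 : ℂ) R).norm_image_sub_le_of_norm_hasDerivWithin_le (C := 0)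
      (fun x hx => (hder x hx).hasDerivWithinAt) (by simp) (by simpa using hR : (0 : ℂ) ∈ _) hz
    simp only [zero_mul, norm_le_zero_iff, sub_eq_zero, hk0, neg_zero, Complex.exp_zero, mul_one]
      at this
    rw [← this, mul_assoc, ← Complex.exp_add]
    simp
  have hre : Set.MapsTo k (Metric.ball 0 R) {z | z.re ≤ M} := by
    intro z hz
    have h1 := hb z hz
    rw [hexp z hz, norm_mul, mul_comm, Complex.norm_exp] at h1
    have h2 := le_of_mul_le_mul_right h1 (norm_pos_iff.2 hg0)
    exact Real.exp_le_exp.1 h2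
  have hk1 : ∀ z, ‖z‖ ≤ R / 2 → ‖k z‖ ≤ 2 * M := by
    intro z hz
    have h1 := Complex.borelCaratheodory_zero hM hkd hre hR (z := z) (by simp; linarith) hk0
    refine h1.trans ?_
    rw [div_le_iff₀ (by linarith)]
    nlinarith
  have hdiff : ∀ z : ℂ, ‖z‖ ≤ 3 * R / 8 → ‖deriv k z‖ ≤ 2 * M / (R / 8) := by
    intro z hz
    refine Complex.norm_deriv_le_of_forall_mem_sphere_norm_le (by positivity) ?_ ?_
    · refine hkd.diffContOnCl_ball ?_
      intro x hx
      rw [mem_ball_zero_iff]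
      rw [Metric.mem_closedBall, dist_eq_norm] at hx
      have := norm_le_norm_sub_add x z
      linarith
    · intro x hx
      refine hk1 x ?_
      rw [mem_sphere_iff_norm] at hx
      have := norm_le_norm_sub_add x z
      linarith
  have hderiv : ∀ z ∈ Metric.ball (0 : ℂ) R, deriv k z = logDeriv g z := fun z hz => (hk z hz).deriv
  have hsecond : ∀ z ∈ Metric.closedBall (0 : ℂ) (R / 4), ‖deriv (logDeriv g) z‖ ≤ 128 * M / R ^ 2 := by
    intro z hz
    rw [mem_closedBall_zero_iff] at hz
    have := Complex.norm_deriv_le_of_forall_mem_sphere_norm_le (f := logDeriv g) (c := z)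
      (R := R / 8) (C := 2 * M / (R / 8)) (by positivity) ?_ ?_
    · refine this.trans (le_of_eq ?_)
      field_simp
      norm_num
    · refine hdl.diffContOnCl_ball ?_
      intro x hx
      rw [mem_ball_zero_iff]
      rw [Metric.mem_closedBall, dist_eq_norm] at hx
      have := norm_le_norm_sub_add x z
      linarith
    · intro x hx
      rw [mem_sphere_iff_norm] at hx
      have := norm_le_norm_sub_add x z
      rw [← hderiv x (by rw [mem_ball_zero_iff]; linarith)]
      exact hdiff x (by linarith)
  refine (convex_closedBall (0 : ℂ) (R / 4)).norm_image_sub_le_of_norm_deriv_le (𝕜 := ℂ) ?_ hsecond ?_ ?_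
  · intro x hx
    rw [mem_closedBall_zero_iff] at hx
    have hx' : x ∈ Metric.ball (0 : ℂ) R := by rw [mem_ball_zero_iff]; linarith
    exact (hdl x hx').differentiableAt (Metric.isOpen_ball.mem_nhds hx')
  · simpa using hs'
  · simpa using hs

theorem logDeriv_prod_sub_pow {Z : Finset ℂ} {m : ℂ → ℕ} {g : ℂ → ℂ} {s : ℂ}
    (hg : Differentiable ℂ g) (hgs : g s ≠ 0) (hs : ∀ ρ ∈ Z, m ρ ≠ 0 → s ≠ ρ) :
    logDeriv (fun z => (∏ ρ ∈ Z, (z - ρ) ^ m ρ) * g z) s =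
      ∑ ρ ∈ Z, (m ρ : ℂ) * (1 / (s - ρ)) + logDeriv g s := by
  have hne : ∀ ρ ∈ Z, (s - ρ) ^ m ρ ≠ 0 := by
    intro ρ hρ
    by_cases h : m ρ = 0
    · simp [h]
    · exact pow_ne_zero _ (sub_ne_zero.2 (hs ρ hρ h))
  rw [logDeriv_mul s (Finset.prod_ne_zero_iff.2 hne) hgs (by fun_prop) (hg s)]
  congr 1
  have := logDeriv_prod (s := Z) (f := fun ρ z => (z - ρ) ^ m ρ) (x := s) hne
    (fun ρ _ => by fun_prop)
  rw [show (fun z => ∏ ρ ∈ Z, (z - ρ) ^ m ρ) = ∏ ρ ∈ Z, (fun z => (z - ρ) ^ m ρ) from by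
    ext z; simp]
  rw [show (∏ ρ ∈ Z, (fun z => (z - ρ) ^ m ρ)) = (∏ ρ ∈ Z, (fun ρ z => (z - ρ) ^ m ρ) ρ) from rfl]
  refine Eq.trans ?_ (this.trans (Finset.sum_congr rfl fun ρ hρ => ?_))
  · congr 1
    ext z
    simp
  · have h1 := logDeriv_fun_pow (f := fun z : ℂ => z - ρ) (x := s) (by fun_prop) (m ρ)
    rw [h1]
    congr 1
    rw [logDeriv_apply]
    simp

/-- The zeros within `2r` of `c` are divided out. On the circle of radius `4r` each factor satisfies
`|z - ρ| ≥ 2r ≥ |c - ρ|`, so the quotient keeps the bound of `f` relative to its value at `c`, and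
by the maximum principle also inside. It has no zero within `2r`, where the previous estimate
applies. -/
theorem norm_logDeriv_sub_sub_sum_le {f : ℂ → ℂ} (hf : Differentiable ℂ f) {c : ℂ} (hc : f c ≠ 0)
    {r M : ℝ} (hr : 0 < r) (hM : 0 < M) {Z : Finset ℂ}
    (hZ : ∀ ρ, ρ ∈ Z ↔ f ρ = 0 ∧ ‖ρ - c‖ ≤ 2 * r)
    (hb : ∀ z, ‖z - c‖ = 4 * r → ‖f z‖ ≤ Real.exp M * ‖f c‖) {s s' : ℂ}
    (hs : ‖s - c‖ ≤ r / 2) (hs' : ‖s' - c‖ ≤ r / 2) (hfs : f s ≠ 0) (hfs' : f s' ≠ 0) :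
    ‖logDeriv f s - logDeriv f s' - ∑ ρ ∈ Z,
      (analyticOrderNatAt f ρ : ℂ) * (1 / (s - ρ) - 1 / (s' - ρ))‖ ≤ 32 * M / r ^ 2 * ‖s - s'‖ := by
  have htop : ∀ z, analyticOrderAt f z ≠ ⊤ := fun z h =>
    hc (by rw [(AnalyticOnNhd.analyticOrderAt_eq_top_iff_eq_zero z fun z => hf.analyticAt z).1 h]; rfl)
  obtain ⟨g, hg, hgZ, hfg⟩ := hf.exists_eq_prod_mul htop Z
  have hg0 : ∀ z, f z ≠ 0 → g z ≠ 0 := fun z hz h => hz (by rw [hfg, h, mul_zero])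
  set P : ℂ → ℂ := fun z => ∏ ρ ∈ Z, (z - ρ) ^ analyticOrderNatAt f ρ with hPdef
  have hfP : f = fun z => P z * g z := funext hfg
  have hl : ∀ z, f z ≠ 0 → logDeriv f z =
      ∑ ρ ∈ Z, (analyticOrderNatAt f ρ : ℂ) * (1 / (z - ρ)) + logDeriv g z := by
    intro z hz
    conv_lhs => rw [hfP]
    refine logDeriv_prod_sub_pow hg (hg0 z hz) fun ρ hρ _ h => hz ?_
    rw [h]; exact ((hZ ρ).1 hρ).1
  have hnv : ∀ z ∈ Metric.ball (0 : ℂ) (2 * r), g (c + z) ≠ 0 := by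
    intro z hz h
    have h1 : f (c + z) = 0 := by rw [hfg, h, mul_zero]
    refine hgZ (c + z) ((hZ _).2 ⟨h1, ?_⟩) h
    simpa using (mem_ball_zero_iff.1 hz).le
  have hPc : P c ≠ 0 := fun h => hc (by rw [hfP]; simp [h])
  have hfr : ∀ z ∈ frontier (Metric.ball c (4 * r)), ‖g z‖ ≤ Real.exp M * ‖g c‖ := by
    intro z hz
    rw [frontier_ball c (by positivity), mem_sphere_iff_norm] at hz
    have h1 := hb z hz
    have h2 : ‖P c‖ ≤ ‖P z‖ := by
      simp only [hPdef, norm_prod, norm_pow]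
      refine Finset.prod_le_prod (fun _ _ => by positivity) fun ρ hρ => ?_
      have h3 := ((hZ ρ).1 hρ).2
      have h4 : ‖z - c‖ ≤ ‖z - ρ‖ + ‖ρ - c‖ := norm_sub_le_norm_sub_add_norm_sub z ρ c
      rw [norm_sub_rev c ρ]
      gcongr
      linarith
    rw [hfg, hfg c, norm_mul, norm_mul] at h1
    have h5 : 0 < ‖P c‖ := norm_pos_iff.2 hPc
    have h6 : ‖P c‖ * ‖g z‖ ≤ ‖P c‖ * (Real.exp M * ‖g c‖) :=
      calc ‖P c‖ * ‖g z‖ ≤ ‖P z‖ * ‖g z‖ := by gcongr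
        _ ≤ _ := h1
        _ = _ := by ring
    exact le_of_mul_le_mul_left h6 h5
  have hgb : ∀ z ∈ Metric.ball (0 : ℂ) (2 * r), ‖g (c + z)‖ ≤ Real.exp M * ‖g (c + 0)‖ := by
    intro z hz
    rw [add_zero]
    refine Complex.norm_le_of_forall_mem_frontier_norm_le Metric.isBounded_ball
      (hg.diffContOnCl) hfr (subset_closure ?_)
    rw [Metric.mem_ball, dist_eq_norm, add_sub_cancel_left]
    have := mem_ball_zero_iff.1 hz
    linarith
  have hgc : Differentiable ℂ fun z => g (c + z) := by fun_prop
  have hmain := norm_logDeriv_sub_le_of_nonvanishing (by positivity : 0 < 2 * r) hM hgc hnv hgb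
    (s := s - c) (s' := s' - c) (by linarith) (by linarith)
  have hshift : ∀ z, logDeriv (fun z => g (c + z)) (z - c) = logDeriv g z := by
    intro z
    rw [logDeriv_apply, logDeriv_apply, deriv_comp_const_add]
    simp
  rw [hshift, hshift, sub_sub_sub_cancel_right] at hmain
  rw [hl s hfs, hl s' hfs']
  have : ∑ ρ ∈ Z, (analyticOrderNatAt f ρ : ℂ) * (1 / (s - ρ) - 1 / (s' - ρ)) =
      ∑ ρ ∈ Z, (analyticOrderNatAt f ρ : ℂ) * (1 / (s - ρ)) -
      ∑ ρ ∈ Z, (analyticOrderNatAt f ρ : ℂ) * (1 / (s' - ρ)) := by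
    rw [← Finset.sum_sub_distrib]
    exact Finset.sum_congr rfl fun _ _ => by ring
  rw [this]
  calc _ = ‖logDeriv g s - logDeriv g s'‖ := by congr 1; ring
    _ ≤ _ := hmain
    _ = _ := by field_simp; ring

theorem finite_zeros_closedBall {f : ℂ → ℂ} (hf : Differentiable ℂ f) {c : ℂ} (hc : f c ≠ 0)
    (a : ℂ) (r : ℝ) : {ρ | f ρ = 0 ∧ ‖ρ - a‖ ≤ r}.Finite := by
  have h := AnalyticOnNhd.preimage_zero_mem_codiscrete (fun z _ => hf.analyticAt z) hc
  have h2 := mem_codiscrete'.1 h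
  have h3 : (f ⁻¹' {0}ᶜ)ᶜ = {ρ | f ρ = 0} := by ext; simp
  rw [h3] at h2
  have hcl : IsClosed {ρ | f ρ = 0} := isClosed_eq hf.continuous continuous_const
  have h4 := ((isCompact_closedBall a r).inter_right hcl).finite (h2.2.mono Set.inter_subset_right)
  refine h4.subset fun ρ hρ => ⟨?_, hρ.1⟩
  rw [Metric.mem_closedBall, dist_eq_norm]
  exact hρ.2

/-- On radius `4r` the logarithm of the growth is `M = O(r^{3/2})`, so the error `M / r²` vanishes
in the limit. This is the part of Hadamard's factorization that is needed: an order below two leaves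
no extra term in the difference of two values of `f'/f`. -/
theorem tendsto_sum_zeros_logDeriv_sub {f : ℂ → ℂ} (hf : Differentiable ℂ f) {c : ℂ} (hc : f c ≠ 0)
    {B : ℝ} (hB : ∀ z : ℂ, 2 ≤ ‖z‖ → ‖f z‖ ≤ B * Real.exp (‖z‖ ^ (1 + 1 / 2 : ℝ))) {s s' : ℂ}
    (hfs : f s ≠ 0) (hfs' : f s' ≠ 0) :
    Tendsto (fun r : ℝ => ∑ ρ ∈ (finite_zeros_closedBall hf hc c (2 * r)).toFinset,
      (analyticOrderNatAt f ρ : ℂ) * (1 / (s - ρ) - 1 / (s' - ρ))) atTop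
      (𝓝 (logDeriv f s - logDeriv f s')) := by
  rw [tendsto_iff_norm_sub_tendsto_zero]
  set K : ℝ := |Real.log ((|B| + 1) / ‖f c‖)| + 1
  have hlim : Tendsto (fun r : ℝ => 32 * ‖s - s'‖ * (K * r ^ (-2 : ℝ) +
      (5 : ℝ) ^ (3 / 2 : ℝ) * r ^ (-(1 / 2) : ℝ))) atTop (𝓝 (32 * ‖s - s'‖ * (K * 0 + (5 : ℝ) ^ (3 / 2 : ℝ) * 0))) :=
    (((tendsto_rpow_neg_atTop (by norm_num)).const_mul K).add
      ((tendsto_rpow_neg_atTop (by norm_num)).const_mul _)).const_mul _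
  simp only [mul_zero, add_zero] at hlim
  refine squeeze_zero' (Eventually.of_forall fun _ => norm_nonneg _) ?_ hlim
  filter_upwards [eventually_ge_atTop (max (‖c‖ + 1) (max (2 * ‖s - c‖) (2 * ‖s' - c‖)))] with r hr
  have hr1 : ‖c‖ + 1 ≤ r := (le_max_left _ _).trans hr
  have hr2 : 2 * ‖s - c‖ ≤ r := (le_max_left _ _).trans ((le_max_right _ _).trans hr)
  have hr3 : 2 * ‖s' - c‖ ≤ r := (le_max_right _ _).trans ((le_max_right _ _).trans hr)
  have hr0 : 0 < r := lt_of_lt_of_le (by positivity) hr1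
  have h5 : (5 : ℝ) ^ (3 / 2 : ℝ) * r ^ (3 / 2 : ℝ) = (5 * r) ^ (3 / 2 : ℝ) :=
    (Real.mul_rpow (by norm_num) hr0.le).symm
  set M : ℝ := K + (5 : ℝ) ^ (3 / 2 : ℝ) * r ^ (3 / 2 : ℝ)
  have hfc : 0 < ‖f c‖ := norm_pos_iff.2 hc
  have hM : 0 < M := by positivity
  have hb : ∀ z, ‖z - c‖ = 4 * r → ‖f z‖ ≤ Real.exp M * ‖f c‖ := by
    intro z hz
    have h1 : ‖z - c‖ ≤ ‖z‖ + ‖c‖ := norm_sub_le z c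
    have h2 : ‖z‖ ≤ ‖z - c‖ + ‖c‖ := norm_le_norm_sub_add z c
    have h3 : 2 ≤ ‖z‖ := by linarith [norm_nonneg c]
    have h4 : ‖z‖ ≤ 5 * r := by linarith
    calc ‖f z‖ ≤ B * Real.exp (‖z‖ ^ (1 + 1 / 2 : ℝ)) := hB z h3
      _ ≤ (|B| + 1) * Real.exp ((5 * r) ^ (3 / 2 : ℝ)) := by
          have : B ≤ |B| + 1 := by linarith [le_abs_self B]
          gcongr
          calc ‖z‖ ^ (1 + 1 / 2 : ℝ) = ‖z‖ ^ (3 / 2 : ℝ) := by norm_num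
            _ ≤ _ := by gcongr
      _ = Real.exp (Real.log ((|B| + 1) / ‖f c‖) + (5 * r) ^ (3 / 2 : ℝ)) * ‖f c‖ := by
          rw [Real.exp_add, Real.exp_log (by positivity)]
          field_simp
      _ ≤ _ := by
          gcongr
          simp only [M, K, h5]
          linarith [le_abs_self (Real.log ((|B| + 1) / ‖f c‖))]
  rw [norm_sub_rev]
  refine (norm_logDeriv_sub_sub_sum_le hf hc hr0 hM (fun ρ => by simp) hb (by linarith)
    (by linarith) hfs hfs').trans (le_of_eq ?_)
  have e1 : r ^ (-2 : ℝ) = (r ^ 2)⁻¹ := by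
    rw [Real.rpow_neg hr0.le]; norm_num
  have e2 : r ^ (-(1 / 2) : ℝ) = r ^ (3 / 2 : ℝ) * (r ^ 2)⁻¹ := by
    rw [← e1, ← Real.rpow_add hr0]; norm_num
  rw [e1, e2]
  simp only [M]
  field_simp

theorem logDeriv_one_sub_of_symm {f : ℂ → ℂ} (hf : Differentiable ℂ f) {ε : ℂ} (hε : ε ≠ 0)
    (hsym : ∀ s, f s = ε * f (1 - s)) (s : ℂ) : logDeriv f (1 - s) = -logDeriv f s := by
  have h1 : HasDerivAt f (ε * (deriv f (1 - s) * (-1))) s := by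
    have h2 : HasDerivAt (fun z => f (1 - z)) (deriv f (1 - s) * (-1)) s :=
      (hf (1 - s)).hasDerivAt.comp s ((hasDerivAt_id s).const_sub 1)
    exact (h2.const_mul ε).congr_of_eventuallyEq (Eventually.of_forall hsym)
  rw [logDeriv_apply, logDeriv_apply, h1.deriv, hsym s, mul_div_mul_left _ _ hε]
  ring

theorem one_add_norm_le_of_re {s ρ : ℂ} {δ : ℝ} (hδ : 0 < δ) (h : δ ≤ |(s - ρ).re|) :
    1 + ‖ρ‖ ≤ ((‖s‖ + 2) / δ + 1) * ‖s - ρ‖ := by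
  have h1 : δ ≤ ‖s - ρ‖ := h.trans (Complex.abs_re_le_norm _)
  have h2 : ‖ρ‖ ≤ ‖s‖ + ‖s - ρ‖ := by
    calc ‖ρ‖ = ‖s - (s - ρ)‖ := by congr 1; ring
      _ ≤ _ := norm_sub_le _ _
  have h3 : ‖s‖ + 2 ≤ (‖s‖ + 2) / δ * ‖s - ρ‖ := by
    rw [div_mul_eq_mul_div, le_div_iff₀ hδ]
    gcongr
  linarith

/-- Over a common denominator the numerator of the pair is `2s - 1`, independent of `ρ`, which
leaves quadratic decay in `ρ`. The dependence on `s` is explicit because `s` later runs over a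
vertical line. -/
theorem norm_zero_pair_le {s ρ : ℂ} {δ : ℝ} (hδ : 0 < δ) (hs : 1 + δ ≤ s.re) (h0 : 0 ≤ ρ.re)
    (h1 : ρ.re ≤ 1) :
    ‖1 / (s - ρ) + 1 / (s - (1 - ρ))‖ ≤
      (2 * ‖s‖ + 1) * ((‖s‖ + 2) / δ + 1) ^ 2 * (2 / (1 + ‖ρ‖ ^ 2)) := by
  have a1 : δ ≤ (s - ρ).re := by simp; linarith
  have a2 : δ ≤ (s - (1 - ρ)).re := by simp; linarith
  have b1 := one_add_norm_le_of_re hδ (a1.trans (le_abs_self _))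
  have b2 := one_add_norm_le_of_re hδ (a2.trans (le_abs_self _))
  have n1 : 0 < ‖s - ρ‖ := lt_of_lt_of_le hδ (a1.trans (Complex.re_le_norm _))
  have n2 : 0 < ‖s - (1 - ρ)‖ := lt_of_lt_of_le hδ (a2.trans (Complex.re_le_norm _))
  have z1 := norm_pos_iff.1 n1
  have z2 := norm_pos_iff.1 n2
  set K := (‖s‖ + 2) / δ + 1
  have hK : 0 < K := by positivity
  have b2' : 1 + ‖ρ‖ ≤ (K + K) * ‖s - (1 - ρ)‖ := by
    have h3 : ‖ρ‖ ≤ 1 + ‖1 - ρ‖ := by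
      calc ‖ρ‖ = ‖1 - (1 - ρ)‖ := by congr 1; ring
        _ ≤ ‖(1 : ℂ)‖ + ‖1 - ρ‖ := norm_sub_le _ _
        _ = _ := by simp
    linarith [norm_nonneg (1 - ρ)]
  have e : 1 / (s - ρ) + 1 / (s - (1 - ρ)) = (2 * s - 1) / ((s - ρ) * (s - (1 - ρ))) := by
    field_simp
    ring
  rw [e, norm_div, norm_mul]
  have c1 : ‖2 * s - 1‖ ≤ 2 * ‖s‖ + 1 := by
    refine (norm_sub_le _ _).trans ?_
    simp
  have c2 : (1 + ‖ρ‖ ^ 2) ≤ 2 * K ^ 2 * (‖s - ρ‖ * ‖s - (1 - ρ)‖) := by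
    have := mul_le_mul b1 b2' (by positivity) (by positivity)
    nlinarith [norm_nonneg ρ]
  rw [div_le_iff₀ (by positivity)]
  calc ‖2 * s - 1‖ ≤ 2 * ‖s‖ + 1 := c1
    _ = (2 * ‖s‖ + 1) * ((1 + ‖ρ‖ ^ 2) / (1 + ‖ρ‖ ^ 2)) := by field_simp
    _ ≤ (2 * ‖s‖ + 1) * ((2 * K ^ 2 * (‖s - ρ‖ * ‖s - (1 - ρ)‖)) / (1 + ‖ρ‖ ^ 2)) := by gcongr
    _ = _ := by ring

/-- At `s = 2` both fractions have nonnegative real part on the critical strip, and the first is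
bounded below. This positivity gives the convergence of `∑ 1/(1+|ρ|²)` without a count of zeros. -/
theorem re_zero_pair_ge {ρ : ℂ} (h0 : 0 ≤ ρ.re) (h1 : ρ.re ≤ 1) :
    1 / (8 * (1 + ‖ρ‖ ^ 2)) ≤ (1 / (2 - ρ) + 1 / (2 - (1 - ρ))).re := by
  have a1 : (1 : ℝ) ≤ (2 - ρ).re := by simp; linarith
  have a2 : (0 : ℝ) ≤ (2 - (1 - ρ)).re := by simp; linarith
  have n1 : 0 < ‖2 - ρ‖ := lt_of_lt_of_le one_pos (a1.trans (Complex.re_le_norm _))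
  have e1 : ‖2 - ρ‖ ≤ 2 + ‖ρ‖ := by
    refine (norm_sub_le _ _).trans ?_
    simp
  rw [Complex.add_re, one_div (2 - ρ), one_div (2 - (1 - ρ)), Complex.inv_re, Complex.inv_re,
    Complex.normSq_eq_norm_sq]
  have f1 : 1 / (8 * (1 + ‖ρ‖ ^ 2)) ≤ (2 - ρ).re / ‖2 - ρ‖ ^ 2 := by
    rw [div_le_div_iff₀ (by positivity) (by positivity)]
    nlinarith [sq_nonneg (‖ρ‖ - 2), norm_nonneg ρ, mul_self_le_mul_self n1.le e1]
  have f2 : 0 ≤ (2 - (1 - ρ)).re / Complex.normSq (2 - (1 - ρ)) :=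
    div_nonneg a2 (Complex.normSq_nonneg _)
  linarith

/-- Partial fractions of `f'/f` for an entire function of order less than two that is symmetric
under `s ↦ 1 - s` and has its zeros in the critical strip. -/
theorem partial_fractions_of_symm {f : ℂ → ℂ} (hf : Differentiable ℂ f)
    {B : ℝ} (hB : ∀ z : ℂ, 2 ≤ ‖z‖ → ‖f z‖ ≤ B * Real.exp (‖z‖ ^ (1 + 1 / 2 : ℝ)))
    {ε : ℂ} (hε : ε ≠ 0) (hsym : ∀ s, f s = ε * f (1 - s)) {S : Set ℂ}
    (hS : ∀ ρ, ρ ∈ S ↔ f ρ = 0) (hstrip : ∀ ρ ∈ S, 0 ≤ ρ.re ∧ ρ.re ≤ 1) :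
    (Summable fun ρ : S => (analyticOrderNatAt f ρ : ℝ) * (1 / (1 + ‖(ρ : ℂ)‖ ^ 2))) ∧
    ∀ s : ℂ, 1 < s.re → HasSum (fun ρ : S => (analyticOrderNatAt f ρ : ℂ) *
      (1 / (s - ρ) + 1 / (s - (1 - ρ)))) (2 * logDeriv f s) := by
  classical
  have hne : ∀ s : ℂ, 1 < s.re → f s ≠ 0 := fun s hs h => by
    have := (hstrip s ((hS s).2 h)).2
    linarith
  have hne' : ∀ s : ℂ, 1 < s.re → f (1 - s) ≠ 0 := fun s hs h => by
    refine hne s hs ?_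
    rw [hsym, h, mul_zero]
  have hc : f 2 ≠ 0 := hne 2 (by norm_num)
  set Zr : ℝ → Finset S := fun r => (finite_zeros_closedBall hf hc 2 (2 * r)).toFinset.subtype (· ∈ S)
  have hZr : ∀ (r : ℝ) (u : ℂ → ℂ), ∑ ρ ∈ Zr r, u ρ =
      ∑ ρ ∈ (finite_zeros_closedBall hf hc 2 (2 * r)).toFinset, u ρ := by
    intro r u
    rw [← Finset.sum_subtype_of_mem (p := (· ∈ S)) u]
    intro x hx
    simp only [Set.Finite.mem_toFinset, Set.mem_ofPred_eq] at hx
    exact (hS x).2 hx.1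
  have hZmem : ∀ r (ρ : S), ρ ∈ Zr r ↔ ‖(ρ : ℂ) - 2‖ ≤ 2 * r := by
    intro r ρ
    have := (hS ρ).1 ρ.2
    simp [Zr, this]
  have hlim : ∀ s : ℂ, 1 < s.re → Tendsto (fun r : ℝ => ∑ ρ ∈ Zr r,
      (analyticOrderNatAt f ρ : ℂ) * (1 / (s - ρ) + 1 / (s - (1 - ρ)))) atTop
      (𝓝 (2 * logDeriv f s)) := by
    intro s hs
    -- The second point is `1 - s`: by symmetry the difference of logarithmic derivatives is `2
    -- f'/f(s)`, and `-1/((1-s)-ρ)` is `1/(s-(1-ρ))`.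
    have h1 := tendsto_sum_zeros_logDeriv_sub hf hc hB (hne s hs) (hne' s hs)
    rw [logDeriv_one_sub_of_symm hf hε hsym, sub_neg_eq_add, ← two_mul] at h1
    refine h1.congr fun r => ?_
    rw [hZr r fun ρ => (analyticOrderNatAt f ρ : ℂ) * (1 / (s - ρ) + 1 / (s - (1 - ρ)))]
    refine Finset.sum_congr rfl fun ρ _ => ?_
    congr 1
    rw [sub_eq_add_neg, ← div_neg]
    congr 2
    ring
  have hev : ∀ u : Finset S, ∀ᶠ r in atTop, u ⊆ Zr r := by
    intro u
    have : ∀ ρ ∈ u, ∀ᶠ r in atTop, ρ ∈ Zr r := fun ρ _ => by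
      filter_upwards [eventually_ge_atTop (‖(ρ : ℂ) - 2‖)] with r hr
      rw [hZmem]
      linarith [norm_nonneg ((ρ : ℂ) - 2)]
    exact (Filter.eventually_all_finset u).2 this
  have hZtop : Tendsto Zr atTop atTop := by
    rw [tendsto_atTop]
    exact hev
  -- Every finite set of zeros lies in a large disc, and the real parts of the disc sums at `s = 2`
  -- converge. As their terms are nonnegative, they bound all finite sums.
  have hsum : Summable fun ρ : S => (analyticOrderNatAt f ρ : ℝ) * (1 / (8 * (1 + ‖(ρ : ℂ)‖ ^ 2))) := by
    refine summable_of_sum_le (c := (2 * logDeriv f 2).re) (fun ρ => by positivity) fun u => ?_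
    have h1 := (Complex.continuous_re.tendsto _).comp (hlim 2 (by norm_num))
    refine ge_of_tendsto h1 ?_
    filter_upwards [hev u] with r hr
    simp only [Function.comp_apply, Complex.re_sum]
    have hterm : ∀ ρ : S, (analyticOrderNatAt f ρ : ℝ) * (1 / (8 * (1 + ‖(ρ : ℂ)‖ ^ 2))) ≤
        ((analyticOrderNatAt f ρ : ℂ) * (1 / (2 - (ρ : ℂ)) + 1 / (2 - (1 - ρ)))).re := by
      intro ρ
      rw [← Complex.ofReal_natCast, Complex.re_ofReal_mul]
      have := hstrip ρ ρ.2
      gcongr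
      exact re_zero_pair_ge this.1 this.2
    calc _ ≤ ∑ ρ ∈ Zr r, (analyticOrderNatAt f ρ : ℝ) * (1 / (8 * (1 + ‖(ρ : ℂ)‖ ^ 2))) :=
          Finset.sum_le_sum_of_subset_of_nonneg hr fun _ _ _ => by positivity
      _ ≤ _ := Finset.sum_le_sum fun ρ _ => hterm ρ
  have hsum' : Summable fun ρ : S => (analyticOrderNatAt f ρ : ℝ) * (1 / (1 + ‖(ρ : ℂ)‖ ^ 2)) := by
    refine (hsum.mul_left 8).congr fun ρ => ?_
    field_simp
  refine ⟨hsum', fun s hs => ?_⟩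
  have hss : Summable fun ρ : S => (analyticOrderNatAt f ρ : ℂ) *
      (1 / (s - ρ) + 1 / (s - (1 - ρ))) := by
    set δ := s.re - 1
    have hδ : 0 < δ := by simp only [δ]; linarith
    refine Summable.of_norm_bounded
      (hsum'.mul_left ((2 * ‖s‖ + 1) * ((‖s‖ + 2) / δ + 1) ^ 2 * 2)) fun ρ => ?_
    rw [norm_mul, Complex.norm_natCast]
    have h := hstrip ρ ρ.2
    have := norm_zero_pair_le (s := s) hδ (by simp [δ]) h.1 h.2
    calc _ ≤ (analyticOrderNatAt f ρ : ℝ) *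
          ((2 * ‖s‖ + 1) * ((‖s‖ + 2) / δ + 1) ^ 2 * (2 / (1 + ‖(ρ : ℂ)‖ ^ 2))) := by gcongr
      _ = _ := by ring
  -- The limit was taken along growing discs; absolute convergence makes it the unordered sum.
  have h2 := tendsto_nhds_unique (hlim s hs) (hss.hasSum.comp hZtop)
  rw [h2]
  exact hss.hasSum

/-! ### Chebyshev-type bounds for prime ideals. -/

section PrimeSums

variable {F : Type*} [Field F] [NumberField F]

theorem primeNorm_ne_zero (p : HeightOneSpectrum (𝓞 F)) : primeNorm p ≠ 0 := by
  rw [primeNorm, Ne, Ideal.absNorm_eq_zero_iff]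
  exact p.ne_bot

theorem two_le_primeNorm (p : HeightOneSpectrum (𝓞 F)) : 2 ≤ primeNorm p := by
  have h1 : primeNorm p ≠ 1 := by
    rw [primeNorm, Ne, Ideal.absNorm_eq_one_iff]
    exact p.isPrime.ne_top
  have := primeNorm_ne_zero p
  omega

theorem two_le_primeNorm_real (p : HeightOneSpectrum (𝓞 F)) : (2 : ℝ) ≤ primeNorm p := by
  exact_mod_cast two_le_primeNorm p

theorem primeNorm_pos_real (p : HeightOneSpectrum (𝓞 F)) : (0 : ℝ) < primeNorm p := by
  linarith [two_le_primeNorm_real p]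

theorem log_primeNorm_pos (p : HeightOneSpectrum (𝓞 F)) : 0 < Real.log (primeNorm p) :=
  Real.log_pos (by linarith [two_le_primeNorm_real p])

theorem log_two_le_log_primeNorm (p : HeightOneSpectrum (𝓞 F)) :
    Real.log 2 ≤ Real.log (primeNorm p) :=
  Real.log_le_log two_pos (two_le_primeNorm_real p)

theorem mem_primesLE {x : ℝ} {p : HeightOneSpectrum (𝓞 F)} :
    p ∈ primesLE F x ↔ (primeNorm p : ℝ) ≤ x := by
  simp [primesLE]

theorem exists_prime_dvd_primeNorm (p : HeightOneSpectrum (𝓞 F)) :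
    ∃ q : ℕ, q.Prime ∧ q ∣ primeNorm p ∧ (q : 𝓞 F) ∈ p.asIdeal := by
  have key : ∀ m : ℕ, m ≠ 0 → (m : 𝓞 F) ∈ p.asIdeal →
      ∃ q : ℕ, q.Prime ∧ q ∣ m ∧ (q : 𝓞 F) ∈ p.asIdeal := by
    intro m
    induction m using Nat.recOnMul with
    | zero => simp
    | one =>
      intro _ h
      rw [Nat.cast_one] at h
      exact absurd ((Ideal.eq_top_iff_one _).2 h) p.isPrime.ne_top
    | prime q hq => exact fun _ h => ⟨q, hq, dvd_rfl, h⟩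
    | mul a b iha ihb =>
      intro h0 h
      rw [Nat.cast_mul] at h
      have ha0 : a ≠ 0 := fun h => h0 (by simp [h])
      have hb0 : b ≠ 0 := fun h => h0 (by simp [h])
      rcases p.isPrime.mem_or_mem h with h | h
      · obtain ⟨q, h1, h2, h3⟩ := iha ha0 h
        exact ⟨q, h1, h2.mul_right b, h3⟩
      · obtain ⟨q, h1, h2, h3⟩ := ihb hb0 h
        exact ⟨q, h1, h2.mul_left a, h3⟩
  exact key _ (primeNorm_ne_zero p) (Ideal.absNorm_mem _)

/-- A rational prime contained in `𝔭`. -/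
def primeBelow (p : HeightOneSpectrum (𝓞 F)) : ℕ := (exists_prime_dvd_primeNorm p).choose

theorem prime_primeBelow (p : HeightOneSpectrum (𝓞 F)) : (primeBelow p).Prime :=
  (exists_prime_dvd_primeNorm p).choose_spec.1

theorem primeBelow_le (p : HeightOneSpectrum (𝓞 F)) : primeBelow p ≤ primeNorm p :=
  Nat.le_of_dvd (Nat.pos_of_ne_zero (primeNorm_ne_zero p))
    (exists_prime_dvd_primeNorm p).choose_spec.2.1

theorem primeBelow_mem (p : HeightOneSpectrum (𝓞 F)) : (primeBelow p : 𝓞 F) ∈ p.asIdeal :=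
  (exists_prime_dvd_primeNorm p).choose_spec.2.2

/-- The distinct primes over `q` are coprime, so their product divides `(q)`, and the norm of `(q)`
is `q ^ n`. This reduces Chebyshev's bound for `F` to the one for `ℚ`. -/
theorem sum_log_primeNorm_le_of_primeBelow_eq {q : ℕ} (hq : q.Prime)
    (T : Finset (HeightOneSpectrum (𝓞 F))) (hT : ∀ p ∈ T, primeBelow p = q) :
    ∑ p ∈ T, Real.log (primeNorm p) ≤ Module.finrank ℚ F * Real.log q := by
  have hdvd : ∏ p ∈ T, p.asIdeal ∣ Ideal.span {(q : 𝓞 F)} := by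
    refine Finset.prod_dvd_of_coprime (fun p _ p' _ hne => ?_) fun p hp => ?_
    · have := p.isMaximal
      have := p'.isMaximal
      exact Ideal.isCoprime_of_isMaximal fun h => hne (HeightOneSpectrum.ext h)
    · rw [Ideal.dvd_span_singleton, ← hT p hp]
      exact primeBelow_mem p
  have h1 := Ideal.absNorm_dvd_absNorm_of_le (Ideal.le_of_dvd hdvd)
  rw [Ideal.absNorm_span_natCast, map_prod, RingOfIntegers.rank] at h1
  have h2 := Nat.le_of_dvd (pow_pos hq.pos _) h1
  have h3 : (∏ p ∈ T, (primeNorm p : ℝ)) ≤ (q : ℝ) ^ Module.finrank ℚ F := by exact_mod_cast h2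
  rw [← Real.log_pow, ← Real.log_prod fun p _ => (primeNorm_pos_real p).ne']
  exact Real.log_le_log (Finset.prod_pos fun p _ => primeNorm_pos_real p) h3

theorem sum_log_primeNorm_le {x : ℝ} (hx : 0 ≤ x) :
    ∑ p ∈ primesLE F x, Real.log (primeNorm p) ≤ Module.finrank ℚ F * Real.log 4 * x := by
  classical
  have hmaps : ∀ p ∈ primesLE F x, primeBelow p ∈ (Finset.Ioc 0 ⌊x⌋₊).filter Nat.Prime := by
    intro p hp
    rw [Finset.mem_filter, Finset.mem_Ioc]
    refine ⟨⟨(prime_primeBelow p).pos, Nat.le_floor ?_⟩, prime_primeBelow p⟩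
    exact (Nat.cast_le.2 (primeBelow_le p)).trans (mem_primesLE.1 hp)
  rw [← Finset.sum_fiberwise_of_maps_to hmaps]
  calc _ ≤ ∑ q ∈ (Finset.Ioc 0 ⌊x⌋₊).filter Nat.Prime, Module.finrank ℚ F * Real.log q := by
        refine Finset.sum_le_sum fun q hq => ?_
        exact sum_log_primeNorm_le_of_primeBelow_eq (Finset.mem_filter.1 hq).2 _
          fun p hp => (Finset.mem_filter.1 hp).2
    _ = Module.finrank ℚ F * Chebyshev.theta x := by rw [← Finset.mul_sum, Chebyshev.theta]
    _ ≤ Module.finrank ℚ F * (Real.log 4 * x) := by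
        gcongr
        exact Chebyshev.theta_le_log4_mul_x hx
    _ = _ := by ring

/-- Dyadic bound for sums over primes of a number field. -/
theorem sum_log_primeNorm_mul_le {v : ℝ → ℝ} (hv : AntitoneOn v (Set.Ici 1))
    (hv0 : ∀ x, 1 ≤ x → 0 ≤ v x) (T : Finset (HeightOneSpectrum (𝓞 F))) {k : ℕ}
    (hT : ∀ p ∈ T, primeNorm p < 2 ^ k) :
    ∑ p ∈ T, Real.log (primeNorm p) * v (primeNorm p) ≤
      Module.finrank ℚ F * Real.log 4 * ∑ j ∈ Finset.range k, 2 ^ (j + 1) * v (2 ^ j) := by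
  classical
  have hmaps : ∀ p ∈ T, Nat.log 2 (primeNorm p) ∈ Finset.range k := by
    intro p hp
    rw [Finset.mem_range]
    exact Nat.log_lt_of_lt_pow (primeNorm_ne_zero p) (hT p hp)
  rw [← Finset.sum_fiberwise_of_maps_to hmaps, Finset.mul_sum]
  refine Finset.sum_le_sum fun j _ => ?_
  have hvj : 0 ≤ v (2 ^ j) := hv0 _ (one_le_pow₀ (by norm_num))
  calc ∑ p ∈ T with Nat.log 2 (primeNorm p) = j, Real.log (primeNorm p) * v (primeNorm p)
      ≤ ∑ p ∈ T with Nat.log 2 (primeNorm p) = j, Real.log (primeNorm p) * v (2 ^ j) := by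
        refine Finset.sum_le_sum fun p hp => ?_
        have h1 := (Finset.mem_filter.1 hp).2
        have h2 : 2 ^ j ≤ primeNorm p := by
          rw [← h1]; exact Nat.pow_log_le_self 2 (primeNorm_ne_zero p)
        have h3 : (2 : ℝ) ^ j ≤ primeNorm p := by exact_mod_cast h2
        have h4 : (1 : ℝ) ≤ 2 ^ j := one_le_pow₀ (by norm_num)
        exact mul_le_mul_of_nonneg_left (hv h4 (h4.trans h3) h3) (log_primeNorm_pos p).le
    _ = (∑ p ∈ T with Nat.log 2 (primeNorm p) = j, Real.log (primeNorm p)) * v (2 ^ j) := by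
        rw [Finset.sum_mul]
    _ ≤ (∑ p ∈ primesLE F (2 ^ (j + 1)), Real.log (primeNorm p)) * v (2 ^ j) := by
        refine mul_le_mul_of_nonneg_right ?_ hvj
        refine Finset.sum_le_sum_of_subset_of_nonneg ?_ fun p _ _ => (log_primeNorm_pos p).le
        intro p hp
        rw [mem_primesLE]
        have h1 := (Finset.mem_filter.1 hp).2
        have h2 : primeNorm p < 2 ^ (j + 1) := by
          rw [← h1]; exact Nat.lt_pow_succ_log_self (by norm_num) _
        exact_mod_cast h2.le
    _ ≤ (Module.finrank ℚ F * Real.log 4 * 2 ^ (j + 1)) * v (2 ^ j) := by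
        gcongr
        exact sum_log_primeNorm_le (by positivity)
    _ = _ := by ring

theorem summable_log_primeNorm_mul {v : ℝ → ℝ} (hv : AntitoneOn v (Set.Ici 1))
    (hv0 : ∀ x, 1 ≤ x → 0 ≤ v x) (hs : Summable fun j : ℕ => (2 : ℝ) ^ (j + 1) * v (2 ^ j)) :
    Summable fun p : HeightOneSpectrum (𝓞 F) => Real.log (primeNorm p) * v (primeNorm p) := by
  refine summable_of_sum_le
    (c := Module.finrank ℚ F * Real.log 4 * ∑' j : ℕ, (2 : ℝ) ^ (j + 1) * v (2 ^ j))
    (fun p => mul_nonneg (log_primeNorm_pos p).le (hv0 _ (by linarith [two_le_primeNorm_real p])))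
    fun T => ?_
  obtain ⟨k, hk⟩ : ∃ k : ℕ, ∀ p ∈ T, primeNorm p < 2 ^ k := by
    refine ⟨T.sup primeNorm, fun p hp => ?_⟩
    exact lt_of_le_of_lt (Finset.le_sup hp) Nat.lt_two_pow_self
  refine (sum_log_primeNorm_mul_le hv hv0 T hk).trans ?_
  have : 0 ≤ Real.log 4 := Real.log_nonneg (by norm_num)
  gcongr
  exact hs.sum_le_tsum _ fun j _ => mul_nonneg (by positivity) (hv0 _ (one_le_pow₀ (by norm_num)))

theorem summable_log_primeNorm_mul_rpow {σ : ℝ} (hσ : 1 < σ) :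
    Summable fun p : HeightOneSpectrum (𝓞 F) =>
      Real.log (primeNorm p) * (primeNorm p : ℝ) ^ (-σ) := by
  refine summable_log_primeNorm_mul (v := fun x => x ^ (-σ)) ?_ ?_ ?_
  · intro x hx y _ hxy
    have hx' : (1 : ℝ) ≤ x := hx
    exact Real.rpow_le_rpow_of_nonpos (by linarith) hxy (by linarith)
  · intro x hx
    positivity
  · have h : ∀ j : ℕ, (2 : ℝ) ^ (j + 1) * ((2 : ℝ) ^ j) ^ (-σ) = 2 * ((2 : ℝ) ^ (1 - σ)) ^ j := by
      intro j
      rw [← Real.rpow_natCast 2 j, ← Real.rpow_natCast 2 (j + 1), ← Real.rpow_mul two_pos.le,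
        ← Real.rpow_add two_pos, ← Real.rpow_natCast, ← Real.rpow_mul two_pos.le]
      have h2 : (2 : ℝ) * 2 ^ ((1 - σ) * (j : ℝ)) = 2 ^ (1 + (1 - σ) * (j : ℝ)) := by
        rw [Real.rpow_add two_pos, Real.rpow_one]
      rw [h2]
      congr 1
      push_cast
      ring
    simp_rw [h]
    refine (summable_geometric_of_lt_one (by positivity) ?_).mul_left 2
    exact Real.rpow_lt_one_of_one_lt_of_neg (by norm_num) (by linarith)

theorem summable_primeNorm_rpow {σ : ℝ} (hσ : 1 < σ) :
    Summable fun p : HeightOneSpectrum (𝓞 F) => (primeNorm p : ℝ) ^ (-σ) := by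
  have h := (summable_log_primeNorm_mul_rpow (F := F) hσ).mul_left (Real.log 2)⁻¹
  refine Summable.of_nonneg_of_le (fun p => by positivity) (fun p => ?_) h
  have h1 := log_two_le_log_primeNorm p
  have h2 : 0 < Real.log 2 := Real.log_pos (by norm_num)
  have h3 : (0 : ℝ) ≤ (primeNorm p : ℝ) ^ (-σ) := by positivity
  rw [inv_mul_eq_div, le_div_iff₀ h2, mul_comm]
  gcongr

/-- The sum of `log N(𝔭) / N(𝔭)` just diverges; a factor `(1 + log N(𝔭))^{-2}`, supplied later by
the decay of a Schwartz function, is enough to rescue it. It governs the squares of primes. -/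
theorem summable_log_primeNorm_div_sq :
    Summable fun p : HeightOneSpectrum (𝓞 F) =>
      Real.log (primeNorm p) * (1 / ((primeNorm p : ℝ) * (1 + Real.log (primeNorm p)) ^ 2)) := by
  refine summable_log_primeNorm_mul (v := fun x => 1 / (x * (1 + Real.log x) ^ 2)) ?_ ?_ ?_
  · intro x hx y _ hxy
    have hx' : (1 : ℝ) ≤ x := hx
    have h0 := Real.log_nonneg hx'
    have h1 := Real.log_le_log (by linarith) hxy
    have h2 : 0 ≤ y := by linarith
    simp only
    gcongr
  · intro x hx
    have := Real.log_nonneg hx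
    positivity
  · have h2 : 0 < Real.log 2 := Real.log_pos (by norm_num)
    have hs := (summable_inv_nat_add_sq (a := 1) one_pos).mul_left (2 / (Real.log 2) ^ 2)
    refine Summable.of_nonneg_of_le (fun j => ?_) (fun j => ?_) hs
    · have := Real.log_nonneg (one_le_pow₀ (by norm_num : (1 : ℝ) ≤ 2) (n := j))
      positivity
    · rw [Real.log_pow]
      have h3 : Real.log 2 ≤ 1 := by linarith [Real.log_two_lt_d9]
      have h4 : Real.log 2 * (j + 1) ≤ 1 + j * Real.log 2 := by
        nlinarith
      calc (2 : ℝ) ^ (j + 1) * (1 / (2 ^ j * (1 + j * Real.log 2) ^ 2))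
          = 2 / (1 + j * Real.log 2) ^ 2 := by field_simp; ring
        _ ≤ 2 / (Real.log 2 * (j + 1)) ^ 2 := by gcongr
        _ = _ := by field_simp

/-- With `v = 1/x` every dyadic block contributes the same constant, so the bound is the number of
blocks. -/
theorem sum_log_primeNorm_div_le {x : ℝ} (hx : 1 ≤ x) :
    ∑ p ∈ primesLE F x, Real.log (primeNorm p) / primeNorm p ≤
      4 * Module.finrank ℚ F * (Real.log x + Real.log 2) := by
  set k := Nat.log 2 ⌊x⌋₊ + 1
  have hfl : ⌊x⌋₊ ≠ 0 := (Nat.floor_pos.2 hx).ne'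
  have h := sum_log_primeNorm_mul_le (F := F) (v := fun x => 1 / x) ?_ ?_ (primesLE F x) (k := k) ?_
  · have h1 : ∀ j : ℕ, (2 : ℝ) ^ (j + 1) * (1 / 2 ^ j) = 2 := fun j => by field_simp; ring
    simp only [h1, Finset.sum_const, Finset.card_range, nsmul_eq_mul, mul_one_div] at h
    refine h.trans ?_
    have h2 : (k : ℝ) * Real.log 2 ≤ Real.log x + Real.log 2 := by
      simp only [k]
      push_cast
      rw [add_mul, one_mul]
      gcongr
      rw [← Real.log_pow]
      refine Real.log_le_log (by positivity) ?_
      refine le_trans ?_ (Nat.floor_le (by linarith : 0 ≤ x))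
      exact_mod_cast Nat.pow_log_le_self 2 hfl
    have h4 : Real.log 4 = 2 * Real.log 2 := by
      rw [show (4 : ℝ) = 2 ^ 2 by norm_num, Real.log_pow]; norm_num
    rw [h4]
    calc _ = 4 * Module.finrank ℚ F * ((k : ℝ) * Real.log 2) := by ring
      _ ≤ _ := by gcongr
  · intro x hx y _ hxy
    have hx' : (1 : ℝ) ≤ x := hx
    simp only
    gcongr
  · intro x hx; positivity
  · intro p hp
    have h1 : primeNorm p ≤ ⌊x⌋₊ := Nat.le_floor (mem_primesLE.1 hp)
    exact h1.trans_lt (Nat.lt_pow_succ_log_self (by norm_num) _)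

end PrimeSums

/-! ### Laplace inversion on a vertical line by a Schwartz kernel. -/

section LineKernel

open MeasureTheory

/-- The point `1 + 2πiy` of the line `Re w = 1`. -/
def linePoint (y : ℝ) : ℂ := 1 + 2 * Real.pi * Complex.I * y

theorem linePoint_re (y : ℝ) : (linePoint y).re = 1 := by simp [linePoint]

theorem continuous_linePoint : Continuous linePoint := by unfold linePoint; fun_prop

theorem norm_linePoint_le (y : ℝ) : ‖linePoint y‖ ≤ 8 * (1 + |y|) := by
  rw [linePoint]
  refine (norm_add_le _ _).trans ?_
  simp only [norm_one, norm_mul, Complex.norm_I, Complex.norm_real, Real.norm_eq_abs,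
    abs_of_pos Real.pi_pos, Complex.norm_ofNat, mul_one]
  nlinarith [Real.pi_le_four, abs_nonneg y]

/-- `H` is the kernel that recovers `g` from its Laplace transform on the line `Re w = 1`. -/
def IsLineKernel (g : ℝ → ℂ) (H : 𝓢(ℝ, ℂ)) : Prop :=
  ∀ u : ℝ, ∫ y : ℝ, H y * Complex.exp (-linePoint y * u) = g u

/-- The kernel is the inverse Fourier transform of `g(u) e^u`; the factor `e^u` moves the inversion
from the imaginary axis to `Re w = 1`. -/
theorem exists_isLineKernel {g : ℝ → ℂ} (hg : ContDiff ℝ (⊤ : ℕ∞) g) (hc : HasCompactSupport g) :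
    ∃ H : 𝓢(ℝ, ℂ), IsLineKernel g H := by
  have h1 : HasCompactSupport fun u : ℝ => g u * Complex.exp u := hc.mul_right
  have h2 : ContDiff ℝ (⊤ : ℕ∞) fun u : ℝ => g u * Complex.exp u :=
    hg.mul (Complex.ofRealCLM.contDiff.cexp)
  set k : 𝓢(ℝ, ℂ) := h1.toSchwartzMap h2
  have hk : ∀ u, k u = g u * Complex.exp u := fun u => rfl
  refine ⟨(𝓕⁻ k : 𝓢(ℝ, ℂ)), fun u => ?_⟩
  have h3 : (𝓕 (𝓕⁻ k : 𝓢(ℝ, ℂ)) : 𝓢(ℝ, ℂ)) u = k u := by simp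
  rw [SchwartzMap.fourier_coe, Real.fourier_real_eq_integral_exp_smul, hk] at h3
  have h4 : g u = Complex.exp (-u) * (g u * Complex.exp u) := by
    rw [mul_comm, mul_assoc, ← Complex.exp_add]
    simp
  rw [h4, ← h3, ← integral_const_mul]
  refine integral_congr_ae (Eventually.of_forall fun y => ?_)
  simp only [smul_eq_mul]
  rw [← mul_assoc, ← Complex.exp_add, mul_comm, linePoint]
  congr 2
  push_cast
  ring

variable {g : ℝ → ℂ} {H : 𝓢(ℝ, ℂ)}

theorem integrable_norm_mul_one_add_abs_pow (H : 𝓢(ℝ, ℂ)) (k : ℕ) :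
    Integrable fun y : ℝ => ‖H y‖ * (1 + |y|) ^ k := by
  have h0 : Integrable fun y : ℝ => ‖H y‖ := H.integrable.norm
  have hk := H.integrable_pow_mul volume k
  refine ((h0.add hk).const_mul (2 ^ (k - 1))).mono' ?_ (Eventually.of_forall fun y => ?_)
  · exact (by fun_prop : Continuous fun y : ℝ => ‖H y‖ * (1 + |y|) ^ k).aestronglyMeasurable
  · have := add_pow_le (zero_le_one) (abs_nonneg y) k
    rw [Real.norm_of_nonneg (by positivity)]
    simp only [Pi.add_apply, Real.norm_eq_abs, one_pow] at this ⊢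
    calc ‖H y‖ * (1 + |y|) ^ k ≤ ‖H y‖ * (2 ^ (k - 1) * (1 + |y| ^ k)) := by gcongr
      _ = _ := by ring

/-- Dominated convergence: the kernel decays faster than any power, so polynomial growth along the
line is harmless. -/
theorem hasSum_integral_kernel_mul {ι : Type*} [Countable ι] (H : 𝓢(ℝ, ℂ)) {Φ : ι → ℝ → ℂ}
    {Ψ : ℝ → ℂ} {c : ι → ℝ} (k : ℕ) (hΦ : ∀ i, Continuous (Φ i))
    (hb : ∀ i y, ‖Φ i y‖ ≤ c i * (1 + |y|) ^ k) (hc : Summable c)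
    (hs : ∀ y, HasSum (fun i => Φ i y) (Ψ y)) :
    HasSum (fun i => ∫ y, H y * Φ i y) (∫ y, H y * Ψ y) := by
  refine hasSum_integral_of_dominated_convergence (fun i y => c i * (‖H y‖ * (1 + |y|) ^ k)) ?_ ?_
    ?_ ?_ ?_
  · intro i
    have := hΦ i
    exact (by fun_prop : Continuous fun y => H y * Φ i y).aestronglyMeasurable
  · intro i
    refine Eventually.of_forall fun y => ?_
    rw [norm_mul]
    calc ‖H y‖ * ‖Φ i y‖ ≤ ‖H y‖ * (c i * (1 + |y|) ^ k) := by gcongr; exact hb i y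
      _ = _ := by ring
  · exact Eventually.of_forall fun y => hc.mul_right _
  · simp_rw [tsum_mul_right]
    exact (integrable_norm_mul_one_add_abs_pow H k).const_mul _
  · exact Eventually.of_forall fun y => (hs y).mul_left _

theorem integrable_kernel_mul (H : 𝓢(ℝ, ℂ)) {Φ : ℝ → ℂ} {c : ℝ} (k : ℕ) (hΦ : Continuous Φ)
    (hb : ∀ y, ‖Φ y‖ ≤ c * (1 + |y|) ^ k) : Integrable fun y => H y * Φ y := by
  refine ((integrable_norm_mul_one_add_abs_pow H k).const_mul c).mono'
    (by fun_prop : Continuous fun y => H y * Φ y).aestronglyMeasurable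
    (Eventually.of_forall fun y => ?_)
  rw [norm_mul]
  calc ‖H y‖ * ‖Φ y‖ ≤ ‖H y‖ * (c * (1 + |y|) ^ k) := by gcongr; exact hb y
    _ = _ := by ring

theorem IsLineKernel.integral_eq (hH : IsLineKernel g H) : ∫ y, H y = g 0 := by
  have := hH 0
  simpa using this

theorem re_linePoint_add_pos {b : ℂ} (hb : -1 < b.re) (y : ℝ) : 0 < (linePoint y + b).re := by
  rw [Complex.add_re, linePoint_re]
  linarith

theorem linePoint_add_ne_zero {b : ℂ} (hb : -1 < b.re) (y : ℝ) : linePoint y + b ≠ 0 := fun h => by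
  have := re_linePoint_add_pos hb y
  simp [h] at this

/-- Here `1/(w + b)` is the Laplace transform of `e^{-bu}` on the half-line, valid because `Re (w +
b) > 0`. After Fubini the inner integral reproduces `g(u)`. -/
theorem IsLineKernel.integral_div (hH : IsLineKernel g H) {b : ℂ} (hb : -1 < b.re) :
    ∫ y, H y * (1 / (linePoint y + b)) = ∫ u in Set.Ioi (0 : ℝ), Complex.exp (-b * u) * g u := by
  have h1 : ∀ y, 1 / (linePoint y + b) =
      ∫ u in Set.Ioi (0 : ℝ), Complex.exp (-(linePoint y + b) * u) := by
    intro y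
    rw [integral_exp_mul_complex_Ioi (by rw [Complex.neg_re]; linarith [re_linePoint_add_pos hb y])]
    have := linePoint_add_ne_zero hb y
    simp only [Complex.ofReal_zero, mul_zero, Complex.exp_zero]
    field_simp
  simp_rw [h1, ← integral_const_mul]
  rw [integral_integral_swap]
  · refine setIntegral_congr_fun measurableSet_Ioi fun u _ => ?_
    rw [← hH u, ← integral_const_mul]
    refine integral_congr_ae (Eventually.of_forall fun y => ?_)
    simp only
    rw [mul_left_comm, ← Complex.exp_add]
    congr 2
    ring
  · have hprod : Integrable (fun z : ℝ × ℝ => ‖H z.1‖ * Real.exp (-(1 + b.re) * z.2))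
        (volume.prod (volume.restrict (Set.Ioi 0))) :=
      Integrable.mul_prod (L := ℝ) H.integrable.norm (integrableOn_exp_mul_Ioi (by linarith) 0)
    refine hprod.mono' ?_ (Eventually.of_forall fun z => ?_)
    · refine Continuous.aestronglyMeasurable ?_
      have := continuous_linePoint
      have h := H.continuous
      simp only [Function.uncurry_def]
      fun_prop
    · simp only [Function.uncurry, norm_mul, Complex.norm_exp]
      refine le_of_eq ?_
      congr 2
      have : ((-(linePoint z.1 + b)) * (z.2 : ℂ)).re = (-(linePoint z.1 + b)).re * z.2 :=
        Complex.re_mul_ofReal _ _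
      rw [this, Complex.neg_re, Complex.add_re, linePoint_re]

end LineKernel

/-! ### The Euler product and its logarithmic derivative. -/

namespace NFLFunction

variable {F : Type*} [Field F] [NumberField F] {d : ℕ}

/-- The Dirichlet series of `f`. -/
def dirichletSeries (f : NFLFunction F d) (s : ℂ) : ℂ :=
  ∑' n : {n : Ideal (𝓞 F) // n ≠ ⊥},
    f.coeff n * (Ideal.absNorm (n : Ideal (𝓞 F)) : ℂ) ^ (-s)

/-- `α_i(𝔭) N(𝔭)^(-s)`. -/
def eulerTerm (f : NFLFunction F d) (x : HeightOneSpectrum (𝓞 F) × Fin d) (s : ℂ) : ℂ :=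
  f.α x.2 x.1 * (primeNorm x.1 : ℂ) ^ (-s)

theorem norm_eulerTerm_le {f : NFLFunction F d} (hRP : f.RamanujanPetersson)
    (x : HeightOneSpectrum (𝓞 F) × Fin d) (s : ℂ) :
    ‖f.eulerTerm x s‖ ≤ (primeNorm x.1 : ℝ) ^ (-s.re) := by
  rw [eulerTerm, norm_mul, Complex.norm_natCast_cpow_of_pos (Nat.pos_of_ne_zero (primeNorm_ne_zero _)),
    Complex.neg_re]
  exact mul_le_of_le_one_left (by positivity) (hRP x.2 x.1).2

theorem primeNorm_rpow_le_half (p : HeightOneSpectrum (𝓞 F)) {σ : ℝ} (hσ : 1 ≤ σ) :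
    (primeNorm p : ℝ) ^ (-σ) ≤ 1 / 2 := by
  calc (primeNorm p : ℝ) ^ (-σ) ≤ (primeNorm p : ℝ) ^ (-1 : ℝ) :=
        Real.rpow_le_rpow_of_exponent_le (by linarith [two_le_primeNorm_real p]) (by linarith)
    _ ≤ (2 : ℝ) ^ (-1 : ℝ) :=
        Real.rpow_le_rpow_of_nonpos two_pos (two_le_primeNorm_real p) (by norm_num)
    _ = 1 / 2 := by norm_num [Real.rpow_neg_one]

theorem norm_eulerTerm_le_half {f : NFLFunction F d} (hRP : f.RamanujanPetersson)
    (x : HeightOneSpectrum (𝓞 F) × Fin d) {s : ℂ} (hs : 1 ≤ s.re) : ‖f.eulerTerm x s‖ ≤ 1 / 2 :=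
  (norm_eulerTerm_le hRP x s).trans (primeNorm_rpow_le_half _ hs)

theorem summable_prod_fin {ι : Type*} {u : ι → ℝ} (hu : Summable u) (h0 : ∀ i, 0 ≤ u i) (d : ℕ) :
    Summable fun x : ι × Fin d => u x.1 := by
  rw [summable_prod_of_nonneg (fun x => h0 x.1)]
  exact ⟨fun _ => Summable.of_finite, by simpa using hu.mul_left (d : ℝ)⟩

theorem hasDerivAt_eulerTerm (f : NFLFunction F d) (x : HeightOneSpectrum (𝓞 F) × Fin d) (s : ℂ) :
    HasDerivAt (f.eulerTerm x) (-(Real.log (primeNorm x.1) : ℂ) * f.eulerTerm x s) s := by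
  have hN : (primeNorm x.1 : ℂ) ≠ 0 := by exact_mod_cast primeNorm_ne_zero x.1
  have h := ((hasDerivAt_id s).neg.const_cpow (c := (primeNorm x.1 : ℂ)) (Or.inl hN)).const_mul
    (f.α x.2 x.1)
  refine h.congr_deriv ?_
  simp only [eulerTerm, id, Pi.neg_apply, Complex.natCast_log]
  ring

theorem summable_log_mul_rpow_pow {σ : ℝ} (hσ : 1 < σ) :
    Summable fun x : (HeightOneSpectrum (𝓞 F) × Fin d) × ℕ =>
      Real.log (primeNorm x.1.1) * ((primeNorm x.1.1 : ℝ) ^ (-σ)) ^ (x.2 + 1) := by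
  have h1 := summable_prod_fin (summable_log_primeNorm_mul_rpow (F := F) hσ)
    (fun p => mul_nonneg (log_primeNorm_pos p).le (by positivity)) d
  have h2 : Summable fun m : ℕ => ((1 : ℝ) / 2) ^ m := summable_geometric_two
  have h3 := h1.mul_of_nonneg h2
    (fun x => mul_nonneg (log_primeNorm_pos x.1).le (by positivity)) (fun m => by positivity)
  refine Summable.of_nonneg_of_le (fun x => ?_) (fun x => ?_) h3
  · exact mul_nonneg (log_primeNorm_pos _).le (by positivity)
  · have h4 := primeNorm_rpow_le_half x.1.1 hσ.le
    have h5 := (log_primeNorm_pos x.1.1).le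
    rw [pow_succ', ← mul_assoc]
    gcongr

theorem multipliable_eulerTerm {f : NFLFunction F d} (hRP : f.RamanujanPetersson) {σ : ℝ}
    (hσ : 1 < σ) :
    HasProdLocallyUniformlyOn (fun x s => 1 + -f.eulerTerm x s)
      (fun s => ∏' x, (1 + -f.eulerTerm x s)) {s : ℂ | σ < s.re} := by
  refine Summable.hasProdLocallyUniformlyOn_one_add (isOpen_lt continuous_const Complex.continuous_re)
    (summable_prod_fin (summable_primeNorm_rpow (F := F) hσ) (fun p => by positivity) d)
    (Eventually.of_forall fun x s hs => ?_) fun x => ?_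
  · rw [norm_neg]
    refine (norm_eulerTerm_le hRP x s).trans ?_
    have hs' : σ < s.re := hs
    exact Real.rpow_le_rpow_of_exponent_le (by linarith [two_le_primeNorm_real x.1]) (by linarith)
  · exact fun s _ => (f.hasDerivAt_eulerTerm x s).neg.continuousAt.continuousWithinAt

/-- The product of `1 - α_i(𝔭) N(𝔭)^{-s}` over all pairs `(𝔭, i)` inverts the Euler product. Working
with this inverse gives entire factors, and the nonvanishing of the Dirichlet series comes for free.
-/
theorem dirichletSeries_mul_tprod {f : NFLFunction F d} (hRP : f.RamanujanPetersson) {s : ℂ}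
    (hs : 1 < s.re) : f.dirichletSeries s * ∏' x, (1 + -f.eulerTerm x s) = 1 := by
  obtain ⟨σ, hσ, hσs⟩ := exists_between hs
  have h1 := (multipliable_eulerTerm hRP hσ).hasProd hσs
  have h2 : HasProd (fun p : HeightOneSpectrum (𝓞 F) => ∏ i, (1 + -f.eulerTerm (p, i) s))
      (∏' x, (1 + -f.eulerTerm x s)) := h1.prod_fiberwise fun p => hasProd_fintype _
  have h3 := (f.euler_product s hs).mul h2
  refine h3.unique ?_
  convert hasProd_one with p
  rw [← Finset.prod_mul_distrib]
  refine Finset.prod_eq_one fun i _ => ?_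
  have h4 := norm_eulerTerm_le_half hRP (p, i) hs.le
  have h5 : 1 - f.eulerTerm (p, i) s ≠ 0 := by
    intro h
    rw [sub_eq_zero] at h
    rw [← h, norm_one] at h4
    norm_num at h4
  rw [← sub_eq_add_neg]
  exact inv_mul_cancel₀ h5

theorem dirichletSeries_ne_zero {f : NFLFunction F d} (hRP : f.RamanujanPetersson) {s : ℂ}
    (hs : 1 < s.re) : f.dirichletSeries s ≠ 0 :=
  left_ne_zero_of_mul_eq_one (dirichletSeries_mul_tprod hRP hs)

/-- The locally uniform product for the inverse is differentiated logarithmically factor by factor.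
Each factor expands into a geometric series, since Ramanujan–Petersson bounds the local terms by
`1/2`. -/
theorem hasSum_neg_logDeriv_dirichletSeries {f : NFLFunction F d} (hRP : f.RamanujanPetersson)
    {s : ℂ} (hs : 1 < s.re) :
    DifferentiableAt ℂ f.dirichletSeries s ∧
    HasSum (fun x : (HeightOneSpectrum (𝓞 F) × Fin d) × ℕ =>
      (Real.log (primeNorm x.1.1) : ℂ) * f.eulerTerm x.1 s ^ (x.2 + 1))
      (-logDeriv f.dirichletSeries s) := by
  obtain ⟨σ, hσ, hσs⟩ := exists_between hs
  set Ω : Set ℂ := {s : ℂ | σ < s.re}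
  have hΩ : IsOpen Ω := isOpen_lt continuous_const Complex.continuous_re
  set P : ℂ → ℂ := fun s => ∏' x, (1 + -f.eulerTerm x s) with hP
  have hprod := multipliable_eulerTerm hRP hσ
  have hd : ∀ x, Differentiable ℂ fun s => 1 + -f.eulerTerm x s := fun x s =>
    ((f.hasDerivAt_eulerTerm x s).neg.const_add 1).differentiableAt
  have hPd : DifferentiableOn ℂ P Ω := by
    have h := TendstoLocallyUniformlyOn.differentiableOn hprod
      (Eventually.of_forall fun T => ?_) hΩ
    · exact h
    · exact (Differentiable.fun_finsetProd fun x _ => hd x).differentiableOn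
  have hPne : P s ≠ 0 := right_ne_zero_of_mul_eq_one (dirichletSeries_mul_tprod hRP hs)
  have hPs := hPd.differentiableAt (hΩ.mem_nhds hσs)
  have hDP : f.dirichletSeries =ᶠ[𝓝 s] fun z => (P z)⁻¹ := by
    filter_upwards [hΩ.mem_nhds hσs] with z hz
    exact eq_inv_of_mul_eq_one_left (dirichletSeries_mul_tprod hRP (hσ.trans hz))
  have hDd : HasDerivAt f.dirichletSeries (-deriv P s / P s ^ 2) s :=
    (hPs.hasDerivAt.inv hPne).congr_of_eventuallyEq hDP
  have hlog : -logDeriv f.dirichletSeries s = logDeriv P s := by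
    rw [logDeriv_apply, hDd.deriv, hDP.eq_of_nhds, logDeriv_apply]
    field_simp
  refine ⟨hDd.differentiableAt, ?_⟩
  have hz : ∀ x, ‖f.eulerTerm x s‖ < 1 := fun x =>
    (norm_eulerTerm_le_half hRP x hs.le).trans_lt (by norm_num)
  have hne : ∀ x, 1 + -f.eulerTerm x s ≠ 0 := by
    intro x h
    rw [← sub_eq_add_neg, sub_eq_zero] at h
    have := hz x
    rw [← h, norm_one] at this
    exact lt_irrefl _ this
  have hl : ∀ x, logDeriv (fun s => 1 + -f.eulerTerm x s) s =
      (Real.log (primeNorm x.1) : ℂ) * f.eulerTerm x s * (1 - f.eulerTerm x s)⁻¹ := by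
    intro x
    have h6 : HasDerivAt (fun s => 1 + -f.eulerTerm x s)
        (-(-(Real.log (primeNorm x.1) : ℂ) * f.eulerTerm x s)) s :=
      (f.hasDerivAt_eulerTerm x s).neg.const_add 1
    rw [logDeriv_apply, h6.deriv, ← sub_eq_add_neg]
    ring
  have hsum : Summable fun x : (HeightOneSpectrum (𝓞 F) × Fin d) × ℕ =>
      (Real.log (primeNorm x.1.1) : ℂ) * f.eulerTerm x.1 s ^ (x.2 + 1) := by
    refine Summable.of_norm_bounded (summable_log_mul_rpow_pow hs) fun x => ?_
    rw [norm_mul, norm_pow, Complex.norm_real, Real.norm_of_nonneg (log_primeNorm_pos _).le]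
    have := (log_primeNorm_pos x.1.1).le
    gcongr
    exact norm_eulerTerm_le hRP _ _
  have hinner : ∀ x, HasSum (fun m : ℕ => (Real.log (primeNorm x.1) : ℂ) * f.eulerTerm x s ^ (m + 1))
      (logDeriv (fun s => 1 + -f.eulerTerm x s) s) := by
    intro x
    rw [hl]
    have := (hasSum_geometric_of_norm_lt_one (hz x)).mul_left
      ((Real.log (primeNorm x.1) : ℂ) * f.eulerTerm x s)
    convert! this using 2 with m
    ring
  have h2 := hsum.hasSum.prod_fiberwise hinner
  have h3 := logDeriv_tprod_eq_tsum hΩ hσs hne (fun x => (hd x).differentiableOn)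
    h2.summable ⟨_, hprod⟩ hPne
  rw [hlog, hP, h3, h2.tsum_eq]
  exact hsum.hasSum

end NFLFunction

/-! ### The completed L-function as an entire function, and its zeros. -/

namespace NFLFunction

variable {F : Type*} [Field F] [NumberField F] {d : ℕ}

/-- The completed `L`-function with its removable singularities removed. -/
def xi (f : NFLFunction F d) : ℂ → ℂ := toMeromorphicNFOn f.completed Set.univ

theorem meromorphicOn_completed (f : NFLFunction F d) : MeromorphicOn f.completed Set.univ :=
  fun s _ => f.meromorphic_completed s

theorem meromorphicOrderAt_xi (f : NFLFunction F d) (s : ℂ) :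
    meromorphicOrderAt f.xi s = meromorphicOrderAt f.completed s :=
  meromorphicOrderAt_toMeromorphicNFOn f.meromorphicOn_completed (Set.mem_univ s)

theorem xi_eq_completed (f : NFLFunction F d) {s : ℂ} (h0 : s ≠ 0) (h1 : s ≠ 1) :
    f.xi s = f.completed s := by
  rw [xi, toMeromorphicNFOn_eq_toMeromorphicNFAt f.meromorphicOn_completed (Set.mem_univ s),
    toMeromorphicNFAt_eq_self.2 (f.analyticAt_completed s h0 h1).meromorphicNFAt]

theorem differentiable_xi {f : NFLFunction F d} (hf : f.NoPoles) : Differentiable ℂ f.xi := by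
  intro s
  refine AnalyticAt.differentiableAt ?_
  exact (meromorphicNFOn_toMeromorphicNFOn f.completed Set.univ
    (Set.mem_univ s)).meromorphicOrderAt_nonneg_iff_analyticAt.1
    ((hf s).trans_eq (f.meromorphicOrderAt_xi s).symm)

theorem xi_eq_of_one_lt_re (f : NFLFunction F d) {s : ℂ} (hs : 1 < s.re) :
    f.xi s = (f.A : ℂ) ^ (s / 2) * f.gammaFactor s * f.dirichletSeries s := by
  rw [f.xi_eq_completed (fun h => by simp [h] at hs; linarith) (fun h => by simp [h] at hs)]
  exact f.completed_eq s hs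

theorem exists_norm_xi_le (f : NFLFunction F d) :
    ∃ B : ℝ, ∀ z : ℂ, 2 ≤ ‖z‖ → ‖f.xi z‖ ≤ B * Real.exp (‖z‖ ^ (1 + 1 / 2 : ℝ)) := by
  obtain ⟨B, hB⟩ := f.order_one (1 / 2) (by norm_num)
  refine ⟨B, fun z hz => ?_⟩
  rw [f.xi_eq_completed (fun h => by norm_num [h] at hz) (fun h => by norm_num [h] at hz)]
  exact hB z hz

theorem A_ne_zero (f : NFLFunction F d) : (f.A : ℂ) ≠ 0 := by
  have := f.one_le_A
  exact_mod_cast (by omega : f.A ≠ 0)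

theorem Gamma_κ_ne_zero {f : NFLFunction F d} (hκ : ∀ j, 0 < (f.κ j).re) {s : ℂ}
    (hs : 0 ≤ s.re) (j) : Complex.Gamma ((s + f.κ j) / 2) ≠ 0 := by
  refine Complex.Gamma_ne_zero_of_re_pos ?_
  have := hκ j
  simp
  linarith

theorem pi_ne_zero' : (Real.pi : ℂ) ≠ 0 := by exact_mod_cast Real.pi_ne_zero

theorem gammaFactor_ne_zero {f : NFLFunction F d} (hκ : ∀ j, 0 < (f.κ j).re) {s : ℂ}
    (hs : 0 ≤ s.re) : f.gammaFactor s ≠ 0 := by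
  refine mul_ne_zero ?_ (Finset.prod_ne_zero_iff.2 fun j _ => Gamma_κ_ne_zero hκ hs j)
  rw [Complex.cpow_ne_zero_iff]
  exact Or.inl pi_ne_zero'

theorem xi_ne_zero_of_one_lt_re {f : NFLFunction F d} (hRP : f.RamanujanPetersson)
    (hκ : ∀ j, 0 < (f.κ j).re) {s : ℂ} (hs : 1 < s.re) : f.xi s ≠ 0 := by
  rw [f.xi_eq_of_one_lt_re hs]
  refine mul_ne_zero (mul_ne_zero ?_ (gammaFactor_ne_zero hκ (by linarith)))
    (dirichletSeries_ne_zero hRP hs)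
  rw [Complex.cpow_ne_zero_iff]
  exact Or.inl f.A_ne_zero

theorem conj_two : conj (2 : ℂ) = 2 := by
  apply Complex.ext <;> simp

theorem arg_natCast_ne_pi (n : ℕ) : (n : ℂ).arg ≠ Real.pi := by
  rw [Complex.natCast_arg]
  exact Real.pi_ne_zero.symm

theorem conj_natCast_cpow (n : ℕ) (s : ℂ) : conj ((n : ℂ) ^ s) = (n : ℂ) ^ conj s := by
  have := Complex.cpow_conj (n : ℂ) s (arg_natCast_ne_pi n)
  rw [this, Complex.conj_natCast]

theorem dirichletSeries_conj {f : NFLFunction F d} (hf : f.IsSelfDual) (s : ℂ) :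
    f.dirichletSeries (conj s) = conj (f.dirichletSeries s) := by
  rw [dirichletSeries, dirichletSeries, Complex.conj_tsum]
  refine tsum_congr fun n => ?_
  rw [map_mul, hf n n.2, conj_natCast_cpow, map_neg]

theorem gammaFactor_conj (f : NFLFunction F d) (s : ℂ) :
    f.gammaFactor (conj s) = conj (f.gammaFactor s) := by
  obtain ⟨σ, hσ⟩ := f.κ_conj
  rw [gammaFactor, gammaFactor, map_mul, map_prod]
  congr 1
  · have h := Complex.cpow_conj (Real.pi : ℂ) (-((d * Module.finrank ℚ F : ℕ) : ℂ) * s / 2)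
      (by rw [Complex.arg_ofReal_of_nonneg Real.pi_pos.le]; exact Real.pi_ne_zero.symm)
    rw [Complex.conj_ofReal] at h
    rw [← h]
    congr 1
    simp [conj_two]
  · rw [← Equiv.prod_comp σ]
    refine Finset.prod_congr rfl fun j _ => ?_
    rw [hσ, ← Complex.Gamma_conj]
    congr 1
    simp [conj_two]

/-- Schwarz reflection: for `Re s > 1` self-duality and the conjugation symmetry of the `κ_j` give
the identity, and analytic continuation extends it. -/
theorem xi_conj {f : NFLFunction F d} (hf : f.IsSelfDual) (hp : f.NoPoles) (s : ℂ) :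
    conj (f.xi (conj s)) = f.xi s := by
  have hd := differentiable_xi hp
  have hd' : Differentiable ℂ (conj ∘ f.xi ∘ conj) := fun z =>
    differentiableAt_conj_conj_iff.2 (hd _)
  have hext : (conj ∘ f.xi ∘ conj) = f.xi := by
    refine AnalyticOnNhd.eq_of_eventuallyEq (z₀ := 2) (fun z _ => hd'.analyticAt z)
      (fun z _ => hd.analyticAt z) ?_
    have h1 : ∀ᶠ z : ℂ in 𝓝 2, 1 < z.re :=
      (isOpen_lt continuous_const Complex.continuous_re).mem_nhds (by simp)
    filter_upwards [h1] with z hz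
    have hz' : 1 < (conj z).re := by simpa using hz
    simp only [Function.comp_apply]
    rw [f.xi_eq_of_one_lt_re hz', f.xi_eq_of_one_lt_re hz, gammaFactor_conj,
      dirichletSeries_conj hf, map_mul, map_mul, conj_natCast_cpow]
    simp [conj_two]
  exact congrFun hext s

theorem rootNumber_ne_zero (f : NFLFunction F d) : f.rootNumber ≠ 0 := by
  rw [← norm_ne_zero_iff, f.norm_rootNumber]
  exact one_ne_zero

/-- Reflection removes the conjugations from the functional equation, leaving the symmetry `s ↦ 1 -
s` that the partial fractions require. The identity theorem covers the points `0` and `1`. -/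
theorem xi_symm {f : NFLFunction F d} (hf : f.IsSelfDual) (hp : f.NoPoles) (s : ℂ) :
    f.xi s = f.rootNumber * f.xi (1 - s) := by
  have hd := differentiable_xi hp
  have hd' : Differentiable ℂ fun s => f.rootNumber * f.xi (1 - s) := by fun_prop
  refine congrFun (AnalyticOnNhd.eq_of_eventuallyEq (z₀ := 2) (fun z _ => hd.analyticAt z)
      (fun z _ => hd'.analyticAt z) ?_) s
  have h1 : ∀ᶠ z : ℂ in 𝓝 2, 1 < z.re :=
    (isOpen_lt continuous_const Complex.continuous_re).mem_nhds (by simp)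
  filter_upwards [h1] with z hz
  have hz0 : z ≠ 0 := fun h => by simp [h] at hz; linarith
  have hz1 : z ≠ 1 := fun h => by simp [h] at hz
  have h2 : conj (1 - z) ≠ 0 := by
    rw [Ne, map_eq_zero, sub_eq_zero]
    exact hz1.symm
  have h3 : conj (1 - z) ≠ 1 := by
    intro h
    have := congrArg conj h
    simp at this
    exact hz0 this
  rw [f.xi_eq_completed hz0 hz1, f.functional_equation z hz0 hz1, ← f.xi_eq_completed h2 h3,
    xi_conj hf hp]

theorem re_mem_of_xi_eq_zero {f : NFLFunction F d} (hf : f.IsSelfDual) (hp : f.NoPoles)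
    (hRP : f.RamanujanPetersson) (hκ : ∀ j, 0 < (f.κ j).re) {ρ : ℂ} (h : f.xi ρ = 0) :
    0 ≤ ρ.re ∧ ρ.re ≤ 1 := by
  constructor
  · by_contra! h0
    refine xi_ne_zero_of_one_lt_re hRP hκ (s := 1 - ρ) (by simp; linarith) ?_
    have := xi_symm hf hp ρ
    rw [h, eq_comm, mul_eq_zero] at this
    exact this.resolve_left f.rootNumber_ne_zero
  · by_contra! h0
    exact xi_ne_zero_of_one_lt_re hRP hκ h0 h

theorem xi_order_ne_top {f : NFLFunction F d} (hp : f.NoPoles)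
    (hRP : f.RamanujanPetersson) (hκ : ∀ j, 0 < (f.κ j).re) (z : ℂ) :
    analyticOrderAt f.xi z ≠ ⊤ := by
  intro h
  have := (AnalyticOnNhd.analyticOrderAt_eq_top_iff_eq_zero z
    fun z => (differentiable_xi hp).analyticAt z).1 h
  exact xi_ne_zero_of_one_lt_re hRP hκ (s := 2) (by simp) (congrFun this 2)

/-- Since `Re κ_j > 0`, the gamma factor is finite and nonzero on `Re s ≥ 0`. So `L` has no trivial
zeros there, and its order equals that of `xi`. -/
theorem meromorphicOrderAt_L {f : NFLFunction F d} (hp : f.NoPoles)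
    (hRP : f.RamanujanPetersson) (hκ : ∀ j, 0 < (f.κ j).re) {ρ : ℂ} (hρ : 0 ≤ ρ.re) :
    meromorphicOrderAt f.L ρ = (analyticOrderNatAt f.xi ρ : ℤ) := by
  have h1 : f.L = (fun s => (f.A : ℂ) ^ (-s / 2) * (f.gammaFactor s)⁻¹) * f.completed := by
    ext s; rfl
  have hA : AnalyticAt ℂ (fun s => (f.A : ℂ) ^ (-s / 2)) ρ := by
    refine Differentiable.analyticAt (fun s => ?_) ρ
    exact DifferentiableAt.const_cpow (by fun_prop) (Or.inl f.A_ne_zero)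
  have hG : AnalyticAt ℂ (fun s => (f.gammaFactor s)⁻¹) ρ := by
    refine Differentiable.analyticAt (f := fun s => (f.gammaFactor s)⁻¹) ?_ ρ
    have : (fun s => (f.gammaFactor s)⁻¹) = fun s =>
        (Real.pi : ℂ) ^ (((d * Module.finrank ℚ F : ℕ) : ℂ) * s / 2) *
          ∏ j, (Complex.Gamma ((s + f.κ j) / 2))⁻¹ := by
      ext s
      rw [gammaFactor, mul_inv, ← Complex.cpow_neg, Finset.prod_inv_distrib]
      congr 2
      ring
    rw [this]
    refine Differentiable.mul (fun s => DifferentiableAt.const_cpow (by fun_prop) (Or.inl pi_ne_zero'))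
      (Differentiable.fun_finsetProd fun j _ => ?_)
    exact Complex.differentiable_one_div_Gamma.comp (by fun_prop : Differentiable ℂ fun s => (s + f.κ j) / 2)
  have h2 : meromorphicOrderAt f.L ρ = meromorphicOrderAt f.completed ρ := by
    rw [h1]
    refine meromorphicOrderAt_mul_of_ne_zero (hA.mul hG) (mul_ne_zero ?_ (inv_ne_zero ?_))
    · rw [Complex.cpow_ne_zero_iff]
      exact Or.inl f.A_ne_zero
    · exact gammaFactor_ne_zero hκ hρ
  rw [h2, ← f.meromorphicOrderAt_xi, ((differentiable_xi hp).analyticAt ρ).meromorphicOrderAt_eq,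
    ← Nat.cast_analyticOrderNatAt (xi_order_ne_top hp hRP hκ ρ), ENat.map_natCast]

theorem zeroMult_eq {f : NFLFunction F d} (hp : f.NoPoles) (hRP : f.RamanujanPetersson)
    (hκ : ∀ j, 0 < (f.κ j).re) {ρ : ℂ} (hρ : 0 ≤ ρ.re) :
    f.zeroMult ρ = analyticOrderNatAt f.xi ρ := by
  rw [zeroMult, meromorphicOrderAt_L hp hRP hκ hρ]
  rfl

theorem mem_stripZeros_iff {f : NFLFunction F d} (hf : f.IsSelfDual) (hp : f.NoPoles)
    (hRP : f.RamanujanPetersson) (hκ : ∀ j, 0 < (f.κ j).re) (ρ : ℂ) :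
    ρ ∈ f.stripZeros ↔ f.xi ρ = 0 := by
  have key : 0 ≤ ρ.re → (0 < meromorphicOrderAt f.L ρ ↔ f.xi ρ = 0) := by
    intro hρ
    rw [meromorphicOrderAt_L hp hRP hκ hρ, ← (((differentiable_xi hp).analyticAt ρ)).analyticOrderAt_ne_zero,
      ← Nat.cast_analyticOrderNatAt (xi_order_ne_top hp hRP hκ ρ)]
    rw [← WithTop.coe_zero, WithTop.coe_lt_coe]
    simp [Nat.pos_iff_ne_zero]
  constructor
  · exact fun h => (key h.1).1 h.2.2
  · intro h
    have := re_mem_of_xi_eq_zero hf hp hRP hκ h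
    exact ⟨this.1, this.2, (key this.1).2 h⟩

theorem xi_partial_fractions {f : NFLFunction F d} (hf : f.IsSelfDual) (hp : f.NoPoles)
    (hRP : f.RamanujanPetersson) (hκ : ∀ j, 0 < (f.κ j).re) :
    (Summable fun ρ : f.stripZeros => (f.zeroMult ρ : ℝ) * (1 / (1 + ‖(ρ : ℂ)‖ ^ 2))) ∧
    ∀ s : ℂ, 1 < s.re → HasSum (fun ρ : f.stripZeros => (f.zeroMult ρ : ℂ) *
      (1 / (s - ρ) + 1 / (s - (1 - ρ)))) (2 * logDeriv f.xi s) := by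
  obtain ⟨B, hB⟩ := f.exists_norm_xi_le
  have h := partial_fractions_of_symm (differentiable_xi hp) hB f.rootNumber_ne_zero
    (xi_symm hf hp) (mem_stripZeros_iff hf hp hRP hκ) fun ρ hρ => ⟨hρ.1, hρ.2.1⟩
  have hm : ∀ ρ : f.stripZeros, f.zeroMult ρ = analyticOrderNatAt f.xi ρ := fun ρ =>
    zeroMult_eq hp hRP hκ ρ.2.1
  simp_rw [hm]
  exact h

theorem logDeriv_natCast_cpow_div_two {c : ℂ} (hc : c ≠ 0) (a s : ℂ) :
    logDeriv (fun s => c ^ (a * s / 2)) s = a / 2 * Complex.log c := by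
  have h1 : HasDerivAt (fun s : ℂ => a * s / 2) (a / 2) s := by
    simpa using ((hasDerivAt_id s).const_mul a).div_const 2
  have h := h1.const_cpow (c := c) (Or.inl hc)
  have hne : c ^ (a * s / 2) ≠ 0 := by
    rw [Complex.cpow_ne_zero_iff]
    exact Or.inl hc
  rw [logDeriv_apply, h.deriv]
  field_simp

theorem logDeriv_xi {f : NFLFunction F d} (hRP : f.RamanujanPetersson)
    (hκ : ∀ j, 0 < (f.κ j).re) {s : ℂ} (hs : 1 < s.re) :
    logDeriv f.xi s = 1 / 2 * (Real.log f.A : ℂ)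
      - (d * Module.finrank ℚ F : ℕ) / 2 * (Real.log Real.pi : ℂ)
      + 1 / 2 * ∑ j, Complex.digamma ((s + f.κ j) / 2) + logDeriv f.dirichletSeries s := by
  have hpi := pi_ne_zero'
  have hA := f.A_ne_zero
  set a : ℂ → ℂ := fun s => (f.A : ℂ) ^ (1 * s / 2)
  set b : ℂ → ℂ := fun s => (Real.pi : ℂ) ^ (-((d * Module.finrank ℚ F : ℕ) : ℂ) * s / 2)
  set c : Fin (d * Module.finrank ℚ F) → ℂ → ℂ := fun j s => Complex.Gamma ((s + f.κ j) / 2)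
  have hev : f.xi =ᶠ[𝓝 s] fun s => a s * (b s * ∏ j, c j s) * f.dirichletSeries s := by
    filter_upwards [(isOpen_lt continuous_const Complex.continuous_re).mem_nhds hs] with z hz
    rw [f.xi_eq_of_one_lt_re hz, gammaFactor]
    simp only [a, b, c, one_mul]
  have ha : DifferentiableAt ℂ a s := DifferentiableAt.const_cpow (by fun_prop) (Or.inl hA)
  have hb : DifferentiableAt ℂ b s := DifferentiableAt.const_cpow (by fun_prop) (Or.inl hpi)
  have hre : ∀ j, 0 < ((s + f.κ j) / 2).re := fun j => by
    have := hκ j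
    simp
    linarith
  have hG : ∀ j, DifferentiableAt ℂ Complex.Gamma ((s + f.κ j) / 2) := fun j => by
    refine Complex.differentiableAt_Gamma _ fun m h => ?_
    have := hre j
    rw [h] at this
    simp at this
    linarith [(Nat.cast_nonneg m : (0 : ℝ) ≤ m)]
  have hc : ∀ j, DifferentiableAt ℂ (c j) s := fun j =>
    DifferentiableAt.comp s (hG j) (by fun_prop)
  have hcne : ∀ j, c j s ≠ 0 := fun j => Gamma_κ_ne_zero hκ (by linarith) j
  have hane : a s ≠ 0 := by
    simp only [a]; rw [Complex.cpow_ne_zero_iff]; exact Or.inl hA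
  have hbne : b s ≠ 0 := by
    simp only [b]; rw [Complex.cpow_ne_zero_iff]; exact Or.inl hpi
  have hPne : ∏ j, c j s ≠ 0 := Finset.prod_ne_zero_iff.2 fun j _ => hcne j
  have hPd : DifferentiableAt ℂ (fun s => ∏ j, c j s) s :=
    DifferentiableAt.fun_finsetProd fun j _ => hc j
  have hcl : ∀ j, logDeriv (c j) s = 1 / 2 * Complex.digamma ((s + f.κ j) / 2) := fun j => by
    have h1 := logDeriv_comp (g := fun s : ℂ => (s + f.κ j) / 2) (x := s) (hG j) (by fun_prop)
    have h2 : deriv (fun s : ℂ => (s + f.κ j) / 2) s = 1 / 2 := by simp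
    rw [h2, mul_comm] at h1
    exact h1
  have hPl : logDeriv (fun s => ∏ j, c j s) s = ∑ j, logDeriv (c j) s := by
    have := logDeriv_prod (s := Finset.univ) (f := c) (x := s) (fun j _ => hcne j) (fun j _ => hc j)
    rw [← this]
  have hd := (hasSum_neg_logDeriv_dirichletSeries hRP hs).1
  rw [logDeriv_apply, hev.deriv_eq, hev.eq_of_nhds, ← logDeriv_apply,
    logDeriv_mul (f := fun s => a s * (b s * ∏ j, c j s)) (g := f.dirichletSeries) s
      (mul_ne_zero hane (mul_ne_zero hbne hPne)) (dirichletSeries_ne_zero hRP hs)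
      (ha.mul (hb.mul hPd)) hd,
    logDeriv_mul (f := a) (g := fun s => b s * ∏ j, c j s) s hane (mul_ne_zero hbne hPne) ha
      (hb.mul hPd),
    logDeriv_mul (f := b) (g := fun s => ∏ j, c j s) s hbne hPne hb hPd,
    hPl, logDeriv_natCast_cpow_div_two hA, logDeriv_natCast_cpow_div_two hpi]
  simp_rw [hcl]
  rw [← Finset.mul_sum, Complex.natCast_log, Complex.ofReal_log Real.pi_pos.le]
  ring

end NFLFunction

/-! ### The explicit formula for smooth test functions of compact support. -/

section Kernel

open MeasureTheory

theorem integrable_kernel_mul_of_hasSum {ι : Type*} [Countable ι] (H : 𝓢(ℝ, ℂ)) {Φ : ι → ℝ → ℂ}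
    {Ψ : ℝ → ℂ} {c : ι → ℝ} (k : ℕ) (hΦ : ∀ i, Continuous (Φ i))
    (hb : ∀ i y, ‖Φ i y‖ ≤ c i * (1 + |y|) ^ k) (hc : Summable c)
    (hs : ∀ y, HasSum (fun i => Φ i y) (Ψ y)) :
    Integrable fun y => H y * Ψ y := by
  have hm : AEStronglyMeasurable Ψ volume := by
    refine aestronglyMeasurable_of_tendsto_ae (u := (atTop : Filter (Finset ι)))
      (f := fun T y => ∑ i ∈ T, Φ i y) (fun T => ?_) (Eventually.of_forall hs)
    exact (continuous_finsetSum T fun i _ => hΦ i).aestronglyMeasurable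
  refine ((integrable_norm_mul_one_add_abs_pow H k).const_mul (∑' i, c i)).mono'
    (H.continuous.aestronglyMeasurable.mul hm) (Eventually.of_forall fun y => ?_)
  have h1 : ‖Ψ y‖ ≤ (∑' i, c i) * (1 + |y|) ^ k := by
    rw [← (hs y).tsum_eq]
    exact tsum_of_norm_bounded (hc.hasSum.mul_right _) fun i => hb i y
  rw [norm_mul]
  calc ‖H y‖ * ‖Ψ y‖ ≤ ‖H y‖ * ((∑' i, c i) * (1 + |y|) ^ k) := by gcongr
    _ = _ := by ring

/-- The point `3/2 + 2πiy` of the line `Re s = 3/2`. -/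
def criticalShift (y : ℝ) : ℂ := 1 / 2 + linePoint y

theorem criticalShift_re (y : ℝ) : (criticalShift y).re = 3 / 2 := by
  rw [criticalShift, Complex.add_re, linePoint_re]
  norm_num

theorem continuous_criticalShift : Continuous criticalShift :=
  continuous_const.add continuous_linePoint

theorem norm_criticalShift_le (y : ℝ) : ‖criticalShift y‖ ≤ 9 * (1 + |y|) := by
  refine (norm_add_le _ _).trans ?_
  have := norm_linePoint_le y
  have h2 : ‖(1 / 2 : ℂ)‖ = 1 / 2 := by norm_num
  rw [h2]
  linarith [abs_nonneg y]

/-- The transform `∫ g(u) e^((ρ - 1/2)u) du`. -/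
def zeroTransform (g : ℝ → ℂ) (ρ : ℂ) : ℂ := ∫ u : ℝ, g u * Complex.exp ((ρ - 1 / 2) * u)

/-- The summands of the gamma factor's contribution. -/
def gammaSummand (κ : ℂ) (g : ℝ → ℂ) (n : ℕ) : ℂ :=
  g 0 / ((n : ℂ) + 1) -
    2 * ∫ u in Set.Ioi (0 : ℝ), Complex.exp (-(2 * n + 1 / 2 + κ) * u) * g u

/-- The contribution of a gamma factor with parameter `κ` to the explicit formula. -/
def gammaTerm (κ : ℂ) (g : ℝ → ℂ) : ℂ :=
  -Real.eulerMascheroniConstant * g 0 + ∑' n : ℕ, gammaSummand κ g n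

variable {g : ℝ → ℂ} {H : 𝓢(ℝ, ℂ)}

/-- Each fraction of the pair yields an integral over the positive half-line. Evenness of `g`
reflects one of them to the negative half-line, and together they form the full transform. -/
theorem integral_kernel_zero_pair (hH : IsLineKernel g H) (hg : Continuous g)
    (hc : HasCompactSupport g) (he : ∀ u, g (-u) = g u) {ρ : ℂ} (h0 : 0 ≤ ρ.re) (h1 : ρ.re ≤ 1) :
    ∫ y, H y * (1 / (criticalShift y - ρ) + 1 / (criticalShift y - (1 - ρ))) =
      zeroTransform g ρ := by
  have b1 : -1 < (1 / 2 - ρ).re := by simp; linarith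
  have b2 : -1 < (ρ - 1 / 2).re := by simp; linarith
  have e1 : ∀ y, criticalShift y - ρ = linePoint y + (1 / 2 - ρ) := fun y => by
    rw [criticalShift]; ring
  have e2 : ∀ y, criticalShift y - (1 - ρ) = linePoint y + (ρ - 1 / 2) := fun y => by
    rw [criticalShift]; ring
  have hint : ∀ b : ℂ, -1 < b.re → Integrable fun y => H y * (1 / (linePoint y + b)) := by
    intro b hb
    have := continuous_linePoint
    refine integrable_kernel_mul H (c := 1 / (1 + b.re)) 0 ?_ fun y => ?_
    · exact continuous_const.div (by fun_prop) (linePoint_add_ne_zero hb)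
    · rw [norm_div, norm_one, pow_zero, mul_one]
      have h2 := Complex.re_le_norm (linePoint y + b)
      rw [Complex.add_re, linePoint_re] at h2
      have : 0 < 1 + b.re := by linarith
      gcongr
  simp_rw [e1, e2, mul_add]
  rw [integral_add (hint _ b1) (hint _ b2), hH.integral_div b1, hH.integral_div b2]
  have hi : Integrable fun u : ℝ => g u * Complex.exp ((ρ - 1 / 2) * u) :=
    (by fun_prop : Continuous fun u : ℝ => g u * Complex.exp ((ρ - 1 / 2) * u)).integrable_of_hasCompactSupport
      hc.mul_right
  rw [zeroTransform, ← intervalIntegral.integral_Iic_add_Ioi (b := (0 : ℝ)) hi.integrableOn hi.integrableOn,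
    add_comm]
  congr 1
  · have h3 := integral_comp_neg_Ioi (0 : ℝ) fun u : ℝ => g u * Complex.exp ((ρ - 1 / 2) * u)
    rw [neg_zero] at h3
    rw [← h3]
    refine setIntegral_congr_fun measurableSet_Ioi fun u _ => ?_
    simp only [he]
    rw [mul_comm]
    congr 2
    push_cast
    ring
  · refine setIntegral_congr_fun measurableSet_Ioi fun u _ => ?_
    rw [mul_comm]
    congr 2
    ring

/-- The series of the digamma function is integrated term by term; on the line its summands grow
only linearly in `y`. -/
theorem digamma_kernel (hH : IsLineKernel g H) {κ : ℂ} (hκ : 0 < κ.re) :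
    (Integrable fun y => H y * Complex.digamma ((criticalShift y + κ) / 2)) ∧
    Summable (gammaSummand κ g) ∧
    ∫ y, H y * Complex.digamma ((criticalShift y + κ) / 2) = gammaTerm κ g := by
  have hcs := continuous_criticalShift
  have hre : ∀ y, 3 / 4 ≤ ((criticalShift y + κ) / 2).re := fun y => by
    have h1 : ((criticalShift y + κ) / 2).re = ((criticalShift y).re + κ.re) / 2 := by simp
    rw [h1, criticalShift_re]
    linarith
  have hne : ∀ (n : ℕ) y, (n : ℂ) + (criticalShift y + κ) / 2 ≠ 0 := fun n y h => by
    have h1 := congrArg Complex.re h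
    rw [Complex.add_re, Complex.natCast_re, Complex.zero_re] at h1
    linarith [hre y, (Nat.cast_nonneg n : (0 : ℝ) ≤ n)]
  set Φ : ℕ → ℝ → ℂ := fun n y => 1 / ((n : ℂ) + 1) - 1 / ((n : ℂ) + (criticalShift y + κ) / 2)
  have hΦ : ∀ n, Continuous (Φ n) := fun n =>
    continuous_const.sub (continuous_const.div (by fun_prop) (hne n))
  have hb : ∀ n y, ‖Φ n y‖ ≤ ((10 + ‖κ‖) * (1 / ((n : ℝ) + 3 / 4) ^ 2)) * (1 + |y|) ^ 1 := by
    intro n y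
    refine (norm_digamma_summand_le (by norm_num) (by norm_num) (hre y) n).trans ?_
    have h1 : ‖(criticalShift y + κ) / 2 - 1‖ ≤ (10 + ‖κ‖) * (1 + |y|) := by
      refine (norm_sub_le _ _).trans ?_
      rw [norm_div, norm_one, Complex.norm_ofNat]
      have h2 := norm_add_le (criticalShift y) κ
      have h3 := norm_criticalShift_le y
      nlinarith [abs_nonneg y, norm_nonneg κ, mul_nonneg (norm_nonneg κ) (abs_nonneg y)]
    calc _ ≤ (10 + ‖κ‖) * (1 + |y|) * (1 / ((n : ℝ) + 3 / 4) ^ 2) := by gcongr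
      _ = _ := by ring
  have hc := (summable_inv_nat_add_sq (a := 3 / 4) (by norm_num)).mul_left (10 + ‖κ‖)
  have hs : ∀ y, HasSum (fun n => Φ n y)
      (Complex.digamma ((criticalShift y + κ) / 2) + Real.eulerMascheroniConstant) := by
    intro y
    have hpos : 0 < ((criticalShift y + κ) / 2).re := by linarith [hre y]
    rw [digamma_eq_tsum hpos, add_comm, add_neg_cancel_left]
    exact (summable_digamma_summand hpos).hasSum
  have h1 := integrable_kernel_mul_of_hasSum H 1 hΦ hb hc hs
  have h2 := hasSum_integral_kernel_mul H 1 hΦ hb hc hs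
  have hterm : ∀ n, ∫ y, H y * Φ n y = gammaSummand κ g n := by
    intro n
    have hb' : -1 < (2 * (n : ℂ) + 1 / 2 + κ).re := by
      simp
      linarith [(Nat.cast_nonneg n : (0 : ℝ) ≤ n)]
    have e : ∀ y, H y * Φ n y = H y * (1 / ((n : ℂ) + 1)) -
        2 * (H y * (1 / (linePoint y + (2 * n + 1 / 2 + κ)))) := by
      intro y
      have h3 : (n : ℂ) + (criticalShift y + κ) / 2 = (linePoint y + (2 * n + 1 / 2 + κ)) / 2 := by
        rw [criticalShift]; ring
      simp only [Φ, h3]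
      rw [one_div_div]
      ring
    have i1 : Integrable fun y => H y * (1 / ((n : ℂ) + 1)) := H.integrable.mul_const _
    have i2 : Integrable fun y => H y * (1 / (linePoint y + (2 * n + 1 / 2 + κ))) := by
      have h4 : Integrable fun y => H y * Φ n y :=
        integrable_kernel_mul H 1 (hΦ n) (hb n)
      have h5 := ((i1.sub h4).const_mul (1 / 2))
      refine h5.congr (Eventually.of_forall fun y => ?_)
      simp only [Pi.sub_apply, e]
      ring
    simp_rw [e]
    rw [integral_sub i1 (i2.const_mul 2), integral_const_mul, hH.integral_div hb', integral_mul_const,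
      hH.integral_eq, gammaSummand, mul_one_div]
  simp_rw [hterm] at h2
  have i3 : Integrable fun y => H y * (Real.eulerMascheroniConstant : ℂ) := H.integrable.mul_const _
  have i4 : Integrable fun y => H y * Complex.digamma ((criticalShift y + κ) / 2) := by
    refine (h1.sub i3).congr (Eventually.of_forall fun y => ?_)
    simp only [Pi.sub_apply]
    ring
  refine ⟨i4, h2.summable, ?_⟩
  simp_rw [mul_add] at h2
  rw [integral_add i4 i3, integral_mul_const, hH.integral_eq] at h2
  rw [gammaTerm, h2.tsum_eq]
  ring

end Kernel

instance countable_heightOneSpectrum (F : Type*) [Field F] [NumberField F] :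
    Countable (HeightOneSpectrum (𝓞 F)) := by
  have h : (Set.univ : Set (HeightOneSpectrum (𝓞 F))) ⊆ ⋃ n : ℕ, (primesLE F n : Set _) := by
    intro p _
    exact Set.mem_iUnion.2 ⟨primeNorm p, by simp [mem_primesLE]⟩
  exact Set.countable_univ_iff.1
    ((Set.countable_iUnion fun n => (Finset.countable_toSet _)).mono h)

namespace NFLFunction

open MeasureTheory

variable {F : Type*} [Field F] [NumberField F] {d : ℕ}

/-- The terms of the sum over prime powers `𝔭^(m+1)` in the explicit formula, separately for each
local parameter. -/
def primePowerTerm (f : NFLFunction F d) (g : ℝ → ℂ)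
    (x : (HeightOneSpectrum (𝓞 F) × Fin d) × ℕ) : ℂ :=
  (Real.log (primeNorm x.1.1) : ℂ) * f.eulerTerm x.1 (1 / 2) ^ (x.2 + 1) *
    g (((x.2 + 1 : ℕ) : ℝ) * Real.log (primeNorm x.1.1))

theorem countable_stripZeros {f : NFLFunction F d} (hf : f.IsSelfDual) (hp : f.NoPoles)
    (hRP : f.RamanujanPetersson) (hκ : ∀ j, 0 < (f.κ j).re) : Countable f.stripZeros := by
  have h2 : f.xi 2 ≠ 0 := xi_ne_zero_of_one_lt_re hRP hκ (by simp)
  have h : f.stripZeros ⊆ ⋃ n : ℕ, {ρ | f.xi ρ = 0 ∧ ‖ρ - 0‖ ≤ n} := by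
    intro ρ hρ
    obtain ⟨n, hn⟩ := exists_nat_ge ‖ρ - 0‖
    exact Set.mem_iUnion.2 ⟨n, (mem_stripZeros_iff hf hp hRP hκ ρ).1 hρ, hn⟩
  exact (Set.countable_iUnion fun n : ℕ =>
    (finite_zeros_closedBall (differentiable_xi hp) h2 0 n).countable).mono h

variable {g : ℝ → ℂ} {H : 𝓢(ℝ, ℂ)}

theorem hasSum_zeros_kernel {f : NFLFunction F d} (hf : f.IsSelfDual) (hp : f.NoPoles)
    (hRP : f.RamanujanPetersson) (hκ : ∀ j, 0 < (f.κ j).re) (hH : IsLineKernel g H)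
    (hg : Continuous g) (hc : HasCompactSupport g) (he : ∀ u, g (-u) = g u) :
    HasSum (fun ρ : f.stripZeros => (f.zeroMult ρ : ℂ) * zeroTransform g ρ)
      (∫ y, H y * (2 * logDeriv f.xi (criticalShift y))) := by
  have := countable_stripZeros hf hp hRP hκ
  obtain ⟨hs, hpf⟩ := xi_partial_fractions hf hp hRP hκ
  have hcs := continuous_criticalShift
  have hne : ∀ (ρ : ℂ), ρ.re ≤ 1 → ∀ y, criticalShift y - ρ ≠ 0 := fun ρ hρ y h => by
    have h1 := congrArg Complex.re h
    rw [Complex.sub_re, criticalShift_re, Complex.zero_re] at h1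
    linarith
  have hne2 : ∀ (ρ : f.stripZeros) y, criticalShift y - (1 - ρ) ≠ 0 := fun ρ y =>
    hne _ (by have := ρ.2.1; simp; linarith) y
  have key := hasSum_integral_kernel_mul H (ι := f.stripZeros)
    (Φ := fun ρ y => (f.zeroMult ρ : ℂ) *
      (1 / (criticalShift y - ρ) + 1 / (criticalShift y - (1 - ρ))))
    (Ψ := fun y => 2 * logDeriv f.xi (criticalShift y))
    -- On the line `‖s‖ ≤ 9 (1 + |y|)`. Hence `2‖s‖ + 1 ≤ 19 (1 + |y|)` and, with `δ = 1/2`, `2‖s‖ +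
    -- 5 ≤ 23 (1 + |y|)`; altogether cubic growth.
    (c := fun ρ => (19 * 23 ^ 2 * 2) * ((f.zeroMult ρ : ℝ) * (1 / (1 + ‖(ρ : ℂ)‖ ^ 2)))) 3
    (fun ρ => continuous_const.mul ((continuous_const.div (by fun_prop) (hne ρ ρ.2.2.1)).add
      (continuous_const.div (by fun_prop) (hne2 ρ)))) ?_ (hs.mul_left _) ?_
  · convert! key using 2 with ρ
    rw [← integral_kernel_zero_pair hH hg hc he ρ.2.1 ρ.2.2.1, ← integral_const_mul]
    refine integral_congr_ae (Eventually.of_forall fun y => ?_)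
    simp only
    ring
  · intro ρ y
    rw [norm_mul, Complex.norm_natCast]
    have h1 := norm_zero_pair_le (s := criticalShift y) (δ := 1 / 2) (by norm_num)
      (by rw [criticalShift_re]; norm_num) ρ.2.1 ρ.2.2.1
    have h2 := norm_criticalShift_le y
    have h3 := norm_nonneg (criticalShift y)
    have h4 := abs_nonneg y
    calc _ ≤ (f.zeroMult ρ : ℝ) * ((2 * ‖criticalShift y‖ + 1) *
          ((‖criticalShift y‖ + 2) / (1 / 2) + 1) ^ 2 * (2 / (1 + ‖(ρ : ℂ)‖ ^ 2))) := by gcongr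
      _ ≤ (f.zeroMult ρ : ℝ) * ((19 * (1 + |y|)) *
          (23 * (1 + |y|)) ^ 2 * (2 / (1 + ‖(ρ : ℂ)‖ ^ 2))) := by
          gcongr
          · linarith
          · rw [div_div_eq_mul_div]; linarith
      _ = _ := by ring
  · intro y
    exact hpf _ (by rw [criticalShift_re]; norm_num)

theorem hasSum_primes_kernel {f : NFLFunction F d} (hRP : f.RamanujanPetersson)
    (hH : IsLineKernel g H) :
    (Integrable fun y => H y * -logDeriv f.dirichletSeries (criticalShift y)) ∧
    HasSum (f.primePowerTerm g) (∫ y, H y * -logDeriv f.dirichletSeries (criticalShift y)) := by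
  have hcs := continuous_criticalShift
  have hre : ∀ y, 1 < (criticalShift y).re := fun y => by rw [criticalShift_re]; norm_num
  have hΦ : ∀ x : (HeightOneSpectrum (𝓞 F) × Fin d) × ℕ, Continuous fun y : ℝ =>
      (Real.log (primeNorm x.1.1) : ℂ) * f.eulerTerm x.1 (criticalShift y) ^ (x.2 + 1) := by
    intro x
    have h1 : Continuous (f.eulerTerm x.1) :=
      continuous_iff_continuousAt.2 fun s => (f.hasDerivAt_eulerTerm x.1 s).continuousAt
    fun_prop
  have hb : ∀ (x : (HeightOneSpectrum (𝓞 F) × Fin d) × ℕ) (y : ℝ),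
      ‖(Real.log (primeNorm x.1.1) : ℂ) * f.eulerTerm x.1 (criticalShift y) ^ (x.2 + 1)‖ ≤
      Real.log (primeNorm x.1.1) * ((primeNorm x.1.1 : ℝ) ^ (-(3 / 2) : ℝ)) ^ (x.2 + 1) *
        (1 + |y|) ^ 0 := by
    intro x y
    rw [pow_zero, mul_one, norm_mul, norm_pow, Complex.norm_real,
      Real.norm_of_nonneg (log_primeNorm_pos _).le]
    have := (log_primeNorm_pos x.1.1).le
    gcongr
    have h2 := norm_eulerTerm_le hRP x.1 (criticalShift y)
    rwa [criticalShift_re] at h2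
  have hc := summable_log_mul_rpow_pow (F := F) (d := d) (σ := 3 / 2) (by norm_num)
  have hs := fun y => (hasSum_neg_logDeriv_dirichletSeries hRP (hre y)).2
  refine ⟨integrable_kernel_mul_of_hasSum H 0 hΦ hb hc hs, ?_⟩
  convert! hasSum_integral_kernel_mul H 0 hΦ hb hc hs using 2 with x
  rw [primePowerTerm, ← hH, ← integral_const_mul]
  refine integral_congr_ae (Eventually.of_forall fun y => ?_)
  have hN : (primeNorm x.1.1 : ℂ) ≠ 0 := by exact_mod_cast primeNorm_ne_zero x.1.1
  -- Splitting off the value at `1/2` leaves `exp (-w log N)`, on which the kernel evaluates `g` at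
  -- `log N`, and at its multiples for higher powers.
  have h3 : f.eulerTerm x.1 (criticalShift y) = f.eulerTerm x.1 (1 / 2) *
      Complex.exp (-linePoint y * Real.log (primeNorm x.1.1)) := by
    rw [eulerTerm, eulerTerm, mul_assoc, Complex.cpow_def_of_ne_zero hN,
      Complex.cpow_def_of_ne_zero hN, ← Complex.exp_add, criticalShift, Complex.natCast_log]
    congr 2
    ring
  simp only
  rw [h3, mul_pow, ← Complex.exp_nat_mul]
  have h4 : -linePoint y * ((((x.2 + 1 : ℕ) : ℝ) * Real.log (primeNorm x.1.1) : ℝ) : ℂ) =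
      ((x.2 + 1 : ℕ) : ℂ) * (-linePoint y * Real.log (primeNorm x.1.1)) := by
    push_cast
    ring
  rw [h4]
  ring

/-- The explicit formula for smooth even test functions of compact support. -/
theorem explicit_formula {f : NFLFunction F d} (hf : f.IsSelfDual) (hp : f.NoPoles)
    (hRP : f.RamanujanPetersson) (hκ : ∀ j, 0 < (f.κ j).re) (hg : ContDiff ℝ (⊤ : ℕ∞) g)
    (hc : HasCompactSupport g) (he : ∀ u, g (-u) = g u) :
    Summable (f.primePowerTerm g) ∧ (∀ j, Summable (gammaSummand (f.κ j) g)) ∧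
    HasSum (fun ρ : f.stripZeros => (f.zeroMult ρ : ℂ) * zeroTransform g ρ)
      (g 0 * ((Real.log f.A : ℂ) - (d * Module.finrank ℚ F : ℕ) * (Real.log Real.pi : ℂ))
        + ∑ j, gammaTerm (f.κ j) g - 2 * ∑' x, f.primePowerTerm g x) := by
  obtain ⟨H, hH⟩ := exists_isLineKernel hg hc
  obtain ⟨hi, hsum⟩ := hasSum_primes_kernel hRP hH
  have hz := hasSum_zeros_kernel hf hp hRP hκ hH hg.continuous hc he
  refine ⟨hsum.summable, fun j => (digamma_kernel hH (hκ j)).2.1, ?_⟩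
  convert! hz using 1
  set c : ℂ := (Real.log f.A : ℂ) - (d * Module.finrank ℚ F : ℕ) * (Real.log Real.pi : ℂ)
  have e : ∀ y, H y * (2 * logDeriv f.xi (criticalShift y)) =
      H y * c + ∑ j, H y * Complex.digamma ((criticalShift y + f.κ j) / 2) -
        2 * (H y * -logDeriv f.dirichletSeries (criticalShift y)) := by
    intro y
    rw [logDeriv_xi hRP hκ (by rw [criticalShift_re]; norm_num), ← Finset.mul_sum]
    simp only [c]
    ring
  have i1 : Integrable fun y => H y * c := H.integrable.mul_const _
  have i2 : Integrable fun y => ∑ j, H y * Complex.digamma ((criticalShift y + f.κ j) / 2) :=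
    integrable_finsetSum _ fun j _ => (digamma_kernel hH (hκ j)).1
  rw [funext e]
  rw [integral_sub (f := fun y => H y * c + ∑ j, H y * Complex.digamma ((criticalShift y + f.κ j) / 2))
    (i1.add i2) (hi.const_mul 2), integral_add i1 i2, integral_const_mul,
    integral_mul_const, hH.integral_eq, integral_finsetSum _ fun j _ => (digamma_kernel hH (hκ j)).1,
    hsum.tsum_eq]
  congr 2
  exact Finset.sum_congr rfl fun j _ => ((digamma_kernel hH (hκ j)).2.2).symm

end NFLFunction

/-! ### Fourier bounds for a Schwartz function cut by a steep step. -/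

section Truncation

open MeasureTheory

theorem SchwartzMap.exists_norm_mul_one_add_abs_pow_le (G : 𝓢(ℝ, ℂ)) (k : ℕ) :
    ∃ C, 0 ≤ C ∧ ∀ u, ‖G u‖ * (1 + |u|) ^ k ≤ C := by
  have h : ∀ u, ‖G u‖ * (1 + |u|) ^ k ≤
      2 ^ k * (Finset.Iic (k, 0)).sup (fun m => SchwartzMap.seminorm ℝ m.1 m.2) G := fun u => by
    have h := SchwartzMap.one_add_le_sup_seminorm_apply (𝕜 := ℝ) (m := (k, 0)) le_rfl le_rfl G u
    rwa [norm_iteratedFDeriv_zero, mul_comm] at h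
  exact ⟨_, le_trans (by positivity) (h 0), h⟩

theorem SchwartzMap.hasDerivAt_derivCLM (G : 𝓢(ℝ, ℂ)) (u : ℝ) :
    HasDerivAt G (SchwartzMap.derivCLM ℝ ℂ G u) u := by
  rw [SchwartzMap.derivCLM_apply]
  exact G.differentiableAt.hasDerivAt

theorem integral_deriv_mul_exp {Q Q' : ℝ → ℂ} (hQ : ∀ u, HasDerivAt Q (Q' u) u)
    (hi : Integrable Q) (hi' : Integrable Q') (γ : ℝ) :
    ∫ u, Q' u * Complex.exp (γ * u * Complex.I) =
      -(γ * Complex.I) * ∫ u, Q u * Complex.exp (γ * u * Complex.I) := by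
  have hE : ∀ u : ℝ, HasDerivAt (fun u : ℝ => Complex.exp (γ * u * Complex.I))
      (Complex.exp (γ * u * Complex.I) * (γ * Complex.I)) u := fun u => by
    have h := (((hasDerivAt_id u).ofReal_comp).const_mul (γ : ℂ)).mul_const Complex.I
    simpa using h.cexp
  have hb : ∀ u : ℝ, ‖Complex.exp (γ * u * Complex.I)‖ ≤ 1 := fun u => by
    have := Complex.norm_exp_ofReal_mul_I (γ * u)
    rw [Complex.ofReal_mul] at this
    exact this.le
  have hm : AEStronglyMeasurable (fun u : ℝ => Complex.exp (γ * u * Complex.I)) volume :=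
    (by fun_prop : Continuous fun u : ℝ => Complex.exp (γ * u * Complex.I)).aestronglyMeasurable
  have i1 : Integrable fun u => Q u * Complex.exp (γ * u * Complex.I) :=
    hi.mul_bdd hm (Eventually.of_forall hb)
  have i2 : Integrable fun u => Q' u * Complex.exp (γ * u * Complex.I) :=
    hi'.mul_bdd hm (Eventually.of_forall hb)
  have i3 : Integrable fun u => Q u * (Complex.exp (γ * u * Complex.I) * (γ * Complex.I)) := by
    simpa only [mul_assoc] using i1.mul_const (γ * Complex.I)
  have h := integral_mul_deriv_eq_deriv_mul_of_integrable (fun u _ => hQ u) (fun u _ => hE u)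
    i3 i2 i1
  rw [eq_comm, neg_eq_iff_eq_neg] at h
  rw [h, neg_mul, ← integral_const_mul]
  congr 1
  refine integral_congr_ae (Eventually.of_forall fun u => ?_)
  simp only
  ring

theorem norm_integral_mul_exp_le (Q : ℝ → ℂ) (γ : ℝ) :
    ‖∫ u, Q u * Complex.exp (γ * u * Complex.I)‖ ≤ ∫ u, ‖Q u‖ := by
  refine (norm_integral_le_integral_norm _).trans_eq
    (integral_congr_ae (Eventually.of_forall fun u => ?_))
  have := Complex.norm_exp_ofReal_mul_I (γ * u)
  rw [Complex.ofReal_mul] at this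
  simp only
  rw [norm_mul, this, mul_one]

theorem one_add_abs_mul_norm_integral_mul_exp_le {Q Q' : ℝ → ℂ}
    (hQ : ∀ u, HasDerivAt Q (Q' u) u) (hi : Integrable Q) (hi' : Integrable Q') (γ : ℝ) :
    (1 + |γ|) * ‖∫ u, Q u * Complex.exp (γ * u * Complex.I)‖ ≤ (∫ u, ‖Q u‖) + ∫ u, ‖Q' u‖ := by
  have h0 := norm_integral_mul_exp_le Q γ
  have h1 := norm_integral_mul_exp_le Q' γ
  rw [integral_deriv_mul_exp hQ hi hi', norm_mul, norm_neg, norm_mul, Complex.norm_I, mul_one,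
    Complex.norm_real, Real.norm_eq_abs] at h1
  linarith

theorem one_add_sq_mul_norm_integral_mul_exp_le {Q Q' Q'' : ℝ → ℂ}
    (hQ : ∀ u, HasDerivAt Q (Q' u) u) (hQ' : ∀ u, HasDerivAt Q' (Q'' u) u) (hi : Integrable Q)
    (hi' : Integrable Q') (hi'' : Integrable Q'') (γ : ℝ) :
    (1 + γ ^ 2) * ‖∫ u, Q u * Complex.exp (γ * u * Complex.I)‖ ≤
      (∫ u, ‖Q u‖) + ∫ u, ‖Q'' u‖ := by
  have h0 := norm_integral_mul_exp_le Q γ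
  have h1 := norm_integral_mul_exp_le Q'' γ
  rw [integral_deriv_mul_exp hQ' hi' hi'', integral_deriv_mul_exp hQ hi hi', ← mul_assoc, norm_mul,
    norm_mul, norm_neg, norm_mul, Complex.norm_I, mul_one,
    Complex.norm_real, Real.norm_eq_abs, abs_mul_abs_self, ← sq] at h1
  linarith

theorem integrable_and_integral_norm_le_of_bump {S : ℝ → ℂ} (hS : Continuous S) {w b a δ : ℝ}
    (hδ : 0 ≤ δ)
    (h : ∀ u, ‖S u‖ ≤ w * (1 + u ^ 2)⁻¹ + (Set.Icc a (a + δ)).indicator (fun _ => b) u) :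
    Integrable S ∧ ∫ u, ‖S u‖ ≤ w * Real.pi + b * δ := by
  have i1 : Integrable fun u : ℝ => w * (1 + u ^ 2)⁻¹ := integrable_inv_one_add_sq.const_mul w
  have i2 : Integrable ((Set.Icc a (a + δ)).indicator fun _ => b) :=
    (integrable_indicator_iff measurableSet_Icc).2 (integrableOn_const (by simp))
  refine ⟨(i1.add i2).mono' hS.aestronglyMeasurable (Eventually.of_forall h), ?_⟩
  have h3 : Integrable fun u => ‖S u‖ :=
    ((i1.add i2).mono' hS.aestronglyMeasurable (Eventually.of_forall h)).norm
  refine (integral_mono h3 (i1.add i2) h).trans_eq ?_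
  simp only [Pi.add_apply]
  rw [integral_add i1 i2, integral_const_mul, integral_univ_inv_one_add_sq,
    integral_indicator measurableSet_Icc, setIntegral_const]
  simp [hδ, mul_comm]

theorem exists_abs_deriv_le_indicator {T : ℝ → ℝ} (hT : Continuous (deriv T)) {c₀ c₁ : ℝ}
    (h0 : ∀ x < 0, T x = c₀) (h1 : ∀ x, 1 < x → T x = c₁) :
    ∃ M, 0 ≤ M ∧ ∀ x, |deriv T x| ≤ (Set.Icc (0 : ℝ) 1).indicator (fun _ => M) x := by
  obtain ⟨M, hM⟩ := (isCompact_Icc (a := (0 : ℝ)) (b := 1)).exists_bound_of_continuousOn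
    hT.continuousOn
  have hM0 : 0 ≤ M := (norm_nonneg _).trans (hM 0 (by simp))
  refine ⟨M, hM0, fun x => ?_⟩
  by_cases hx : x ∈ Set.Icc (0 : ℝ) 1
  · rw [Set.indicator_of_mem hx]
    exact hM x hx
  · rw [Set.indicator_of_notMem hx]
    rw [Set.mem_Icc, not_and_or, not_le, not_le] at hx
    have : deriv T x = 0 := by
      rcases hx with hx | hx
      · exact (Filter.EventuallyEq.deriv_eq ((eventually_lt_nhds hx).mono h0)).trans
          (deriv_const x c₀)
      · exact (Filter.EventuallyEq.deriv_eq ((eventually_gt_nhds hx).mono h1)).trans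
          (deriv_const x c₁)
    simp [this]

/-- A smooth step rising from `0` to `1` on the interval `[log X, log (X + 1)]`. -/
def logStep (X : ℕ) (u : ℝ) : ℝ :=
  Real.smoothTransition ((u - Real.log X) / (Real.log (X + 1) - Real.log X))

theorem log_gap_pos {X : ℕ} (hX : 2 ≤ X) : 0 < Real.log (X + 1) - Real.log X := by
  have : (0 : ℝ) < X := by positivity
  exact sub_pos.2 (Real.log_lt_log this (by linarith))

theorem log_gap_le_one {X : ℕ} (hX : 2 ≤ X) : Real.log (X + 1) - Real.log X ≤ 1 := by
  have h0 : (2 : ℝ) ≤ X := by exact_mod_cast hX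
  rw [← Real.log_div (by positivity) (by positivity)]
  refine (Real.log_le_sub_one_of_pos (by positivity)).trans ?_
  rw [sub_le_iff_le_add, div_le_iff₀ (by positivity)]
  linarith

theorem inv_log_gap_le {X : ℕ} (hX : 2 ≤ X) : (Real.log (X + 1) - Real.log X)⁻¹ ≤ 2 * X := by
  have h0 : (2 : ℝ) ≤ X := by exact_mod_cast hX
  have h1 := Real.log_le_sub_one_of_pos (x := (X : ℝ) / (X + 1)) (by positivity)
  rw [Real.log_div (by positivity) (by positivity)] at h1
  have h2 : (X : ℝ) / (X + 1) - 1 = -(1 / (X + 1)) := by field_simp; ring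
  rw [h2] at h1
  have h3 : 1 / ((X : ℝ) + 1) ≤ Real.log (X + 1) - Real.log X := by linarith
  calc _ ≤ (1 / ((X : ℝ) + 1))⁻¹ := inv_anti₀ (by positivity) h3
    _ = X + 1 := by simp
    _ ≤ _ := by linarith

theorem logStep_of_le {X : ℕ} (hX : 2 ≤ X) {u : ℝ} (hu : u ≤ Real.log X) : logStep X u = 0 :=
  Real.smoothTransition.zero_of_nonpos
    (div_nonpos_of_nonpos_of_nonneg (by linarith) (log_gap_pos hX).le)

theorem logStep_of_ge {X : ℕ} (hX : 2 ≤ X) {u : ℝ} (hu : Real.log (X + 1) ≤ u) :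
    logStep X u = 1 :=
  Real.smoothTransition.one_of_one_le ((one_le_div (log_gap_pos hX)).2 (by linarith))

theorem logStep_nonneg (X : ℕ) (u : ℝ) : 0 ≤ logStep X u := Real.smoothTransition.nonneg _

theorem logStep_le_one (X : ℕ) (u : ℝ) : logStep X u ≤ 1 := Real.smoothTransition.le_one _

theorem contDiff_logStep (X : ℕ) : ContDiff ℝ (⊤ : ℕ∞) (logStep X) :=
  Real.smoothTransition.contDiff.comp ((contDiff_id.sub contDiff_const).div_const _)

/-- One or two integrations by parts give the two entries of the minimum. The first derivative of
the step has bounded integral however short the transition is. The second has integral of the order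
of the inverse length of the transition, which is at most `2X`. -/
theorem exists_norm_integral_logStep_le (G : 𝓢(ℝ, ℂ)) :
    ∃ C, 0 ≤ C ∧ ∀ X : ℕ, 2 ≤ X → ∀ γ : ℝ,
      ‖∫ u, (logStep X u • G u) * Complex.exp (γ * u * Complex.I)‖ ≤
        C / (1 + Real.log X) ^ 3 * min (1 / (1 + |γ|)) (X / (1 + γ ^ 2)) := by
  set T := Real.smoothTransition
  set G1 : 𝓢(ℝ, ℂ) := SchwartzMap.derivCLM ℝ ℂ G
  set G2 : 𝓢(ℝ, ℂ) := SchwartzMap.derivCLM ℝ ℂ G1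
  have hT : ContDiff ℝ 3 T := Real.smoothTransition.contDiff
  have hT1 : ContDiff ℝ 2 (deriv T) := hT.deriv'
  have hT2 : ContDiff ℝ 1 (deriv (deriv T)) := hT1.deriv'
  obtain ⟨M1, hM1, hM1'⟩ := exists_abs_deriv_le_indicator (T := T) hT1.continuous (c₀ := 0) (c₁ := 1)
    (fun x hx => Real.smoothTransition.zero_of_nonpos hx.le)
    (fun x hx => Real.smoothTransition.one_of_one_le hx.le)
  have hz : ∀ x, x ∉ Set.Icc (0 : ℝ) 1 → deriv T x = 0 := fun x hx => by
    have := hM1' x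
    rw [Set.indicator_of_notMem hx] at this
    exact abs_nonpos_iff.1 this
  obtain ⟨M2, hM2, hM2'⟩ := exists_abs_deriv_le_indicator (T := deriv T) hT2.continuous
    (c₀ := 0) (c₁ := 0) (fun x hx => hz x fun h => absurd h.1 (by linarith))
    (fun x hx => hz x fun h => absurd h.2 (by linarith))
  -- Of these five powers, three become `(1 + log X)^{-3}` and two make the tail integrable.
  obtain ⟨C0, hC0, hG0⟩ := G.exists_norm_mul_one_add_abs_pow_le 5
  obtain ⟨C1, hC1, hG1⟩ := G1.exists_norm_mul_one_add_abs_pow_le 5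
  obtain ⟨C2, hC2, hG2⟩ := G2.exists_norm_mul_one_add_abs_pow_le 5
  set B := C0 + C1 + C2
  set M := M1 + M2
  refine ⟨B * (2 * Real.pi + 6 * M) * 2, by positivity, fun X hX γ => ?_⟩
  set a := Real.log X
  set δ := Real.log (X + 1) - Real.log X
  have hX2 : (2 : ℝ) ≤ X := by exact_mod_cast hX
  have ha : 0 ≤ a := Real.log_nonneg (by linarith)
  have hδ : 0 < δ := log_gap_pos hX
  have hδ1 : δ ≤ 1 := log_gap_le_one hX
  have hδX : δ⁻¹ ≤ 2 * X := inv_log_gap_le hX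
  set w := B / (1 + a) ^ 3
  have hw : 0 ≤ w := by positivity
  -- decay of the Schwartz functions beyond `a`
  have decay : ∀ (S : 𝓢(ℝ, ℂ)) (C : ℝ), C ≤ B → (∀ u, ‖S u‖ * (1 + |u|) ^ 5 ≤ C) →
      ∀ u, a ≤ u → ‖S u‖ ≤ w * (1 + u ^ 2)⁻¹ ∧ ‖S u‖ ≤ w := by
    intro S C hCB hS u hu
    have hu0 : 0 ≤ u := ha.trans hu
    have h1 := (hS u).trans hCB
    rw [abs_of_nonneg hu0] at h1
    have h2 : (1 + a) ^ 3 * (1 + u ^ 2) ≤ (1 + u) ^ 5 := by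
      have : (1 + u) ^ 5 = (1 + u) ^ 3 * (1 + u) ^ 2 := by ring
      rw [this]
      gcongr
      nlinarith
    have h3 : ‖S u‖ ≤ w * (1 + u ^ 2)⁻¹ := by
      have : w * (1 + u ^ 2)⁻¹ = B / ((1 + a) ^ 3 * (1 + u ^ 2)) := by
        simp only [w]; field_simp
      rw [this, le_div_iff₀ (by positivity)]
      exact (mul_le_mul_of_nonneg_left h2 (norm_nonneg _)).trans h1
    refine ⟨h3, h3.trans ?_⟩
    exact mul_le_of_le_one_right hw (inv_le_one_of_one_le₀ (by nlinarith))
  have hv : ∀ u, HasDerivAt (fun u => (u - a) / δ) δ⁻¹ u := fun u => by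
    simpa using ((hasDerivAt_id u).sub_const a).div_const δ
  set θ : ℝ → ℝ := logStep X
  set θ1 : ℝ → ℝ := fun u => deriv T ((u - a) / δ) * δ⁻¹
  set θ2 : ℝ → ℝ := fun u => deriv (deriv T) ((u - a) / δ) * δ⁻¹ * δ⁻¹
  have hθ : ∀ u, HasDerivAt θ (θ1 u) u := fun u =>
    ((hT.differentiable (by norm_num)) _).hasDerivAt.comp u (hv u)
  have hθ1 : ∀ u, HasDerivAt θ1 (θ2 u) u := fun u =>
    (((hT1.differentiable (by norm_num)) _).hasDerivAt.comp u (hv u)).mul_const _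
  set Q0 : ℝ → ℂ := fun u => θ u • G u
  set Q1 : ℝ → ℂ := fun u => θ u • G1 u + θ1 u • G u
  set Q2 : ℝ → ℂ := fun u => (θ u • G2 u + θ1 u • G1 u) + (θ1 u • G1 u + θ2 u • G u)
  have hQ0 : ∀ u, HasDerivAt Q0 (Q1 u) u := fun u => (hθ u).smul (G.hasDerivAt_derivCLM u)
  have hQ1 : ∀ u, HasDerivAt Q1 (Q2 u) u := fun u =>
    ((hθ u).smul (G1.hasDerivAt_derivCLM u)).add ((hθ1 u).smul (G.hasDerivAt_derivCLM u))
  have hTc := hT.continuous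
  have hT1c := hT1.continuous
  have hT2c := hT2.continuous
  have hθc : Continuous θ := (contDiff_logStep X).continuous
  have hθ1c : Continuous θ1 := by fun_prop
  have hθ2c : Continuous θ2 := by fun_prop
  have cG := G.continuous
  have cG1 := G1.continuous
  have cG2 := G2.continuous
  -- pointwise bounds
  have bθ : ∀ (S : 𝓢(ℝ, ℂ)) (C : ℝ), C ≤ B → (∀ u, ‖S u‖ * (1 + |u|) ^ 5 ≤ C) →
      ∀ u, ‖θ u • S u‖ ≤ w * (1 + u ^ 2)⁻¹ := by
    intro S C hCB hS u
    rw [norm_smul, Real.norm_of_nonneg (logStep_nonneg X u)]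
    rcases le_total u a with hu | hu
    · rw [logStep_of_le hX hu, zero_mul]
      positivity
    · exact (mul_le_of_le_one_left (norm_nonneg _) (logStep_le_one X u)).trans
        (decay S C hCB hS u hu).1
  have mem : ∀ u, (u - a) / δ ∈ Set.Icc (0 : ℝ) 1 ↔ u ∈ Set.Icc a (a + δ) := fun u => by
    rw [Set.mem_Icc, Set.mem_Icc, le_div_iff₀ hδ, div_le_iff₀ hδ]
    constructor <;> rintro ⟨h1, h2⟩ <;> constructor <;> linarith
  have bη : ∀ (η : ℝ → ℝ) (m : ℝ), 0 ≤ m →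
      (∀ x, |η x| ≤ (Set.Icc (0 : ℝ) 1).indicator (fun _ => m) x) →
      ∀ (S : 𝓢(ℝ, ℂ)) (C : ℝ), C ≤ B → (∀ u, ‖S u‖ * (1 + |u|) ^ 5 ≤ C) → ∀ e : ℝ, 0 ≤ e →
      ∀ u, ‖(η ((u - a) / δ) * e) • S u‖ ≤
        (Set.Icc a (a + δ)).indicator (fun _ => w * m * e) u := by
    intro η m hm hη S C hCB hS e he u
    have h1 := hη ((u - a) / δ)
    rw [norm_smul, norm_mul, Real.norm_of_nonneg he, Real.norm_eq_abs]
    by_cases hu : u ∈ Set.Icc a (a + δ)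
    · rw [Set.indicator_of_mem ((mem u).2 hu)] at h1
      rw [Set.indicator_of_mem hu]
      calc _ ≤ m * e * w := by
            gcongr
            exact (decay S C hCB hS u hu.1).2
        _ = _ := by ring
    · rw [Set.indicator_of_notMem (fun h => hu ((mem u).1 h))] at h1
      rw [Set.indicator_of_notMem hu, abs_nonpos_iff.1 h1]
      simp
  have hB0 : C0 ≤ B := by simp only [B]; linarith
  have hB1 : C1 ≤ B := by simp only [B]; linarith
  have hB2 : C2 ≤ B := by simp only [B]; linarith
  obtain ⟨j0, n0⟩ := integrable_and_integral_norm_le_of_bump (S := Q0) (w := w) (b := 0) (a := a)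
    (by fun_prop) hδ.le fun u => by
      rw [Set.indicator_zero, add_zero]
      exact bθ G C0 hB0 hG0 u
  obtain ⟨j1, n1⟩ := integrable_and_integral_norm_le_of_bump (S := Q1) (w := w)
    (b := w * M1 * δ⁻¹) (a := a) (by fun_prop) hδ.le fun u =>
      (norm_add_le _ _).trans (add_le_add (bθ G1 C1 hB1 hG1 u)
        (bη _ M1 hM1 hM1' G C0 hB0 hG0 _ (inv_nonneg.2 hδ.le) u))
  obtain ⟨j2, n2⟩ := integrable_and_integral_norm_le_of_bump (S := Q2) (w := w)
    (b := w * M1 * δ⁻¹ + (w * M1 * δ⁻¹ + w * M2 * (δ⁻¹ * δ⁻¹))) (a := a) (by fun_prop) hδ.le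
      fun u => by
        have e1 := bη _ M1 hM1 hM1' G1 C1 hB1 hG1 _ (inv_nonneg.2 hδ.le) u
        have e2 := bη _ M2 hM2 hM2' G C0 hB0 hG0 (δ⁻¹ * δ⁻¹) (by positivity) u
        rw [← mul_assoc] at e2
        have e3 := bθ G2 C2 hB2 hG2 u
        have e4 := norm_add_le (θ u • G2 u + θ1 u • G1 u) (θ1 u • G1 u + θ2 u • G u)
        have e5 := norm_add_le (θ u • G2 u) (θ1 u • G1 u)
        have e6 := norm_add_le (θ1 u • G1 u) (θ2 u • G u)
        have e7 : (Set.Icc a (a + δ)).indicator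
            (fun _ => w * M1 * δ⁻¹ + (w * M1 * δ⁻¹ + w * M2 * (δ⁻¹ * δ⁻¹))) u =
            (Set.Icc a (a + δ)).indicator (fun _ => w * M1 * δ⁻¹) u +
            ((Set.Icc a (a + δ)).indicator (fun _ => w * M1 * δ⁻¹) u +
            (Set.Icc a (a + δ)).indicator (fun _ => w * M2 * (δ⁻¹ * δ⁻¹)) u) := by
          by_cases hu : u ∈ Set.Icc a (a + δ)
          · simp only [Set.indicator_of_mem hu]
          · simp only [Set.indicator_of_notMem hu, add_zero]
        rw [e7]
        linarith
  have r1 := one_add_abs_mul_norm_integral_mul_exp_le hQ0 j0 j1 γ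
  have r2 := one_add_sq_mul_norm_integral_mul_exp_le hQ0 hQ1 j0 j1 j2 γ
  set N := ‖∫ u, Q0 u * Complex.exp (γ * u * Complex.I)‖
  have hp := Real.pi_pos
  have k1 : (1 + |γ|) * N ≤ w * (2 * Real.pi + 6 * M) * 2 := by
    have : w * M1 * δ⁻¹ * δ = w * M1 := by field_simp
    rw [this] at n1
    have : 0 ≤ w * M1 := by positivity
    have : 0 ≤ w * M2 := by positivity
    have : 0 ≤ w * Real.pi := by positivity
    simp only [M]
    linarith
  have k2 : (1 + γ ^ 2) * N ≤ w * (2 * Real.pi + 6 * M) * 2 * X := by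
    have : (w * M1 * δ⁻¹ + (w * M1 * δ⁻¹ + w * M2 * (δ⁻¹ * δ⁻¹))) * δ =
        2 * (w * M1) + w * M2 * δ⁻¹ := by field_simp; ring
    rw [this] at n2
    have h1 : 0 ≤ w * M1 := by positivity
    have h2 : 0 ≤ w * M2 := by positivity
    have h3 : 0 ≤ w * Real.pi := by positivity
    have h4 : w * M2 * δ⁻¹ ≤ w * M2 * (2 * X) := by gcongr
    have h5 : w * M1 ≤ w * M1 * X := le_mul_of_one_le_right h1 (by linarith)
    have h6 : w * Real.pi ≤ w * Real.pi * X := le_mul_of_one_le_right h3 (by linarith)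
    have h7 : 0 ≤ w * M2 * X := by positivity
    simp only [M]
    linarith
  have hfin : B * (2 * Real.pi + 6 * M) * 2 / (1 + a) ^ 3 = w * (2 * Real.pi + 6 * M) * 2 := by
    simp only [w]; ring
  rw [hfin, mul_min_of_nonneg _ _ (by positivity), mul_one_div, mul_div_assoc']
  refine le_min ?_ ?_
  · rw [le_div_iff₀ (by positivity)]
    linarith
  · rw [le_div_iff₀ (by positivity)]
    linarith

end Truncation

/-! ### Weighted sums over the zeros under the Riemann hypothesis. -/

/-- The weights `T/(T² + a²)` have known sums over the zeros. If `a ≤ 2^K`, the first power of two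
not below `a` already dominates `1/(1 + a)`; otherwise the last term dominates `X/(1 + a²)`. -/
theorem min_le_dyadic_sum {X a : ℝ} (ha : 0 ≤ a) {K : ℕ} (hX : X ≤ 2 ^ K) :
    min (1 / (1 + a)) (X / (1 + a ^ 2)) ≤
      8 * ∑ k ∈ Finset.range (K + 1), (2 : ℝ) ^ k / ((2 ^ k) ^ 2 + a ^ 2) := by
  have single : ∀ k ≤ K, (2 : ℝ) ^ k / ((2 ^ k) ^ 2 + a ^ 2) ≤
      ∑ k ∈ Finset.range (K + 1), (2 : ℝ) ^ k / ((2 ^ k) ^ 2 + a ^ 2) := fun k hk =>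
    Finset.single_le_sum (f := fun k : ℕ => (2 : ℝ) ^ k / ((2 ^ k) ^ 2 + a ^ 2))
      (fun i _ => by positivity) (Finset.mem_range.2 (by omega))
  rcases le_or_gt a (2 ^ K) with h | h
  · refine (min_le_left _ _).trans ?_
    have hex : ∃ k : ℕ, a ≤ 2 ^ k := ⟨K, h⟩
    classical
    set k := Nat.find hex
    have hk : a ≤ 2 ^ k := Nat.find_spec hex
    have hkK : k ≤ K := Nat.find_min' hex h
    have hk2 : (2 : ℝ) ^ k ≤ 2 * (1 + a) := by
      rcases Nat.eq_zero_or_pos k with h0 | h0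
      · rw [h0, pow_zero]; linarith
      · have h1 := Nat.find_min hex (m := k - 1) (by omega)
        rw [not_le] at h1
        have h2 : (2 : ℝ) ^ k = 2 * 2 ^ (k - 1) := by
          rw [← pow_succ']; congr 1; omega
        linarith
    have h3 : 1 / (1 + a) ≤ 8 * ((2 : ℝ) ^ k / ((2 ^ k) ^ 2 + a ^ 2)) := by
      have hp : (0 : ℝ) < 2 ^ k := by positivity
      rw [mul_div_assoc', div_le_div_iff₀ (by positivity) (by positivity)]
      nlinarith
    linarith [single k hkK]
  · refine (min_le_right _ _).trans ?_
    have hp : (0 : ℝ) < 2 ^ K := by positivity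
    have h3 : X / (1 + a ^ 2) ≤ 8 * ((2 : ℝ) ^ K / ((2 ^ K) ^ 2 + a ^ 2)) := by
      calc X / (1 + a ^ 2) ≤ 2 ^ K / (1 + a ^ 2) := by gcongr
        _ ≤ _ := by
          rw [mul_div_assoc', div_le_div_iff₀ (by positivity) (by positivity), mul_comm (8 : ℝ),
            mul_assoc]
          have : ((2 : ℝ) ^ K) ^ 2 ≤ a ^ 2 := by gcongr
          exact mul_le_mul_of_nonneg_left (by nlinarith [sq_nonneg a]) hp.le
    linarith [single K le_rfl]

/-- The constant depends on `κ`. That is harmless, because the bound only serves to show that a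
truncation error tends to zero for fixed `f`. -/
theorem exists_norm_digamma_half_le {κ : ℂ} (hκ : 0 < κ.re) :
    ∃ C, 0 ≤ C ∧ ∀ T : ℝ, 1 ≤ T →
      ‖Complex.digamma ((1 / 2 + T + κ) / 2)‖ ≤ C * (1 + Real.log T) := by
  obtain ⟨C, hC⟩ := exists_norm_digamma_sub_log_le (a := 1 / 2) (by norm_num)
  have hl : 0 ≤ Real.log (1 + ‖κ‖) := Real.log_nonneg (by linarith [norm_nonneg κ])
  have key : ∀ T : ℝ, 1 ≤ T →
      ‖Complex.digamma ((1 / 2 + T + κ) / 2)‖ ≤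
        C + (1 + Real.log T + Real.log (1 + ‖κ‖) + Real.pi) := by
    intro T hT
    set z : ℂ := (1 / 2 + T + κ) / 2
    have hre : z.re = (1 / 2 + T + κ.re) / 2 := by simp [z]
    have h1 := hC z (by rw [hre]; linarith)
    have h2 : ‖Complex.log z‖ ≤ |Real.log ‖z‖| + Real.pi := by
      refine (Complex.norm_le_abs_re_add_abs_im _).trans ?_
      rw [Complex.log_re, Complex.log_im]
      gcongr
      exact Complex.abs_arg_le_pi z
    have hz1 : 1 / 2 ≤ ‖z‖ := le_trans (by rw [hre]; linarith) (Complex.re_le_norm z)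
    have hz2 : ‖z‖ ≤ T * (1 + ‖κ‖) := by
      have h3 : ‖z‖ = ‖(1 / 2 + T + κ : ℂ)‖ / 2 := by simp [z]
      have h4 : ‖(1 / 2 + T + κ : ℂ)‖ ≤ 1 / 2 + T + ‖κ‖ := by
        refine (norm_add_le _ _).trans ?_
        gcongr
        refine (norm_add_le _ _).trans ?_
        rw [Complex.norm_real, Real.norm_of_nonneg (by linarith)]
        norm_num
      rw [h3]
      nlinarith [norm_nonneg κ]
    have h5 : Real.log ‖z‖ ≤ Real.log T + Real.log (1 + ‖κ‖) := by
      rw [← Real.log_mul (by linarith) (by linarith [norm_nonneg κ])]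
      exact Real.log_le_log (by linarith) hz2
    have h6 : -1 ≤ Real.log ‖z‖ := by
      have := Real.log_le_log (by norm_num) hz1
      rw [one_div, Real.log_inv] at this
      linarith [Real.log_two_lt_d9]
    have h7 : |Real.log ‖z‖| ≤ 1 + Real.log T + Real.log (1 + ‖κ‖) := by
      have := Real.log_nonneg hT
      exact abs_le.2 ⟨by linarith, by linarith⟩
    calc ‖Complex.digamma z‖ = ‖(Complex.digamma z - Complex.log z) + Complex.log z‖ := by
          rw [sub_add_cancel]
      _ ≤ C + (|Real.log ‖z‖| + Real.pi) := (norm_add_le _ _).trans (add_le_add h1 h2)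
      _ ≤ _ := by gcongr
  have hC0 : 0 ≤ C := (norm_nonneg _).trans (hC 1 (by norm_num))
  refine ⟨C + 1 + Real.log (1 + ‖κ‖) + Real.pi, by positivity, fun T hT => (key T hT).trans ?_⟩
  have := Real.log_nonneg hT
  nlinarith [Real.pi_pos, mul_nonneg hC0 this, mul_nonneg hl this]

namespace NFLFunction

open MeasureTheory

variable {F : Type*} [Field F] [NumberField F] {d : ℕ}

theorem norm_logDeriv_dirichletSeries_le {f : NFLFunction F d} (hRP : f.RamanujanPetersson)
    {s : ℂ} (hs : 3 / 2 ≤ s.re) :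
    ‖logDeriv f.dirichletSeries s‖ ≤ ∑' x : (HeightOneSpectrum (𝓞 F) × Fin d) × ℕ,
      Real.log (primeNorm x.1.1) * ((primeNorm x.1.1 : ℝ) ^ (-(3 / 2) : ℝ)) ^ (x.2 + 1) := by
  have h := (hasSum_neg_logDeriv_dirichletSeries hRP (s := s) (by linarith)).2
  rw [← norm_neg, ← h.tsum_eq]
  refine tsum_of_norm_bounded
    (summable_log_mul_rpow_pow (F := F) (d := d) (σ := 3 / 2) (by norm_num)).hasSum fun x => ?_
  rw [norm_mul, norm_pow, Complex.norm_real, Real.norm_of_nonneg (log_primeNorm_pos _).le]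
  have := (log_primeNorm_pos x.1.1).le
  gcongr
  refine (norm_eulerTerm_le hRP x.1 s).trans (Real.rpow_le_rpow_of_exponent_le ?_ (by linarith))
  linarith [two_le_primeNorm_real x.1.1]

theorem exists_norm_logDeriv_xi_le {f : NFLFunction F d} (hRP : f.RamanujanPetersson)
    (hκ : ∀ j, 0 < (f.κ j).re) :
    ∃ C, 0 ≤ C ∧ ∀ T : ℝ, 1 ≤ T → ‖logDeriv f.xi (1 / 2 + T)‖ ≤ C * (1 + Real.log T) := by
  choose B hB0 hB using fun j => exists_norm_digamma_half_le (hκ j)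
  set S := ∑' x : (HeightOneSpectrum (𝓞 F) × Fin d) × ℕ,
      Real.log (primeNorm x.1.1) * ((primeNorm x.1.1 : ℝ) ^ (-(3 / 2) : ℝ)) ^ (x.2 + 1)
  have hS : 0 ≤ S := tsum_nonneg fun x => by
    have := (log_primeNorm_pos x.1.1).le
    positivity
  set c : ℂ := (Real.log f.A : ℂ) / 2 - (d * Module.finrank ℚ F : ℕ) * (Real.log Real.pi : ℂ) / 2
  refine ⟨‖c‖ + ∑ j, B j + S, by have := Finset.sum_nonneg fun j (_ : j ∈ Finset.univ) => hB0 j; positivity,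
    fun T hT => ?_⟩
  have hre : ((1 / 2 + T : ℂ)).re = 1 / 2 + T := by simp
  have hl := Real.log_nonneg hT
  have e : logDeriv f.xi (1 / 2 + T) = c +
      1 / 2 * ∑ j, Complex.digamma ((1 / 2 + T + f.κ j) / 2) +
      logDeriv f.dirichletSeries (1 / 2 + T) := by
    rw [logDeriv_xi hRP hκ (by rw [hre]; linarith)]
    simp only [c]
    ring
  rw [e]
  have h1 : ‖(1 / 2 : ℂ) * ∑ j, Complex.digamma ((1 / 2 + T + f.κ j) / 2)‖ ≤
      (∑ j, B j) * (1 + Real.log T) := by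
    rw [norm_mul, Finset.sum_mul]
    have h2 : ‖(1 / 2 : ℂ)‖ = 1 / 2 := by norm_num
    rw [h2]
    have h3 : ‖∑ j, Complex.digamma ((1 / 2 + T + f.κ j) / 2)‖ ≤
      ∑ j, B j * (1 + Real.log T) := norm_sum_le_of_le _ fun j _ => hB j T hT
    linarith [norm_nonneg (∑ j, Complex.digamma ((1 / 2 + T + f.κ j) / 2))]
  have h2 := norm_logDeriv_dirichletSeries_le hRP (s := 1 / 2 + T) (by rw [hre]; linarith)
  refine (norm_add_le _ _).trans ((add_le_add (norm_add_le _ _) h2).trans ?_)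
  nlinarith [norm_nonneg c, mul_nonneg (norm_nonneg c) hl, mul_nonneg hS hl]

/-- On the critical line the pair for `ρ` at the real point `1/2 + T` is the positive number `2T/(T²
+ γ²)`. -/
theorem hasSum_zeros_of_riemannHypothesis {f : NFLFunction F d} (hf : f.IsSelfDual)
    (hp : f.NoPoles) (hRP : f.RamanujanPetersson) (hκ : ∀ j, 0 < (f.κ j).re)
    (hRH : f.RiemannHypothesis) {T : ℝ} (hT : 1 ≤ T) :
    HasSum (fun ρ : f.stripZeros => (f.zeroMult ρ : ℝ) * (T / (T ^ 2 + (ρ : ℂ).im ^ 2)))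
      (logDeriv f.xi (1 / 2 + T)).re := by
  have h := (xi_partial_fractions hf hp hRP hκ).2 (1 / 2 + T) (by simp; linarith)
  have h2 := (Complex.reCLM.hasSum h).mul_left (1 / 2)
  convert! h2 using 1
  · ext ρ
    have hρ : (ρ : ℂ) = 1 / 2 + ((ρ : ℂ).im : ℂ) * Complex.I := by
      apply Complex.ext <;> simp [hRH ρ ρ.2]
    set γ := (ρ : ℂ).im
    have e1 : (1 / 2 + T - (1 / 2 + γ * Complex.I) : ℂ) = T - γ * Complex.I := by ring
    have e2 : (1 / 2 + T - (1 - (1 / 2 + γ * Complex.I)) : ℂ) = T + γ * Complex.I := by ring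
    have n1 : (T - γ * Complex.I : ℂ) ≠ 0 := fun h => by
      have := congrArg Complex.re h
      simp at this
      linarith
    have n2 : (T + γ * Complex.I : ℂ) ≠ 0 := fun h => by
      have := congrArg Complex.re h
      simp at this
      linarith
    have n3 : (T ^ 2 + γ ^ 2 : ℂ) ≠ 0 := by
      have : (T ^ 2 + γ ^ 2 : ℝ) ≠ 0 := by positivity
      exact_mod_cast this
    have e3 : (1 / (1 / 2 + T - (ρ : ℂ)) + 1 / (1 / 2 + T - (1 - (ρ : ℂ))) : ℂ) =
        ((2 * (T / (T ^ 2 + γ ^ 2)) : ℝ) : ℂ) := by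
      rw [hρ, e1, e2]
      push_cast
      field_simp
      ring_nf
      rw [Complex.I_sq]
      ring
    rw [e3, Complex.reCLM_apply, ← Complex.ofReal_natCast, ← Complex.ofReal_mul,
      Complex.ofReal_re]
    ring
  · simp

/-- There are `O(1 + log X)` dyadic weights, and each sums over the zeros to `O(1 + log X)` by the
growth of `ξ'/ξ` along the real axis. -/
theorem exists_tsum_zeroMult_min_le {f : NFLFunction F d} (hf : f.IsSelfDual)
    (hp : f.NoPoles) (hRP : f.RamanujanPetersson) (hκ : ∀ j, 0 < (f.κ j).re)
    (hRH : f.RiemannHypothesis) :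
    ∃ C, 0 ≤ C ∧ ∀ X : ℝ, 1 ≤ X →
      Summable (fun ρ : f.stripZeros => (f.zeroMult ρ : ℝ) *
        min (1 / (1 + |(ρ : ℂ).im|)) (X / (1 + (ρ : ℂ).im ^ 2))) ∧
      ∑' ρ : f.stripZeros, (f.zeroMult ρ : ℝ) *
        min (1 / (1 + |(ρ : ℂ).im|)) (X / (1 + (ρ : ℂ).im ^ 2)) ≤ C * (1 + Real.log X) ^ 2 := by
  obtain ⟨B, hB0, hB⟩ := exists_norm_logDeriv_xi_le hRP hκ
  refine ⟨32 * B, by positivity, fun X hX => ?_⟩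
  have hL := Real.log_nonneg hX
  obtain ⟨K, hXK, hK⟩ : ∃ K : ℕ, X ≤ 2 ^ K ∧ (K : ℝ) + 1 ≤ 2 * (1 + Real.log X) := by
    refine ⟨⌈Real.log X / Real.log 2⌉₊, ?_, ?_⟩
    · have h1 := Nat.le_ceil (Real.log X / Real.log 2)
      rw [div_le_iff₀ (Real.log_pos one_lt_two)] at h1
      rw [← Real.log_le_log_iff (by linarith) (by positivity), Real.log_pow]
      exact h1
    · have h1 := (Nat.ceil_lt_add_one (div_nonneg hL (Real.log_pos one_lt_two).le)).le
      have h2 : Real.log X / Real.log 2 ≤ 2 * Real.log X := by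
        rw [div_le_iff₀ (Real.log_pos one_lt_two)]
        nlinarith [Real.log_two_gt_d9]
      linarith
  have hsum : HasSum (fun ρ : f.stripZeros => 8 * ∑ k ∈ Finset.range (K + 1), (f.zeroMult ρ : ℝ) *
      ((2 : ℝ) ^ k / ((2 ^ k) ^ 2 + (ρ : ℂ).im ^ 2)))
      (8 * ∑ k ∈ Finset.range (K + 1), (logDeriv f.xi (1 / 2 + ((2 ^ k : ℝ) : ℂ))).re) :=
    (hasSum_sum fun k _ => hasSum_zeros_of_riemannHypothesis hf hp hRP hκ hRH
      (one_le_pow₀ one_le_two)).mul_left 8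
  have hle : ∀ ρ : f.stripZeros, (f.zeroMult ρ : ℝ) *
        min (1 / (1 + |(ρ : ℂ).im|)) (X / (1 + (ρ : ℂ).im ^ 2)) ≤
      8 * ∑ k ∈ Finset.range (K + 1), (f.zeroMult ρ : ℝ) *
      ((2 : ℝ) ^ k / ((2 ^ k) ^ 2 + (ρ : ℂ).im ^ 2)) := fun ρ => by
    have h1 := min_le_dyadic_sum (abs_nonneg (ρ : ℂ).im) hXK
    rw [sq_abs] at h1
    rw [← Finset.mul_sum]
    calc _ ≤ (f.zeroMult ρ : ℝ) * (8 * ∑ k ∈ Finset.range (K + 1),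
          (2 : ℝ) ^ k / ((2 ^ k) ^ 2 + (ρ : ℂ).im ^ 2)) := by gcongr
      _ = _ := by ring
  have hnn : ∀ ρ : f.stripZeros, 0 ≤ (f.zeroMult ρ : ℝ) *
        min (1 / (1 + |(ρ : ℂ).im|)) (X / (1 + (ρ : ℂ).im ^ 2)) := fun ρ => by
    have : 0 ≤ min (1 / (1 + |(ρ : ℂ).im|)) (X / (1 + (ρ : ℂ).im ^ 2)) :=
      le_min (by positivity) (by positivity)
    positivity
  have hs := Summable.of_nonneg_of_le hnn hle hsum.summable
  refine ⟨hs, (hs.tsum_le_tsum hle hsum.summable).trans ?_⟩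
  rw [hsum.tsum_eq]
  have h3 : ∀ k ∈ Finset.range (K + 1),
      (logDeriv f.xi (1 / 2 + ((2 ^ k : ℝ) : ℂ))).re ≤ B * ((K : ℝ) + 1) := fun k hk => by
    refine (Complex.re_le_norm _).trans ((hB _ (one_le_pow₀ one_le_two)).trans ?_)
    refine mul_le_mul_of_nonneg_left ?_ hB0
    rw [Real.log_pow]
    have h4 : (k : ℝ) ≤ K := by exact_mod_cast Nat.lt_succ_iff.1 (Finset.mem_range.1 hk)
    have h5 := Real.log_two_lt_d9
    have h6 := Real.log_two_gt_d9
    nlinarith [(Nat.cast_nonneg k : (0 : ℝ) ≤ k)]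
  have h4 := Finset.sum_le_card_nsmul _ _ _ h3
  rw [Finset.card_range, nsmul_eq_mul] at h4
  push_cast at h4
  push_cast
  have h5 : ((K : ℝ) + 1) ^ 2 ≤ (2 * (1 + Real.log X)) ^ 2 := by gcongr
  calc _ ≤ 8 * (((K : ℝ) + 1) * (B * (K + 1))) := by gcongr
    _ = 8 * B * ((K : ℝ) + 1) ^ 2 := by ring
    _ ≤ 8 * B * (2 * (1 + Real.log X)) ^ 2 := by gcongr
    _ = _ := by ring

end NFLFunction

/-! ### Truncation of a Schwartz function and the sum over zeros. -/

section Truncation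

open MeasureTheory

/-- The part of `G` that is cut off at `log X`. -/
def cutPart (G : ℝ → ℂ) (X : ℕ) (u : ℝ) : ℂ := (logStep X u + logStep X (-u)) • G u

/-- The smooth truncation of `G` at `log X`. -/
def truncation (G : ℝ → ℂ) (X : ℕ) (u : ℝ) : ℂ := G u - cutPart G X u

theorem truncation_neg {G : ℝ → ℂ} (he : ∀ u, G (-u) = G u) (X : ℕ) (u : ℝ) :
    truncation G X (-u) = truncation G X u := by
  rw [truncation, truncation, cutPart, cutPart, he, neg_neg, add_comm (logStep X (-u))]

theorem log_nat_pos {X : ℕ} (hX : 2 ≤ X) : 0 < Real.log X :=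
  Real.log_pos (by exact_mod_cast hX)

theorem truncation_of_abs_le (G : ℝ → ℂ) {X : ℕ} (hX : 2 ≤ X) {u : ℝ} (hu : |u| ≤ Real.log X) :
    truncation G X u = G u := by
  rw [abs_le] at hu
  rw [truncation, cutPart, logStep_of_le hX hu.2, logStep_of_le hX (by linarith)]
  simp

theorem truncation_of_le_abs (G : ℝ → ℂ) {X : ℕ} (hX : 2 ≤ X) {u : ℝ}
    (hu : Real.log (X + 1) ≤ |u|) : truncation G X u = 0 := by
  have h0 : 0 ≤ Real.log X := (log_nat_pos hX).le
  have h1 := log_gap_pos hX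
  rcases le_abs.1 hu with h | h
  · rw [truncation, cutPart, logStep_of_ge hX h, logStep_of_le hX (by linarith)]
    simp
  · rw [truncation, cutPart, logStep_of_ge hX h, logStep_of_le hX (by linarith)]
    simp

theorem logStep_add_mem {X : ℕ} (hX : 2 ≤ X) (u : ℝ) :
    0 ≤ logStep X u + logStep X (-u) ∧ logStep X u + logStep X (-u) ≤ 1 := by
  have h0 : 0 ≤ Real.log X := (log_nat_pos hX).le
  refine ⟨add_nonneg (logStep_nonneg X u) (logStep_nonneg X _), ?_⟩
  rcases le_total u 0 with h | h
  · rw [logStep_of_le hX (h.trans h0), zero_add]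
    exact logStep_le_one X _
  · rw [logStep_of_le (u := -u) hX (by linarith), add_zero]
    exact logStep_le_one X _

theorem norm_cutPart_le (G : ℝ → ℂ) {X : ℕ} (hX : 2 ≤ X) (u : ℝ) : ‖cutPart G X u‖ ≤ ‖G u‖ := by
  rw [cutPart, norm_smul, Real.norm_of_nonneg (logStep_add_mem hX u).1]
  exact mul_le_of_le_one_left (norm_nonneg _) (logStep_add_mem hX u).2

theorem norm_truncation_le (G : ℝ → ℂ) {X : ℕ} (hX : 2 ≤ X) (u : ℝ) :
    ‖truncation G X u‖ ≤ ‖G u‖ := by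
  have h : truncation G X u = (1 - (logStep X u + logStep X (-u))) • G u := by
    rw [truncation, cutPart, sub_smul, one_smul]
  obtain ⟨h1, h2⟩ := logStep_add_mem hX u
  rw [h, norm_smul, Real.norm_of_nonneg (by linarith)]
  exact mul_le_of_le_one_left (norm_nonneg _) (by linarith)

theorem contDiff_truncation {G : ℝ → ℂ} (hG : ContDiff ℝ (⊤ : ℕ∞) G) (X : ℕ) :
    ContDiff ℝ (⊤ : ℕ∞) (truncation G X) :=
  hG.sub (((contDiff_logStep X).add ((contDiff_logStep X).comp contDiff_neg)).smul hG)

theorem hasCompactSupport_truncation (G : ℝ → ℂ) {X : ℕ} (hX : 2 ≤ X) :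
    HasCompactSupport (truncation G X) := by
  refine HasCompactSupport.intro (isCompact_Icc (a := -Real.log (X + 1)) (b := Real.log (X + 1)))
    fun u hu => truncation_of_le_abs G hX ?_
  by_contra! h
  exact hu ⟨(abs_lt.1 h).1.le, (abs_lt.1 h).2.le⟩

theorem truncation_zero (G : ℝ → ℂ) {X : ℕ} (hX : 2 ≤ X) : truncation G X 0 = G 0 :=
  truncation_of_abs_le G hX (by rw [abs_zero]; exact (log_nat_pos hX).le)

theorem zeroTransform_of_re_eq {ρ : ℂ} (hρ : ρ.re = 1 / 2) (g : ℝ → ℂ) :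
    zeroTransform g ρ = ∫ u : ℝ, g u * Complex.exp (ρ.im * u * Complex.I) := by
  have : ρ - 1 / 2 = ρ.im * Complex.I := by
    apply Complex.ext <;> simp [hρ]
  rw [zeroTransform, this]
  congr 1
  ext u
  congr 2
  ring

theorem integrable_mul_exp_I {g : ℝ → ℂ} (hg : Integrable g) (γ : ℝ) :
    Integrable fun u : ℝ => g u * Complex.exp (γ * u * Complex.I) := by
  refine hg.mul_bdd (c := 1)
    (by fun_prop : Continuous fun u : ℝ => Complex.exp (γ * u * Complex.I)).aestronglyMeasurable
    (Eventually.of_forall fun u => ?_)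
  have := Complex.norm_exp_ofReal_mul_I (γ * u)
  rw [Complex.ofReal_mul] at this
  exact this.le

/-- The removed part is a step on the right plus its mirror image. For even `G` the mirror image
contributes the same integral at `-γ`. -/
theorem exists_norm_zeroTransform_cutPart_le (G : 𝓢(ℝ, ℂ)) (he : ∀ u, G (-u) = G u) :
    ∃ C, 0 ≤ C ∧ ∀ X : ℕ, 2 ≤ X → ∀ ρ : ℂ, ρ.re = 1 / 2 →
      zeroTransform (truncation G X) ρ = zeroTransform G ρ - zeroTransform (cutPart G X) ρ ∧
      ‖zeroTransform (cutPart G X) ρ‖ ≤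
        C / (1 + Real.log X) ^ 3 * min (1 / (1 + |ρ.im|)) (X / (1 + ρ.im ^ 2)) := by
  obtain ⟨C, hC0, hC⟩ := exists_norm_integral_logStep_le G
  refine ⟨2 * C, by positivity, fun X hX ρ hρ => ?_⟩
  have hc : Continuous (cutPart G X) :=
    ((contDiff_logStep X).continuous.add
      ((contDiff_logStep X).continuous.comp continuous_neg)).smul G.continuous
  have hi : Integrable (cutPart G X) :=
    G.integrable.norm.mono' hc.aestronglyMeasurable
      (Eventually.of_forall fun u => norm_cutPart_le G hX u)
  have hi2 : Integrable fun u => logStep X u • G u := by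
    refine G.integrable.norm.mono'
      ((contDiff_logStep X).continuous.smul G.continuous).aestronglyMeasurable
      (Eventually.of_forall fun u => ?_)
    rw [norm_smul, Real.norm_of_nonneg (logStep_nonneg X u)]
    exact mul_le_of_le_one_left (norm_nonneg _) (logStep_le_one X u)
  refine ⟨?_, ?_⟩
  · simp_rw [zeroTransform_of_re_eq hρ]
    rw [← integral_sub (integrable_mul_exp_I G.integrable _) (integrable_mul_exp_I hi _)]
    refine integral_congr_ae (Eventually.of_forall fun u => ?_)
    simp only [truncation]
    ring
  · rw [zeroTransform_of_re_eq hρ]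
    set γ := ρ.im
    have hs : ∫ u, cutPart G X u * Complex.exp (γ * u * Complex.I) =
        (∫ u, (logStep X u • G u) * Complex.exp (γ * u * Complex.I)) +
        ∫ u, (logStep X u • G u) * Complex.exp ((-γ : ℝ) * u * Complex.I) := by
      have h1 := integral_neg_eq_self
        (fun u : ℝ => (logStep X u • G u) * Complex.exp ((-γ : ℝ) * u * Complex.I)) volume
      rw [← h1, ← integral_add (integrable_mul_exp_I hi2 γ)
        (integrable_mul_exp_I hi2 (-γ)).comp_neg]
      refine integral_congr_ae (Eventually.of_forall fun u => ?_)
      simp only [cutPart, he, add_smul, add_mul]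
      push_cast
      rw [neg_mul_neg]
    rw [hs]
    have h2 := hC X hX γ
    have h3 := hC X hX (-γ)
    rw [abs_neg, neg_sq] at h3
    refine (norm_add_le _ _).trans ((add_le_add h2 h3).trans_eq ?_)
    ring

theorem exists_norm_zeroTransform_le (G : 𝓢(ℝ, ℂ)) :
    ∃ C, 0 ≤ C ∧ ∀ ρ : ℂ, ρ.re = 1 / 2 → ‖zeroTransform G ρ‖ ≤ C * (1 / (1 + ‖ρ‖ ^ 2)) := by
  set G1 : 𝓢(ℝ, ℂ) := SchwartzMap.derivCLM ℝ ℂ G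
  set G2 : 𝓢(ℝ, ℂ) := SchwartzMap.derivCLM ℝ ℂ G1
  have hN : 0 ≤ (∫ u, ‖G u‖) + ∫ u, ‖G2 u‖ :=
    add_nonneg (integral_nonneg fun _ => norm_nonneg _) (integral_nonneg fun _ => norm_nonneg _)
  refine ⟨2 * ((∫ u, ‖G u‖) + ∫ u, ‖G2 u‖), by positivity, fun ρ hρ => ?_⟩
  have h := one_add_sq_mul_norm_integral_mul_exp_le G.hasDerivAt_derivCLM G1.hasDerivAt_derivCLM
    G.integrable G1.integrable G2.integrable ρ.im
  rw [← zeroTransform_of_re_eq hρ] at h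
  have h2 : ‖ρ‖ ^ 2 = 1 / 4 + ρ.im ^ 2 := by
    rw [← Complex.normSq_eq_norm_sq, Complex.normSq_apply, hρ]; ring
  rw [mul_one_div, le_div_iff₀ (by positivity), h2]
  nlinarith [norm_nonneg (zeroTransform G ρ), sq_nonneg ρ.im,
    mul_nonneg (norm_nonneg (zeroTransform G ρ)) (sq_nonneg ρ.im)]

end Truncation

namespace NFLFunction

variable {F : Type*} [Field F] [NumberField F] {d : ℕ}

/-- The removed part contributes at most `(1 + log X)^{-3}` times `O((1 + log X)²)`, which tends to
zero. -/
theorem tendsto_tsum_zeros_of_riemannHypothesis {f : NFLFunction F d} (hf : f.IsSelfDual)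
    (hp : f.NoPoles) (hRP : f.RamanujanPetersson) (hκ : ∀ j, 0 < (f.κ j).re)
    (hRH : f.RiemannHypothesis) (G : 𝓢(ℝ, ℂ)) (he : ∀ u, G (-u) = G u) :
    Summable (fun ρ : f.stripZeros => (f.zeroMult ρ : ℂ) * zeroTransform G ρ) ∧
    Tendsto (fun X : ℕ => ∑' ρ : f.stripZeros, (f.zeroMult ρ : ℂ) * zeroTransform (truncation G X) ρ)
      atTop (𝓝 (∑' ρ : f.stripZeros, (f.zeroMult ρ : ℂ) * zeroTransform G ρ)) := by
  obtain ⟨C1, hC10, hC1⟩ := exists_norm_zeroTransform_le G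
  obtain ⟨C2, hC20, hC2⟩ := exists_norm_zeroTransform_cutPart_le G he
  obtain ⟨C3, hC30, hC3⟩ := exists_tsum_zeroMult_min_le hf hp hRP hκ hRH
  have hs1 := (xi_partial_fractions hf hp hRP hκ).1
  have hsG : Summable (fun ρ : f.stripZeros => (f.zeroMult ρ : ℂ) * zeroTransform G ρ) := by
    refine Summable.of_norm_bounded (hs1.mul_left C1) fun ρ => ?_
    rw [norm_mul, Complex.norm_natCast]
    calc _ ≤ (f.zeroMult ρ : ℝ) * (C1 * (1 / (1 + ‖(ρ : ℂ)‖ ^ 2))) := by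
          gcongr
          exact hC1 ρ (hRH ρ ρ.2)
      _ = _ := by ring
  refine ⟨hsG, ?_⟩
  rw [tendsto_iff_norm_sub_tendsto_zero]
  have hlim : Tendsto (fun X : ℕ => C2 * C3 * (1 + Real.log X)⁻¹) atTop (𝓝 0) := by
    have h1 : Tendsto (fun X : ℕ => 1 + Real.log X) atTop atTop :=
      tendsto_atTop_add_const_left _ _ (Real.tendsto_log_atTop.comp tendsto_natCast_atTop_atTop)
    simpa using h1.inv_tendsto_atTop.const_mul (C2 * C3)
  refine squeeze_zero' (Eventually.of_forall fun _ => norm_nonneg _) ?_ hlim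
  filter_upwards [eventually_ge_atTop 2] with X hX
  have hX1 : (1 : ℝ) ≤ X := by exact_mod_cast (by omega : 1 ≤ X)
  have hL := Real.log_nonneg hX1
  obtain ⟨hs3, ht3⟩ := hC3 X hX1
  have hb : ∀ ρ : f.stripZeros, ‖(f.zeroMult ρ : ℂ) * zeroTransform (cutPart G X) ρ‖ ≤
      C2 / (1 + Real.log X) ^ 3 * ((f.zeroMult ρ : ℝ) *
        min (1 / (1 + |(ρ : ℂ).im|)) (X / (1 + (ρ : ℂ).im ^ 2))) := fun ρ => by
    rw [norm_mul, Complex.norm_natCast]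
    calc _ ≤ (f.zeroMult ρ : ℝ) * (C2 / (1 + Real.log X) ^ 3 *
          min (1 / (1 + |(ρ : ℂ).im|)) (X / (1 + (ρ : ℂ).im ^ 2))) := by
          gcongr
          exact (hC2 X hX ρ (hRH ρ ρ.2)).2
      _ = _ := by ring
  have hs4 := Summable.of_norm_bounded (hs3.mul_left _) hb
  have e : ∑' ρ : f.stripZeros, (f.zeroMult ρ : ℂ) * zeroTransform (truncation G X) ρ -
      ∑' ρ : f.stripZeros, (f.zeroMult ρ : ℂ) * zeroTransform G ρ =
      -∑' ρ : f.stripZeros, (f.zeroMult ρ : ℂ) * zeroTransform (cutPart G X) ρ := by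
    have : ∀ ρ : f.stripZeros, (f.zeroMult ρ : ℂ) * zeroTransform (truncation G X) ρ =
        (f.zeroMult ρ : ℂ) * zeroTransform G ρ - (f.zeroMult ρ : ℂ) * zeroTransform (cutPart G X) ρ :=
      fun ρ => by rw [(hC2 X hX ρ (hRH ρ ρ.2)).1]; ring
    simp_rw [this]
    rw [hsG.tsum_sub hs4]
    ring
  rw [e, norm_neg]
  refine (tsum_of_norm_bounded (hs3.mul_left _).hasSum hb).trans ?_
  rw [tsum_mul_left]
  calc _ ≤ C2 / (1 + Real.log X) ^ 3 * (C3 * (1 + Real.log X) ^ 2) := by gcongr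
    _ = _ := by field_simp

/-- Once `log X` exceeds the support of `G`, the truncation is `G` itself, so the zeros may lie off
the critical line. -/
theorem tendsto_tsum_zeros_of_hasCompactSupport {f : NFLFunction F d} (hf : f.IsSelfDual)
    (hp : f.NoPoles) (hRP : f.RamanujanPetersson) (hκ : ∀ j, 0 < (f.κ j).re)
    (G : 𝓢(ℝ, ℂ)) (he : ∀ u, G (-u) = G u) (hc : HasCompactSupport G) :
    Summable (fun ρ : f.stripZeros => (f.zeroMult ρ : ℂ) * zeroTransform G ρ) ∧
    Tendsto (fun X : ℕ => ∑' ρ : f.stripZeros, (f.zeroMult ρ : ℂ) * zeroTransform (truncation G X) ρ)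
      atTop (𝓝 (∑' ρ : f.stripZeros, (f.zeroMult ρ : ℂ) * zeroTransform G ρ)) := by
  refine ⟨(explicit_formula hf hp hRP hκ (G.smooth _) hc he).2.2.summable, ?_⟩
  obtain ⟨B, hB⟩ := hc.isCompact.isBounded.exists_norm_le
  refine tendsto_const_nhds.congr' ?_
  have hlog : Tendsto (fun X : ℕ => Real.log X) atTop atTop :=
    Real.tendsto_log_atTop.comp tendsto_natCast_atTop_atTop
  filter_upwards [eventually_ge_atTop 2, hlog.eventually_ge_atTop B] with X hX hXB
  have : truncation G X = G := by
    ext u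
    rcases le_or_gt |u| (Real.log X) with h | h
    · exact truncation_of_abs_le G hX h
    · have h0 : G u = 0 := image_eq_zero_of_notMem_tsupport fun hu => by
        have := hB u hu
        rw [Real.norm_eq_abs] at this
        linarith
      rw [truncation, cutPart, h0]
      simp
  rw [this]

end NFLFunction

/-! ### Gamma terms and primes under truncation; the explicit formula for Schwartz functions. -/

theorem Summable.tsum_prod_nat_eq {ι : Type*} {a : ι × ℕ → ℂ} (h : Summable a) :
    ∑' x, a x = ∑' i, a (i, 0) + ∑' x : ι × ℕ, a (x.1, x.2 + 1) := by
  have h0 : Summable fun i => a (i, 0) :=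
    h.comp_injective (i := fun i : ι => (i, 0)) fun i j hij => by simpa using hij
  have h1 : Summable fun x : ι × ℕ => a (x.1, x.2 + 1) :=
    h.comp_injective (i := fun x : ι × ℕ => (x.1, x.2 + 1)) fun x y hxy => by
      simp only [Prod.mk.injEq, add_left_inj] at hxy
      exact Prod.ext hxy.1 hxy.2
  rw [h.tsum_prod, h1.tsum_prod, ← h0.tsum_add h1.prod]
  exact tsum_congr fun i => (h.prod_factor i).tsum_eq_zero_add

section Gamma

open MeasureTheory

theorem integrableOn_exp_mul {b : ℂ} (hb : 0 ≤ b.re) {g : ℝ → ℂ} (hg : Integrable g) :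
    IntegrableOn (fun u : ℝ => Complex.exp (-b * u) * g u) (Set.Ioi 0) := by
  refine (hg.integrableOn).bdd_mul (c := 1)
    (by fun_prop : Continuous fun u : ℝ => Complex.exp (-b * u)).aestronglyMeasurable ?_
  filter_upwards [ae_restrict_mem measurableSet_Ioi] with u hu
  rw [Set.mem_Ioi] at hu
  rw [Complex.norm_exp, Real.exp_le_one_iff]
  simp
  positivity

theorem re_two_mul_add_half_add (n : ℕ) (κ : ℂ) :
    (2 * (n : ℂ) + 1 / 2 + κ).re = 2 * n + 1 / 2 + κ.re := by
  simp

/-- The two functions agree on `[0, a]`, so only `u > a` contributes, where the exponential is at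
most `e^{-(2n+1/2)a}`. -/
theorem norm_gammaSummand_sub_le {κ : ℂ} (hκ : 0 < κ.re) {G g : ℝ → ℂ} (hG : Integrable G)
    (hg : Integrable g) {a : ℝ} (h : ∀ u, 0 ≤ u → u ≤ a → g u = G u) (ha : 0 ≤ a)
    (hle : ∀ u, ‖G u - g u‖ ≤ ‖G u‖) (n : ℕ) :
    ‖gammaSummand κ G n - gammaSummand κ g n‖ ≤
      2 * (Real.exp (-(2 * n + 1 / 2) * a) * ∫ u, ‖G u‖) := by
  have hre := re_two_mul_add_half_add n κ
  have hb : 0 ≤ (2 * (n : ℂ) + 1 / 2 + κ).re := by rw [hre]; positivity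
  have e : gammaSummand κ G n - gammaSummand κ g n =
      -2 * ∫ u in Set.Ioi (0 : ℝ), Complex.exp (-(2 * n + 1 / 2 + κ) * u) * (G u - g u) := by
    simp_rw [mul_sub]
    rw [integral_sub (integrableOn_exp_mul hb hG) (integrableOn_exp_mul hb hg), gammaSummand,
      gammaSummand, h 0 le_rfl ha]
    ring
  rw [e, norm_mul, norm_neg, Complex.norm_ofNat, ← integral_const_mul]
  refine mul_le_mul_of_nonneg_left ?_ zero_le_two
  refine (norm_integral_le_of_norm_le (hG.norm.const_mul _).integrableOn ?_).trans
    (setIntegral_le_integral (hG.norm.const_mul _) (Eventually.of_forall fun u => by positivity))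
  filter_upwards [ae_restrict_mem measurableSet_Ioi] with u hu
  rw [Set.mem_Ioi] at hu
  rcases le_or_gt u a with hua | hua
  · rw [h u hu.le hua, sub_self, mul_zero, norm_zero]
    positivity
  · rw [norm_mul, Complex.norm_exp]
    have h2 : (-(2 * (n : ℂ) + 1 / 2 + κ) * u).re = -(2 * n + 1 / 2 + κ.re) * u := by
      rw [Complex.re_mul_ofReal, Complex.neg_re, hre]
    rw [h2]
    have h3 : (2 * n + 1 / 2 : ℝ) * a ≤ (2 * n + 1 / 2) * u := by gcongr
    have h4 : 0 ≤ κ.re * u := by positivity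
    refine mul_le_mul (Real.exp_le_exp.2 (by linarith)) (hle u) (norm_nonneg _) (by positivity)

theorem tendsto_gammaTerm_truncation {κ : ℂ} (hκ : 0 < κ.re) (G : 𝓢(ℝ, ℂ))
    (hs : ∀ X : ℕ, 2 ≤ X → Summable (gammaSummand κ (truncation G X))) :
    Summable (gammaSummand κ G) ∧
    Tendsto (fun X : ℕ => gammaTerm κ (truncation G X)) atTop (𝓝 (gammaTerm κ G)) := by
  set I := ∫ u, ‖G u‖
  have hI : 0 ≤ I := integral_nonneg fun _ => norm_nonneg _
  have hb : ∀ X : ℕ, 2 ≤ X → ∀ n, ‖gammaSummand κ G n - gammaSummand κ (truncation G X) n‖ ≤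
      2 * I * Real.exp (-(1 / 2) * Real.log X) * (1 / 4) ^ n := by
    intro X hX n
    have hL := log_nat_pos hX
    have hint : Integrable (truncation G X) :=
      (contDiff_truncation (G.smooth _) X).continuous.integrable_of_hasCompactSupport
        (hasCompactSupport_truncation G hX)
    refine (norm_gammaSummand_sub_le hκ G.integrable hint (a := Real.log X)
      (fun u h0 hu => truncation_of_abs_le G hX (by rwa [abs_of_nonneg h0])) hL.le
      (fun u => ?_) n).trans ?_
    · rw [truncation, sub_sub_cancel]
      exact norm_cutPart_le G hX u
    · have h1 : Real.exp (-(2 * n + 1 / 2) * Real.log X) ≤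
          Real.exp (-(1 / 2) * Real.log X) * (1 / 4) ^ n := by
        -- The factor `X^{-2n}` is at most `4^{-n}` as `X ≥ 2`; the remaining `X^{-1/2}` gives the
        -- convergence in `X`.
        have h2 : ((1 : ℝ) / 4) ^ n = Real.exp (-(2 * n) * Real.log 2) := by
          have : (1 : ℝ) / 4 = Real.exp (-(2 * Real.log 2)) := by
            rw [Real.exp_neg, mul_comm, Real.exp_mul, Real.exp_log two_pos]
            norm_num
          rw [this, ← Real.exp_nat_mul]
          congr 1
          ring
        rw [h2, ← Real.exp_add, Real.exp_le_exp]
        have h3 : Real.log 2 ≤ Real.log X :=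
          Real.log_le_log two_pos (by exact_mod_cast hX)
        have h4 : (2 * n : ℝ) * Real.log 2 ≤ 2 * n * Real.log X := by gcongr
        linarith
      calc _ ≤ 2 * (Real.exp (-(1 / 2) * Real.log X) * (1 / 4) ^ n * I) := by gcongr
        _ = _ := by ring
  have hgeo : Summable fun n : ℕ => ((1 : ℝ) / 4) ^ n :=
    summable_geometric_of_lt_one (by norm_num) (by norm_num)
  have hd : ∀ X : ℕ, 2 ≤ X →
      Summable fun n => gammaSummand κ G n - gammaSummand κ (truncation G X) n := fun X hX =>
    Summable.of_norm_bounded (hgeo.mul_left _) (hb X hX)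
  have hsG : Summable (gammaSummand κ G) := by
    simpa using (hd 2 le_rfl).add (hs 2 le_rfl)
  refine ⟨hsG, ?_⟩
  rw [tendsto_iff_norm_sub_tendsto_zero]
  have hlim : Tendsto (fun X : ℕ => 2 * I * Real.exp (-(1 / 2) * Real.log X) *
      ∑' n : ℕ, ((1 : ℝ) / 4) ^ n) atTop (𝓝 0) := by
    have h1 : Tendsto (fun X : ℕ => Real.log X) atTop atTop :=
      Real.tendsto_log_atTop.comp tendsto_natCast_atTop_atTop
    have h2 : Tendsto (fun X : ℕ => Real.exp (-(1 / 2) * Real.log X)) atTop (𝓝 0) :=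
      Real.tendsto_exp_atBot.comp (h1.const_mul_atTop_of_neg (by norm_num))
    simpa using (h2.const_mul (2 * I)).mul_const (∑' n : ℕ, ((1 : ℝ) / 4) ^ n)
  refine squeeze_zero' (Eventually.of_forall fun _ => norm_nonneg _) ?_ hlim
  filter_upwards [eventually_ge_atTop 2] with X hX
  have e : gammaTerm κ (truncation G X) - gammaTerm κ G =
      -∑' n, (gammaSummand κ G n - gammaSummand κ (truncation G X) n) := by
    rw [hsG.tsum_sub (hs X hX), gammaTerm, gammaTerm, truncation_zero G hX]
    ring
  rw [e, norm_neg, ← tsum_mul_left]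
  exact tsum_of_norm_bounded (hgeo.mul_left _).hasSum (hb X hX)

end Gamma

namespace NFLFunction

variable {F : Type*} [Field F] [NumberField F] {d : ℕ}

theorem norm_eulerTerm_half_le {f : NFLFunction F d} (hRP : f.RamanujanPetersson)
    (x : HeightOneSpectrum (𝓞 F) × Fin d) :
    ‖f.eulerTerm x (1 / 2)‖ ^ 2 ≤ 1 / (primeNorm x.1 : ℝ) ∧
      ‖f.eulerTerm x (1 / 2)‖ ≤ (2 : ℝ) ^ (-(1 / 2) : ℝ) := by
  have h := norm_eulerTerm_le hRP x (1 / 2)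
  have h2 : ((1 / 2 : ℂ)).re = 1 / 2 := by simp
  rw [h2] at h
  have hN := two_le_primeNorm_real x.1
  refine ⟨?_, h.trans ?_⟩
  · calc _ ≤ ((primeNorm x.1 : ℝ) ^ (-(1 / 2) : ℝ)) ^ 2 := by gcongr
      _ = _ := by
        rw [← Real.rpow_natCast, ← Real.rpow_mul (by linarith)]
        norm_num
        exact Real.rpow_neg_one _
  · exact Real.rpow_le_rpow_of_nonpos two_pos hN (by norm_num)

theorem two_rpow_neg_half_mem : 0 ≤ (2 : ℝ) ^ (-(1 / 2) : ℝ) ∧ (2 : ℝ) ^ (-(1 / 2) : ℝ) < 1 :=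
  ⟨by positivity, Real.rpow_lt_one_of_one_lt_of_neg one_lt_two (by norm_num)⟩

/-- For exponents `m + 2` two of the local factors give `1/N(𝔭)` and the others a geometric series.
The bound on `g` supplies the logarithmic saving needed at the squares. -/
theorem norm_primePowerTerm_succ_le {f : NFLFunction F d} (hRP : f.RamanujanPetersson)
    {g : ℝ → ℂ} {B : ℝ} (hg : ∀ u, ‖g u‖ * (1 + |u|) ^ 2 ≤ B)
    (x : (HeightOneSpectrum (𝓞 F) × Fin d) × ℕ) :
    ‖f.primePowerTerm g (x.1, x.2 + 1)‖ ≤ B *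
      (Real.log (primeNorm x.1.1) *
        (1 / ((primeNorm x.1.1 : ℝ) * (1 + Real.log (primeNorm x.1.1)) ^ 2)) *
      ((2 : ℝ) ^ (-(1 / 2) : ℝ)) ^ x.2) := by
  have hl := (log_primeNorm_pos x.1.1).le
  have hN := primeNorm_pos_real x.1.1
  set l := Real.log (primeNorm x.1.1)
  obtain ⟨h1, h2⟩ := norm_eulerTerm_half_le hRP x.1
  have h3 : ‖f.eulerTerm x.1 (1 / 2)‖ ^ (x.2 + 1 + 1) ≤
      1 / (primeNorm x.1.1 : ℝ) * ((2 : ℝ) ^ (-(1 / 2) : ℝ)) ^ x.2 := by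
    have : x.2 + 1 + 1 = 2 + x.2 := by ring
    rw [this, pow_add]
    gcongr
  have h4 : ‖g (((x.2 + 1 + 1 : ℕ) : ℝ) * l)‖ ≤ B / (1 + l) ^ 2 := by
    rw [le_div_iff₀ (by positivity)]
    refine le_trans ?_ (hg (((x.2 + 1 + 1 : ℕ) : ℝ) * l))
    gcongr
    rw [abs_of_nonneg (by positivity)]
    refine le_mul_of_one_le_left hl ?_
    push_cast
    linarith [(Nat.cast_nonneg x.2 : (0 : ℝ) ≤ x.2)]
  rw [primePowerTerm, norm_mul, norm_mul, norm_pow, Complex.norm_real, Real.norm_of_nonneg hl]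
  have hB : 0 ≤ B := le_trans (by positivity) (hg 0)
  calc _ ≤ l * (1 / (primeNorm x.1.1 : ℝ) * ((2 : ℝ) ^ (-(1 / 2) : ℝ)) ^ x.2) *
        (B / (1 + l) ^ 2) := by gcongr
    _ = _ := by field_simp

theorem summable_succ_bound (F : Type*) [Field F] [NumberField F] (d : ℕ) :
    Summable fun x : (HeightOneSpectrum (𝓞 F) × Fin d) × ℕ =>
      Real.log (primeNorm x.1.1) *
        (1 / ((primeNorm x.1.1 : ℝ) * (1 + Real.log (primeNorm x.1.1)) ^ 2)) *
      ((2 : ℝ) ^ (-(1 / 2) : ℝ)) ^ x.2 := by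
  have h1 := summable_prod_fin (summable_log_primeNorm_div_sq (F := F))
    (fun p => mul_nonneg (log_primeNorm_pos p).le (by positivity)) d
  have h2 : Summable fun m : ℕ => ((2 : ℝ) ^ (-(1 / 2) : ℝ)) ^ m :=
    summable_geometric_of_lt_one two_rpow_neg_half_mem.1 two_rpow_neg_half_mem.2
  exact h1.mul_of_nonneg h2 (fun x => mul_nonneg (log_primeNorm_pos x.1).le (by positivity))
    fun m => by positivity

theorem summable_primePowerTerm_succ {f : NFLFunction F d} (hRP : f.RamanujanPetersson)
    (G : 𝓢(ℝ, ℂ)) : Summable fun x : (HeightOneSpectrum (𝓞 F) × Fin d) × ℕ =>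
      f.primePowerTerm G (x.1, x.2 + 1) := by
  obtain ⟨B, hB0, hB⟩ := G.exists_norm_mul_one_add_abs_pow_le 2
  exact Summable.of_norm_bounded ((summable_succ_bound F d).mul_left B)
    (norm_primePowerTerm_succ_le hRP hB)

theorem tendsto_tsum_primePowerTerm_succ {f : NFLFunction F d} (hRP : f.RamanujanPetersson)
    (G : 𝓢(ℝ, ℂ)) :
    Tendsto (fun X : ℕ => ∑' x : (HeightOneSpectrum (𝓞 F) × Fin d) × ℕ,
        f.primePowerTerm (truncation G X) (x.1, x.2 + 1)) atTop
      (𝓝 (∑' x : (HeightOneSpectrum (𝓞 F) × Fin d) × ℕ, f.primePowerTerm G (x.1, x.2 + 1))) := by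
  obtain ⟨B, hB0, hB⟩ := G.exists_norm_mul_one_add_abs_pow_le 2
  refine tendsto_tsum_of_dominated_convergence ((summable_succ_bound F d).mul_left B) (fun x => ?_) ?_
  · refine tendsto_const_nhds.congr' ?_
    set u : ℝ := ((x.2 + 1 + 1 : ℕ) : ℝ) * Real.log (primeNorm x.1.1)
    have hlog : Tendsto (fun X : ℕ => Real.log X) atTop atTop :=
      Real.tendsto_log_atTop.comp tendsto_natCast_atTop_atTop
    filter_upwards [eventually_ge_atTop 2, hlog.eventually_ge_atTop |u|] with X hX hXu
    rw [primePowerTerm, primePowerTerm, truncation_of_abs_le G hX hXu]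
  · filter_upwards [eventually_ge_atTop 2] with X hX x
    refine norm_primePowerTerm_succ_le hRP (fun u => ?_) x
    exact (mul_le_mul_of_nonneg_right (norm_truncation_le G hX u) (by positivity)).trans (hB u)

/-- Norms are integers, so each is either at most `X`, where the truncation is `G`, or at least `X +
1`, where it vanishes. The smooth cut-off thus acts on primes as a sharp one. -/
theorem tsum_primePowerTerm_truncation_zero (f : NFLFunction F d) (G : ℝ → ℂ) {X : ℕ}
    (hX : 2 ≤ X) :
    ∑' x : HeightOneSpectrum (𝓞 F) × Fin d, f.primePowerTerm (truncation G X) (x, 0) =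
      ∑ p ∈ primesLE F X, ∑ i, f.primePowerTerm G ((p, i), 0) := by
  have hX0 : (0 : ℝ) < X := by positivity
  rw [tsum_eq_sum (s := primesLE F X ×ˢ (Finset.univ : Finset (Fin d))), Finset.sum_product]
  · refine Finset.sum_congr rfl fun p hp => Finset.sum_congr rfl fun i _ => ?_
    rw [mem_primesLE] at hp
    rw [primePowerTerm, primePowerTerm, truncation_of_abs_le G hX]
    have := log_primeNorm_pos p
    simp only [zero_add, Nat.cast_one, one_mul]
    rw [abs_of_pos this]
    exact Real.log_le_log (primeNorm_pos_real p) hp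
  · intro x hx
    have hN : ¬ (primeNorm x.1 : ℝ) ≤ X := fun h =>
      hx (Finset.mem_product.2 ⟨mem_primesLE.2 h, Finset.mem_univ _⟩)
    have hN' : ((X + 1 : ℕ) : ℝ) ≤ primeNorm x.1 := by
      rw [Nat.cast_le, not_le] at hN
      exact_mod_cast hN
    rw [primePowerTerm, truncation_of_le_abs G hX, mul_zero]
    simp only [zero_add, Nat.cast_one, one_mul]
    push_cast at hN'
    exact (Real.log_le_log (by positivity) hN').trans (le_abs_self _)

/-- The explicit formula for even Schwartz functions, with the sum over primes ordered by norm. -/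
theorem explicit_formula_schwartz {f : NFLFunction F d} (hf : f.IsSelfDual) (hp : f.NoPoles)
    (hRP : f.RamanujanPetersson) (hκ : ∀ j, 0 < (f.κ j).re) (G : 𝓢(ℝ, ℂ))
    (he : ∀ u, G (-u) = G u) (hG : f.RiemannHypothesis ∨ HasCompactSupport G) :
    Summable (fun ρ : f.stripZeros => (f.zeroMult ρ : ℂ) * zeroTransform G ρ) ∧
    (∀ j, Summable (gammaSummand (f.κ j) G)) ∧
    ∃ P : ℂ, Tendsto (fun X : ℕ => ∑ p ∈ primesLE F X, ∑ i, f.primePowerTerm G ((p, i), 0)) atTop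
        (𝓝 P) ∧
      ∑' ρ : f.stripZeros, (f.zeroMult ρ : ℂ) * zeroTransform G ρ =
        G 0 * ((Real.log f.A : ℂ) - (d * Module.finrank ℚ F : ℕ) * (Real.log Real.pi : ℂ))
        + ∑ j, gammaTerm (f.κ j) G - 2 * P
        - 2 * ∑' x : (HeightOneSpectrum (𝓞 F) × Fin d) × ℕ, f.primePowerTerm G (x.1, x.2 + 1) := by
  have hz : Summable (fun ρ : f.stripZeros => (f.zeroMult ρ : ℂ) * zeroTransform G ρ) ∧
      Tendsto (fun X : ℕ => ∑' ρ : f.stripZeros,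
        (f.zeroMult ρ : ℂ) * zeroTransform (truncation G X) ρ)
        atTop (𝓝 (∑' ρ : f.stripZeros, (f.zeroMult ρ : ℂ) * zeroTransform G ρ)) := by
    rcases hG with hRH | hc
    · exact tendsto_tsum_zeros_of_riemannHypothesis hf hp hRP hκ hRH G he
    · exact tendsto_tsum_zeros_of_hasCompactSupport hf hp hRP hκ G he hc
  have hX : ∀ X : ℕ, 2 ≤ X → _ := fun X hX =>
    explicit_formula hf hp hRP hκ (contDiff_truncation (G.smooth _) X)
      (hasCompactSupport_truncation G hX) (truncation_neg he X)
  have hγ := fun j => tendsto_gammaTerm_truncation (hκ j) G fun X h => (hX X h).2.1 j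
  have hm := tendsto_tsum_primePowerTerm_succ hRP G
  set D := ∑' ρ : f.stripZeros, (f.zeroMult ρ : ℂ) * zeroTransform G ρ
  set c : ℂ := (Real.log f.A : ℂ) - (d * Module.finrank ℚ F : ℕ) * (Real.log Real.pi : ℂ)
  set M := ∑' x : (HeightOneSpectrum (𝓞 F) × Fin d) × ℕ, f.primePowerTerm G (x.1, x.2 + 1)
  -- The formula for the truncations is solved for the sum over first powers. All other terms
  -- converge, so this sum does as well; its convergence need not be absolute.
  refine ⟨hz.1, fun j => (hγ j).1,
    (G 0 * c + ∑ j, gammaTerm (f.κ j) G - D) / 2 - M, ?_, by ring⟩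
  have hlim := (((tendsto_const_nhds (x := G 0 * c)).add
    (tendsto_finsetSum Finset.univ fun j _ => (hγ j).2)).sub hz.2).div_const 2 |>.sub hm
  refine hlim.congr' ?_
  filter_upwards [eventually_ge_atTop 2] with X h2
  obtain ⟨s1, s2, s3⟩ := hX X h2
  rw [s3.tsum_eq, s1.tsum_prod_nat_eq, tsum_primePowerTerm_truncation_zero f G h2,
    truncation_zero G h2]
  ring

end NFLFunction

/-! ### Rescaling the test function. -/

section Scaling

open MeasureTheory

theorem exists_scaled_schwartz (ψ : 𝓢(ℝ, ℂ)) {l : ℝ} (hl : 0 < l) :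
    ∃ G : 𝓢(ℝ, ℂ), ∀ u, G u = (l : ℂ)⁻¹ * ψ (u / l) := by
  set e : ℝ ≃L[ℝ] ℝ := ContinuousLinearEquiv.unitsEquivAut ℝ (Units.mk0 l⁻¹ (inv_ne_zero hl.ne'))
  refine ⟨(l : ℂ)⁻¹ • SchwartzMap.compCLMOfContinuousLinearEquiv ℂ e ψ, fun u => ?_⟩
  rw [smul_apply, smul_eq_mul]
  simp [e, div_eq_mul_inv]

theorem fourier_even {φ : 𝓢(ℝ, ℂ)} (hφ : ∀ x, φ (-x) = φ x) (u : ℝ) :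
    (𝓕 φ : 𝓢(ℝ, ℂ)) (-u) = (𝓕 φ : 𝓢(ℝ, ℂ)) u := by
  rw [SchwartzMap.fourier_coe, ← Real.fourierInv_eq_fourier_neg, Real.fourierInv_eq_fourier_comp_neg]
  simp_rw [hφ]

theorem integral_fourier_eq (φ : 𝓢(ℝ, ℂ)) : ∫ x, (𝓕 φ : 𝓢(ℝ, ℂ)) x = φ 0 := by
  have h := complexExtension_ofReal φ 0
  rw [← h, complexExtension]
  simp

theorem integral_Ioi_fourier_eq {φ : 𝓢(ℝ, ℂ)} (hφ : ∀ x, φ (-x) = φ x) :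
    ∫ x in Set.Ioi 0, (𝓕 φ : 𝓢(ℝ, ℂ)) x = φ 0 / 2 := by
  have hi := (𝓕 φ : 𝓢(ℝ, ℂ)).integrable (μ := volume)
  have h := intervalIntegral.integral_Iic_add_Ioi (b := (0 : ℝ)) hi.integrableOn hi.integrableOn
  have h3 := integral_comp_neg_Ioi (0 : ℝ) (𝓕 φ : 𝓢(ℝ, ℂ))
  rw [neg_zero] at h3
  simp_rw [fourier_even hφ] at h3
  rw [← h3, integral_fourier_eq] at h
  rw [← h]
  ring

/-- The substitution `u = l x` in the Fourier integral; it is valid for any complex `ρ`, since both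
sides are the same integral. -/
theorem complexExtension_eq_zeroTransform (φ : 𝓢(ℝ, ℂ)) {l : ℝ} (hl : 0 < l) {G : ℝ → ℂ}
    (hG : ∀ u, G u = (l : ℂ)⁻¹ * (𝓕 φ : 𝓢(ℝ, ℂ)) (u / l)) (ρ : ℂ) :
    complexExtension φ (((ρ - 1 / 2) / Complex.I) / (2 * Real.pi : ℂ) * (l : ℂ)) =
      zeroTransform G ρ := by
  have hl' : (l : ℂ) ≠ 0 := by exact_mod_cast hl.ne'
  have hpi : (Real.pi : ℂ) ≠ 0 := by exact_mod_cast Real.pi_pos.ne'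
  rw [complexExtension, zeroTransform]
  have h := Measure.integral_comp_div
    (fun x : ℝ => (l : ℂ)⁻¹ * (𝓕 φ : 𝓢(ℝ, ℂ)) x * Complex.exp ((ρ - 1 / 2) * (l * x))) l
  have h2 : ∀ u : ℝ, G u * Complex.exp ((ρ - 1 / 2) * u) =
      (l : ℂ)⁻¹ * (𝓕 φ : 𝓢(ℝ, ℂ)) (u / l) * Complex.exp ((ρ - 1 / 2) * (l * (u / l : ℝ))) := by
    intro u
    rw [hG]
    congr 3
    push_cast
    field_simp
  simp_rw [h2]
  rw [h, abs_of_pos hl, Complex.real_smul, ← integral_const_mul]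
  refine integral_congr_ae (Eventually.of_forall fun x => ?_)
  simp only
  rw [mul_assoc (l : ℂ)⁻¹, mul_inv_cancel_left₀ hl']
  congr 2
  field_simp

end Scaling

/-! ### The archimedean terms, uniformly in the gamma parameters. -/

section GammaError

open MeasureTheory

/-- As `Re κ > 0`, adding `1/2` does not decrease the modulus, and `‖κ‖ ≥ κ₀` limits its increase to
a bounded factor. The arguments contribute at most `2π`. -/
theorem norm_log_shift_sub_log_le {κ : ℂ} {κ₀ : ℝ} (h0 : 0 < κ₀) (hκ : 0 < κ.re) (hn : κ₀ ≤ ‖κ‖) :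
    ‖Complex.log ((1 / 2 + κ) / 2) - Complex.log κ‖ ≤
      Real.log 2 + Real.log (1 + 1 / κ₀) + 2 * Real.pi := by
  set z : ℂ := (1 / 2 + κ) / 2
  have hκp : 0 < ‖κ‖ := h0.trans_le hn
  have hz : ‖z‖ = ‖(1 / 2 + κ : ℂ)‖ / 2 := by simp [z]
  have h1 : ‖κ‖ ≤ ‖(1 / 2 + κ : ℂ)‖ := by
    refine le_of_sq_le_sq ?_ (norm_nonneg _)
    rw [← Complex.normSq_eq_norm_sq, ← Complex.normSq_eq_norm_sq, Complex.normSq_apply,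
      Complex.normSq_apply]
    simp
    nlinarith
  have hz1 : ‖κ‖ / 2 ≤ ‖z‖ := by rw [hz]; linarith
  have hz2 : ‖z‖ ≤ ‖κ‖ * (1 + 1 / κ₀) := by
    have h2 : ‖(1 / 2 + κ : ℂ)‖ ≤ 1 / 2 + ‖κ‖ := by
      refine (norm_add_le _ _).trans (by norm_num)
    have h3 : 1 ≤ ‖κ‖ * (1 / κ₀) := by rw [mul_one_div, one_le_div h0]; exact hn
    rw [hz]
    linarith
  have l1 := Real.log_le_log (by positivity) hz1
  have l2 := Real.log_le_log (lt_of_lt_of_le (by positivity) hz1) hz2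
  rw [Real.log_div hκp.ne' two_ne_zero] at l1
  rw [Real.log_mul hκp.ne' (by positivity)] at l2
  have l3 : 0 ≤ Real.log (1 + 1 / κ₀) := Real.log_nonneg (by simp; positivity)
  have l4 := Real.log_nonneg one_le_two
  refine (Complex.norm_le_abs_re_add_abs_im _).trans ?_
  rw [Complex.sub_re, Complex.sub_im, Complex.log_re, Complex.log_im, Complex.log_re,
    Complex.log_im]
  have a1 := Complex.abs_arg_le_pi z
  have a2 := Complex.abs_arg_le_pi κ
  have a3 := abs_sub (Complex.arg z) (Complex.arg κ)
  have a4 : |Real.log ‖z‖ - Real.log ‖κ‖| ≤ Real.log 2 + Real.log (1 + 1 / κ₀) :=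
    abs_le.2 ⟨by linarith, by linarith⟩
  linarith

theorem integral_exp_mul_le {r : ℝ} (hr : 0 < r) :
    IntegrableOn (fun u : ℝ => Real.exp (-r * u) * u) (Set.Ioi 0) ∧
    ∫ u in Set.Ioi (0 : ℝ), Real.exp (-r * u) * u ≤ 4 / r ^ 2 := by
  have hi : IntegrableOn (fun u : ℝ => 2 / r * Real.exp (-(r / 2) * u)) (Set.Ioi 0) :=
    (integrableOn_exp_mul_Ioi (by linarith) 0).const_mul _
  have hle : ∀ u ∈ Set.Ioi (0 : ℝ), Real.exp (-r * u) * u ≤ 2 / r * Real.exp (-(r / 2) * u) := by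
    intro u hu
    have h1 : r / 2 * u ≤ Real.exp (r / 2 * u) := by linarith [Real.add_one_le_exp (r / 2 * u)]
    have h2 : u ≤ 2 / r * Real.exp (r / 2 * u) := by
      calc u = 2 / r * (r / 2 * u) := by field_simp
        _ ≤ _ := by gcongr
    calc _ ≤ Real.exp (-r * u) * (2 / r * Real.exp (r / 2 * u)) := by gcongr
      _ = 2 / r * (Real.exp (-r * u) * Real.exp (r / 2 * u)) := by ring
      _ = _ := by rw [← Real.exp_add]; congr 2; ring
  have hi2 : IntegrableOn (fun u : ℝ => Real.exp (-r * u) * u) (Set.Ioi 0) := by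
    refine hi.mono' (by fun_prop : Continuous fun u : ℝ => Real.exp (-r * u) * u).aestronglyMeasurable ?_
    filter_upwards [ae_restrict_mem measurableSet_Ioi] with u hu
    rw [Real.norm_of_nonneg (mul_nonneg (Real.exp_pos _).le (Set.mem_Ioi.1 hu).le)]
    exact hle u hu
  refine ⟨hi2, (setIntegral_mono_on hi2 hi measurableSet_Ioi hle).trans_eq ?_⟩
  rw [integral_const_mul, integral_exp_mul_Ioi (by linarith)]
  simp
  field_simp
  norm_num

/-- Replacing `G(u)` by `G(0)` in every summand produces `G(0)` times the digamma function at `(1/2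
+ κ)/2`, which is `log κ + O(1)`. The Lipschitz bound makes the remainder in the `n`-th summand
`O(b/(n + 1/4)²)`. Nothing here depends on the size of `κ`. -/
theorem exists_norm_gammaTerm_sub_le {κ₀ : ℝ} (h0 : 0 < κ₀) :
    ∃ C, 0 ≤ C ∧ ∀ κ : ℂ, 0 < κ.re → κ₀ ≤ ‖κ‖ → ∀ (G : 𝓢(ℝ, ℂ)) (b : ℝ),
      (∀ u, ‖G 0 - G u‖ ≤ b * |u|) → Summable (gammaSummand κ G) →
      ‖gammaTerm κ G - G 0 * Complex.log κ‖ ≤ C * (‖G 0‖ + b) := by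
  obtain ⟨C, hC⟩ := exists_norm_digamma_sub_log_le (a := 1 / 4) (by norm_num)
  set S := ∑' n : ℕ, 1 / ((n : ℝ) + 1 / 4) ^ 2
  set M := C + (Real.log 2 + Real.log (1 + 1 / κ₀) + 2 * Real.pi)
  have hS : 0 ≤ S := tsum_nonneg fun n => by positivity
  have hC0 : 0 ≤ C := (norm_nonneg _).trans (hC 1 (by norm_num))
  have hM : 0 ≤ M := by
    have : 0 ≤ Real.log (1 + 1 / κ₀) := Real.log_nonneg (by simp; positivity)
    have := Real.log_nonneg one_le_two
    positivity
  refine ⟨M + 2 * S, by positivity, fun κ hκ hn G b hb hs => ?_⟩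
  have hb0 : 0 ≤ b := by
    have := hb 1
    rw [abs_one, mul_one] at this
    exact (norm_nonneg _).trans this
  set z : ℂ := (1 / 2 + κ) / 2
  have hzre : z.re = (1 / 2 + κ.re) / 2 := by simp [z]
  have hz : 0 < z.re := by rw [hzre]; linarith
  have hd := summable_digamma_summand hz
  have hre := fun n : ℕ => re_two_mul_add_half_add n κ
  have hbn : ∀ n : ℕ, 0 < (2 * (n : ℂ) + 1 / 2 + κ).re := fun n => by rw [hre]; positivity
  set J : ℕ → ℂ := fun n =>
    2 * ∫ u in Set.Ioi (0 : ℝ), Complex.exp (-(2 * n + 1 / 2 + κ) * u) * (G 0 - G u)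
  have e : ∀ n : ℕ, gammaSummand κ G n = G 0 * (1 / ((n : ℂ) + 1) - 1 / ((n : ℂ) + z)) + J n := by
    intro n
    have hne : (2 * (n : ℂ) + 1 / 2 + κ) ≠ 0 := fun h => by
      have := hbn n
      rw [h] at this
      simp at this
    have hneg : (-(2 * (n : ℂ) + 1 / 2 + κ)).re < 0 := by rw [Complex.neg_re]; linarith [hbn n]
    have i1 : IntegrableOn (fun u : ℝ => Complex.exp (-(2 * n + 1 / 2 + κ) * u) * G 0)
        (Set.Ioi 0) := (integrableOn_exp_mul_complex_Ioi hneg 0).mul_const _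
    simp only [J]
    simp_rw [mul_sub]
    rw [integral_sub i1 (integrableOn_exp_mul (hbn n).le G.integrable), integral_mul_const,
      integral_exp_mul_complex_Ioi hneg, gammaSummand]
    have h2 : (n : ℂ) + z = (2 * (n : ℂ) + 1 / 2 + κ) / 2 := by simp only [z]; ring
    rw [h2, one_div_div]
    simp only [Complex.ofReal_zero, mul_zero, Complex.exp_zero]
    rw [neg_div_neg_eq]
    ring
  have hJ : ∀ n, ‖J n‖ ≤ 2 * b * (1 / ((n : ℝ) + 1 / 4) ^ 2) := by
    intro n
    set r : ℝ := 2 * n + 1 / 2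
    have hr : 0 < r := by positivity
    obtain ⟨i1, i2⟩ := integral_exp_mul_le hr
    simp only [J]
    rw [norm_mul, Complex.norm_ofNat]
    have h1 : ‖∫ u in Set.Ioi (0 : ℝ), Complex.exp (-(2 * n + 1 / 2 + κ) * u) * (G 0 - G u)‖ ≤
        ∫ u in Set.Ioi (0 : ℝ), b * (Real.exp (-r * u) * u) := by
      refine norm_integral_le_of_norm_le (i1.const_mul b) ?_
      filter_upwards [ae_restrict_mem measurableSet_Ioi] with u hu
      rw [Set.mem_Ioi] at hu
      rw [norm_mul, Complex.norm_exp, Complex.re_mul_ofReal, Complex.neg_re, hre]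
      have h2 := hb u
      rw [abs_of_pos hu] at h2
      have h3 : 0 ≤ κ.re * u := by positivity
      calc _ ≤ Real.exp (-r * u) * (b * u) :=
            mul_le_mul (Real.exp_le_exp.2 (by simp only [r]; linarith)) h2 (norm_nonneg _)
              (Real.exp_pos _).le
        _ = _ := by ring
    rw [integral_const_mul] at h1
    have h4 : 4 / r ^ 2 = 1 / ((n : ℝ) + 1 / 4) ^ 2 := by
      have : r = 2 * ((n : ℝ) + 1 / 4) := by simp only [r]; ring
      rw [this, mul_pow]
      field_simp
      norm_num
    rw [← h4]
    have := mul_le_mul_of_nonneg_left i2 hb0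
    linarith
  have hsJ : Summable J := Summable.of_norm_bounded
    ((summable_inv_nat_add_sq (a := 1 / 4) (by norm_num)).mul_left _) hJ
  have hJt : ‖∑' n, J n‖ ≤ 2 * b * S := by
    rw [← tsum_mul_left]
    exact tsum_of_norm_bounded
      ((summable_inv_nat_add_sq (a := 1 / 4) (by norm_num)).mul_left _).hasSum hJ
  have htot : gammaTerm κ G - G 0 * Complex.log κ =
      G 0 * ((Complex.digamma z - Complex.log z) + (Complex.log z - Complex.log κ)) +
        ∑' n, J n := by
    rw [gammaTerm, tsum_congr e, (hd.mul_left _).tsum_add hsJ, tsum_mul_left, digamma_eq_tsum hz]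
    ring
  have h1 := hC z (by rw [hzre]; linarith)
  have h2 := norm_log_shift_sub_log_le h0 hκ hn
  rw [htot]
  refine (norm_add_le _ _).trans ?_
  rw [norm_mul]
  have h3 : ‖(Complex.digamma z - Complex.log z) + (Complex.log z - Complex.log κ)‖ ≤ M :=
    (norm_add_le _ _).trans (add_le_add h1 h2)
  have h4 := mul_le_mul_of_nonneg_left h3 (norm_nonneg (G 0))
  nlinarith [mul_nonneg hM hb0, mul_nonneg hS (norm_nonneg (G 0))]

end GammaError

/-! ### The conductor term and the prime sum in terms of the rescaled function. -/

namespace NFLFunction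

variable {F : Type*} [Field F] [NumberField F] {d : ℕ}

/-- In general the principal logarithm of a product is not the sum of the logarithms. Here the sum
over the `κ_j` is real by conjugate pairing, so the product is positive and no multiple of `2πi`
arises. -/
theorem log_conductor_eq (f : NFLFunction F d) (hκ : ∀ j, 0 < (f.κ j).re) :
    Complex.log ((Real.pi : ℂ) ^ (-((d * Module.finrank ℚ F : ℕ) : ℤ)) * (f.A : ℂ) * ∏ j, f.κ j) =
      (Real.log f.A : ℂ) - (d * Module.finrank ℚ F : ℕ) * (Real.log Real.pi : ℂ) +
        ∑ j, Complex.log (f.κ j) := by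
  set S := ∑ j, Complex.log (f.κ j)
  have hne : ∀ j, f.κ j ≠ 0 := fun j h => by
    have := hκ j
    rw [h] at this
    simp at this
  have hS : S = (S.re : ℂ) := by
    rw [eq_comm, ← Complex.conj_eq_iff_re]
    obtain ⟨σ, hσ⟩ := f.κ_conj
    simp only [S]
    rw [map_sum, ← Equiv.sum_comp σ fun j => Complex.log (f.κ j)]
    refine Finset.sum_congr rfl fun j _ => ?_
    rw [hσ, Complex.log_conj]
    intro h
    rw [Complex.arg_eq_pi_iff] at h
    linarith [h.1, hκ j]
  have hP : ∏ j, f.κ j = Complex.exp S := by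
    rw [Complex.exp_sum]
    exact Finset.prod_congr rfl fun j _ => (Complex.exp_log (hne j)).symm
  have hA : (0 : ℝ) < f.A := by exact_mod_cast f.one_le_A
  set r : ℝ := Real.log f.A - (d * Module.finrank ℚ F : ℕ) * Real.log Real.pi + S.re
  have hr : (Real.pi : ℂ) ^ (-((d * Module.finrank ℚ F : ℕ) : ℤ)) * (f.A : ℂ) * ∏ j, f.κ j =
      ((Real.exp r : ℝ) : ℂ) := by
    rw [hP, hS]
    have h1 : Real.exp r =
        Real.pi ^ (-((d * Module.finrank ℚ F : ℕ) : ℤ)) * f.A * Real.exp S.re := by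
      have h2 : Real.pi ^ (-((d * Module.finrank ℚ F : ℕ) : ℤ)) =
          Real.exp (-((d * Module.finrank ℚ F : ℕ) * Real.log Real.pi)) := by
        rw [Real.exp_neg, Real.exp_nat_mul, Real.exp_log Real.pi_pos, zpow_neg, zpow_natCast]
      rw [h2, ← Real.exp_log hA, ← Real.exp_add, ← Real.exp_add]
      congr 1
      simp only [r]
      ring
    rw [h1]
    push_cast
    simp
  rw [hr, ← Complex.ofReal_log (Real.exp_pos _).le, Real.log_exp]
  simp only [r]
  push_cast
  rw [← hS]

theorem primesLE_natFloor (F : Type*) [Field F] [NumberField F] {x : ℝ} (hx : 0 ≤ x) :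
    primesLE F x = primesLE F (⌊x⌋₊ : ℝ) := by
  ext p
  rw [mem_primesLE, mem_primesLE, Nat.cast_le, Nat.le_floor_iff hx]

theorem eulerTerm_half (f : NFLFunction F d) (x : HeightOneSpectrum (𝓞 F) × Fin d) :
    f.eulerTerm x (1 / 2) = f.α x.2 x.1 * ((((primeNorm x.1 : ℝ) ^ (1 / 2 : ℝ) : ℝ) : ℂ))⁻¹ := by
  rw [eulerTerm, Complex.cpow_neg, Complex.ofReal_cpow (by positivity)]
  push_cast
  rfl

theorem primeSum_eq (f : NFLFunction F d) (φ : 𝓢(ℝ, ℂ)) {R : ℝ} (hR : 0 < Real.log R) {G : ℝ → ℂ}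
    (hG : ∀ u, G u = (Real.log R : ℂ)⁻¹ * (𝓕 φ : 𝓢(ℝ, ℂ)) (u / Real.log R)) (x : ℝ) :
    f.primeSum φ R x =
      (Real.log R : ℂ) * ∑ p ∈ primesLE F x, ∑ i, f.primePowerTerm G ((p, i), 0) := by
  have hl : (Real.log R : ℂ) ≠ 0 := by exact_mod_cast hR.ne'
  rw [primeSum, Finset.mul_sum]
  refine Finset.sum_congr rfl fun p _ => ?_
  rw [vonMangoldt, Finset.mul_sum, Finset.mul_sum, Finset.sum_mul, Finset.sum_div]
  refine Finset.sum_congr rfl fun i _ => ?_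
  rw [primePowerTerm, hG, eulerTerm_half]
  simp only [zero_add, Nat.cast_one, one_mul, pow_one]
  field_simp

end NFLFunction

/-! ### Squares and higher powers of primes. -/

section Abel

open MeasureTheory

/-- Abel summation, with the main term `δ t` integrated by parts back into the primitive `H` of `h`.
Only the deviation of the summatory function from `δ t` remains, and its bound does not depend on
`b`. -/
theorem norm_sum_mul_sub_le_of_asymptotic (c : ℕ → ℂ) {h h' H : ℝ → ℂ} {β K1 K2 : ℝ} {δ : ℂ}
    (hh : ∀ t, 0 < t → HasDerivAt h (h' t) t) (hH : ∀ t, 0 < t → HasDerivAt H (h t) t)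
    (hc : ContinuousOn h' (Set.Ioi 0)) (hβ : 0 ≤ β) (hK1 : 0 ≤ K1) (hK2 : 0 ≤ K2)
    (bh : ∀ t, 1 ≤ t → ‖h t‖ ≤ β * t ^ (-1 : ℝ))
    (bh' : ∀ t, 1 ≤ t → ‖h' t‖ ≤ β * t ^ (-2 : ℝ))
    (hA : ∀ t : ℝ, 2 ≤ t → ‖∑ k ∈ Finset.Icc 0 ⌊t⌋₊, c k - δ * t‖ ≤
      K1 * t ^ (1 / 2 : ℝ) + K2 * t ^ (3 / 4 : ℝ)) {a b : ℝ} (ha : 2 ≤ a) (hab : a ≤ b) :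
    ‖∑ k ∈ Finset.Ioc ⌊a⌋₊ ⌊b⌋₊, h k * c k - δ * (H b - H a)‖ ≤
      β * (4 * (K1 * a ^ (-(1 / 2) : ℝ)) + 6 * (K2 * a ^ (-(1 / 4) : ℝ))) := by
  have ha0 : 0 < a := by linarith
  have hb0 : 0 < b := by linarith
  set A : ℝ → ℂ := fun t => ∑ k ∈ Finset.Icc 0 ⌊t⌋₊, c k
  have hpos : ∀ t ∈ Set.Icc a b, 0 < t := fun t ht => ha0.trans_le ht.1
  have hsub : Set.Icc a b ⊆ Set.Ioi 0 := fun t ht => hpos t ht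
  have hder : ∀ t ∈ Set.Icc a b, deriv h t = h' t := fun t ht => (hh t (hpos t ht)).deriv
  have hi' : IntegrableOn h' (Set.Icc a b) := (hc.mono hsub).integrableOn_Icc
  have hid : IntegrableOn (deriv h) (Set.Icc a b) := hi'.congr_fun (fun t ht => (hder t ht).symm)
    measurableSet_Icc
  have abel := sum_mul_eq_sub_sub_integral_mul c ha0.le hab
    (fun t ht => (hh t (hpos t ht)).differentiableAt) hid
  have hI : ∫ t in Set.Ioc a b, deriv h t * ∑ k ∈ Finset.Icc 0 ⌊t⌋₊, c k =
      ∫ t in Set.Ioc a b, h' t * A t :=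
    setIntegral_congr_fun measurableSet_Ioc fun t ht => by
      simp only [A]
      rw [hder t (Set.Ioc_subset_Icc_self ht)]
  have iA : IntegrableOn (fun t => h' t * A t) (Set.Ioc a b) :=
    (integrableOn_mul_sum_Icc c ha0.le hi').mono_set Set.Ioc_subset_Icc_self
  have it : IntegrableOn (fun t : ℝ => h' t * (δ * t)) (Set.Ioc a b) :=
    (((hc.mono hsub).mul (by fun_prop : Continuous fun t : ℝ => δ * (t : ℂ)).continuousOn).integrableOn_Icc).mono_set
      Set.Ioc_subset_Icc_self
  have ftc : ∫ t in Set.Ioc a b, h' t * (δ * t) =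
      δ * (b * h b - H b) - δ * (a * h a - H a) := by
    rw [← intervalIntegral.integral_of_le hab]
    refine intervalIntegral.integral_eq_sub_of_hasDerivAt (f := fun t : ℝ => δ * (t * h t - H t))
      (fun t ht => ?_) ?_
    · rw [Set.uIcc_of_le hab] at ht
      have h1 : HasDerivAt (fun t : ℝ => (t : ℂ)) 1 t := (hasDerivAt_id t).ofReal_comp
      refine (((h1.mul (hh t (hpos t ht))).sub (hH t (hpos t ht))).const_mul δ).congr_deriv ?_
      ring
    · rw [intervalIntegrable_iff_integrableOn_Ioc_of_le hab]
      exact it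
  have key : ∑ k ∈ Finset.Ioc ⌊a⌋₊ ⌊b⌋₊, h k * c k - δ * (H b - H a) =
      h b * (A b - δ * b) - h a * (A a - δ * a) -
        ∫ t in Set.Ioc a b, h' t * (A t - δ * t) := by
    have : ∫ t in Set.Ioc a b, h' t * (A t - δ * t) =
        (∫ t in Set.Ioc a b, h' t * A t) - ∫ t in Set.Ioc a b, h' t * (δ * t) := by
      rw [← integral_sub iA it]
      simp_rw [mul_sub]
    rw [this, ftc, abel, hI]
    ring
  have bound : ∀ t, 2 ≤ t → a ≤ t → ∀ (x : ℂ), ‖x‖ ≤ β * t ^ (-1 : ℝ) →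
      ‖x * (A t - δ * t)‖ ≤ β * (K1 * a ^ (-(1 / 2) : ℝ) + K2 * a ^ (-(1 / 4) : ℝ)) := by
    intro t ht hat x hx
    have ht0 : 0 < t := by linarith
    rw [norm_mul]
    calc _ ≤ β * t ^ (-1 : ℝ) * (K1 * t ^ (1 / 2 : ℝ) + K2 * t ^ (3 / 4 : ℝ)) :=
          mul_le_mul hx (hA t ht) (norm_nonneg _) (by positivity)
      _ = β * (K1 * (t ^ (-1 : ℝ) * t ^ (1 / 2 : ℝ)) + K2 * (t ^ (-1 : ℝ) * t ^ (3 / 4 : ℝ))) := by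
          ring
      _ = β * (K1 * t ^ (-(1 / 2) : ℝ) + K2 * t ^ (-(1 / 4) : ℝ)) := by
          rw [← Real.rpow_add ht0, ← Real.rpow_add ht0]
          norm_num
      _ ≤ _ := by
          gcongr β * (K1 * ?_ + K2 * ?_)
          · exact Real.rpow_le_rpow_of_nonpos ha0 hat (by norm_num)
          · exact Real.rpow_le_rpow_of_nonpos ha0 hat (by norm_num)
  have j1 := (integrableOn_Ioi_rpow_of_lt (a := -(3 / 2)) (by norm_num) ha0).const_mul (β * K1)
  have j2 := (integrableOn_Ioi_rpow_of_lt (a := -(5 / 4)) (by norm_num) ha0).const_mul (β * K2)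
  -- The tails of `t^{-3/2}` and `t^{-5/4}` give the coefficients 2 and 4; the boundary terms at `a`
  -- and `b` raise them to 4 and 6.
  have hint : ‖∫ t in Set.Ioc a b, h' t * (A t - δ * t)‖ ≤
      β * (2 * (K1 * a ^ (-(1 / 2) : ℝ)) + 4 * (K2 * a ^ (-(1 / 4) : ℝ))) := by
    have h1 : ‖∫ t in Set.Ioc a b, h' t * (A t - δ * t)‖ ≤
        ∫ t in Set.Ioc a b, (β * K1 * t ^ (-(3 / 2) : ℝ) + β * K2 * t ^ (-(5 / 4) : ℝ)) := by
      refine norm_integral_le_of_norm_le (IntegrableOn.mono_set (j1.add j2) Set.Ioc_subset_Ioi_self) ?_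
      filter_upwards [ae_restrict_mem measurableSet_Ioc] with t ht
      have ht0 : 0 < t := ha0.trans ht.1
      have ht2 : 2 ≤ t := ha.trans ht.1.le
      rw [norm_mul]
      calc _ ≤ β * t ^ (-2 : ℝ) * (K1 * t ^ (1 / 2 : ℝ) + K2 * t ^ (3 / 4 : ℝ)) :=
            mul_le_mul (bh' t (by linarith)) (hA t ht2) (norm_nonneg _) (by positivity)
        _ = β * K1 * (t ^ (-2 : ℝ) * t ^ (1 / 2 : ℝ)) + β * K2 * (t ^ (-2 : ℝ) * t ^ (3 / 4 : ℝ)) := by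
            ring
        _ = _ := by
            rw [← Real.rpow_add ht0, ← Real.rpow_add ht0]
            norm_num
    have h2 : ∫ t in Set.Ioc a b, (β * K1 * t ^ (-(3 / 2) : ℝ) + β * K2 * t ^ (-(5 / 4) : ℝ)) ≤
        ∫ t in Set.Ioi a, (β * K1 * t ^ (-(3 / 2) : ℝ) + β * K2 * t ^ (-(5 / 4) : ℝ)) := by
      refine setIntegral_mono_set (j1.add j2) ?_ Set.Ioc_subset_Ioi_self.eventuallyLE
      filter_upwards [ae_restrict_mem measurableSet_Ioi] with t ht
      have : 0 < t := ha0.trans ht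
      simp only [Pi.zero_apply]
      positivity
    refine h1.trans (h2.trans_eq ?_)
    rw [integral_add j1 j2, integral_const_mul, integral_const_mul,
      integral_Ioi_rpow_of_lt (by norm_num) ha0, integral_Ioi_rpow_of_lt (by norm_num) ha0]
    norm_num
    ring
  rw [key]
  have e1 := bound b (by linarith) hab _ (bh b (by linarith))
  have e2 := bound a ha le_rfl _ (bh a (by linarith))
  refine (norm_sub_le _ _).trans ((add_le_add ((norm_sub_le _ _).trans (add_le_add e1 e2)) hint).trans_eq ?_)
  ring

end Abel

namespace NFLFunction

open MeasureTheory

variable {F : Type*} [Field F] [NumberField F] {d : ℕ}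

/-- The sum of `Λ_f(𝔭²)` over the primes of norm `k`. -/
def primeSquareCoeff (f : NFLFunction F d) (k : ℕ) : ℂ :=
  ∑ p ∈ primesLE F k with primeNorm p = k, f.vonMangoldt p 2

theorem sum_mul_primeSquareCoeff (f : NFLFunction F d) (g : ℕ → ℂ) (n : ℕ) :
    ∑ k ∈ Finset.Icc 0 n, g k * f.primeSquareCoeff k =
      ∑ p ∈ primesLE F n, g (primeNorm p) * f.vonMangoldt p 2 := by
  rw [← Finset.sum_fiberwise_of_maps_to (s := primesLE F n) (t := Finset.Icc 0 n) (g := primeNorm)]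
  · refine Finset.sum_congr rfl fun k hk => ?_
    rw [Finset.mem_Icc] at hk
    rw [primeSquareCoeff, Finset.mul_sum]
    refine Finset.sum_congr ?_ fun p hp => ?_
    · ext p
      simp only [Finset.mem_filter, mem_primesLE, Nat.cast_le]
      constructor <;> rintro ⟨h1, h2⟩ <;> exact ⟨by omega, h2⟩
    · rw [(Finset.mem_filter.1 hp).2]
  · intro p hp
    rw [mem_primesLE, Nat.cast_le] at hp
    exact Finset.mem_Icc.2 ⟨Nat.zero_le _, hp⟩

theorem norm_vonMangoldt_le {f : NFLFunction F d} (hRP : f.RamanujanPetersson)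
    (p : HeightOneSpectrum (𝓞 F)) (m : ℕ) :
    ‖f.vonMangoldt p m‖ ≤ d * Real.log (primeNorm p) := by
  rw [vonMangoldt, norm_mul, Complex.norm_real, Real.norm_of_nonneg (log_primeNorm_pos p).le,
    mul_comm]
  have h : ‖∑ i, f.α i p ^ m‖ ≤ ∑ _i : Fin d, (1 : ℝ) := norm_sum_le_of_le _ fun i _ => by
    rw [norm_pow]
    exact pow_le_one₀ (norm_nonneg _) (hRP i p).2
  rw [Finset.sum_const, Finset.card_univ, Fintype.card_fin, nsmul_eq_mul, mul_one] at h
  exact mul_le_mul_of_nonneg_right h (log_primeNorm_pos p).le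

/-- The purpose is to separate `c` from `x`: `log² c` multiplies only `x^{1/2}`, and `log² x` is
absorbed into a larger power of `x` free of `c`. -/
theorem primeSquareAsymptotic_rpow {f : NFLFunction F d} {δ : ℤ} {c K : ℝ}
    (hc : Real.exp 1 < c) (h : f.PrimeSquareAsymptotic δ c K) {x : ℝ} (hx : 2 ≤ x) :
    ‖∑ p ∈ primesLE F x, f.vonMangoldt p 2 - (δ : ℂ) * (x : ℂ)‖ ≤
      2 * |K| * Real.log c ^ 2 * x ^ (1 / 2 : ℝ) + 128 * |K| * x ^ (3 / 4 : ℝ) := by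
  have hx0 : 0 < x := by linarith
  have hc0 : 0 < c := (Real.exp_pos 1).trans hc
  have h1 := Real.log_le_rpow_div hx0.le (ε := 1 / 8) (by norm_num)
  have h2 := Real.log_nonneg (by linarith : (1 : ℝ) ≤ x)
  have h3 : Real.log x ^ 2 ≤ 64 * x ^ (1 / 4 : ℝ) := by
    calc Real.log x ^ 2 ≤ (x ^ (1 / 8 : ℝ) / (1 / 8)) ^ 2 := by gcongr
      _ = 64 * (x ^ (1 / 8 : ℝ) * x ^ (1 / 8 : ℝ)) := by ring
      _ = _ := by rw [← Real.rpow_add hx0]; norm_num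
  have h4 : Real.log (c * x) ^ 2 ≤ 2 * Real.log c ^ 2 + 128 * x ^ (1 / 4 : ℝ) := by
    rw [Real.log_mul hc0.ne' hx0.ne']
    nlinarith [sq_nonneg (Real.log c - Real.log x)]
  have h5 : x ^ (1 / 2 : ℝ) * x ^ (1 / 4 : ℝ) = x ^ (3 / 4 : ℝ) := by
    rw [← Real.rpow_add hx0]; norm_num
  calc _ ≤ K * (x ^ (1 / 2 : ℝ) * Real.log (c * x) ^ 2) := h x hx
    _ ≤ |K| * (x ^ (1 / 2 : ℝ) * (2 * Real.log c ^ 2 + 128 * x ^ (1 / 4 : ℝ))) := by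
        refine mul_le_mul (le_abs_self K) ?_ (by positivity) (abs_nonneg K)
        gcongr
    _ = 2 * |K| * Real.log c ^ 2 * x ^ (1 / 2 : ℝ) +
        128 * |K| * (x ^ (1 / 2 : ℝ) * x ^ (1 / 4 : ℝ)) := by ring
    _ = _ := by rw [h5]

/-- The asymptotic is compared with the trivial Chebyshev bound, both divided by `x → ∞`. A bound
depending only on `F` and `d` is needed, because `δ` is not among the fixed data. -/
theorem norm_delta_le {f : NFLFunction F d} (hRP : f.RamanujanPetersson) {δ : ℤ} {c K : ℝ}
    (hc : Real.exp 1 < c) (h : f.PrimeSquareAsymptotic δ c K) :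
    ‖(δ : ℂ)‖ ≤ d * (Module.finrank ℚ F * Real.log 4) := by
  have hlim : Tendsto (fun x : ℝ => d * (Module.finrank ℚ F * Real.log 4) +
      (2 * |K| * Real.log c ^ 2 * x ^ (-(1 / 2) : ℝ) + 128 * |K| * x ^ (-(1 / 4) : ℝ))) atTop
      (𝓝 (d * (Module.finrank ℚ F * Real.log 4) +
        (2 * |K| * Real.log c ^ 2 * 0 + 128 * |K| * 0))) :=
    tendsto_const_nhds.add (((tendsto_rpow_neg_atTop (by norm_num)).const_mul _).add
      ((tendsto_rpow_neg_atTop (by norm_num)).const_mul _))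
  simp only [mul_zero, add_zero] at hlim
  refine ge_of_tendsto hlim ?_
  filter_upwards [eventually_ge_atTop 2] with x hx
  have hx0 : 0 < x := by linarith
  have h1 := primeSquareAsymptotic_rpow hc h hx
  have h2 : ‖∑ p ∈ primesLE F x, f.vonMangoldt p 2‖ ≤
      d * (Module.finrank ℚ F * Real.log 4 * x) := by
    refine (norm_sum_le_of_le _ fun p _ => norm_vonMangoldt_le hRP p 2).trans ?_
    rw [← Finset.mul_sum]
    exact mul_le_mul_of_nonneg_left (sum_log_primeNorm_le hx0.le) (Nat.cast_nonneg d)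
  have h3 : ‖(δ : ℂ)‖ * x ≤ d * (Module.finrank ℚ F * Real.log 4 * x) +
      (2 * |K| * Real.log c ^ 2 * x ^ (1 / 2 : ℝ) + 128 * |K| * x ^ (3 / 4 : ℝ)) := by
    have h4 : ‖(δ : ℂ)‖ * x = ‖(δ : ℂ) * (x : ℂ)‖ := by
      rw [norm_mul, Complex.norm_real, Real.norm_of_nonneg hx0.le]
    rw [h4]
    have h5 := norm_sub_norm_le ((δ : ℂ) * (x : ℂ)) (∑ p ∈ primesLE F x, f.vonMangoldt p 2)
    rw [norm_sub_rev] at h5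
    linarith
  have e1 : x ^ (-(1 / 2) : ℝ) * x = x ^ (1 / 2 : ℝ) := by
    rw [← Real.rpow_add_one hx0.ne']; norm_num
  have e2 : x ^ (-(1 / 4) : ℝ) * x = x ^ (3 / 4 : ℝ) := by
    rw [← Real.rpow_add_one hx0.ne']; norm_num
  rw [← e1, ← e2] at h3
  refine le_of_mul_le_mul_right ?_ hx0
  linarith

theorem sum_primePowerTerm_one (f : NFLFunction F d) (G : ℝ → ℂ) (p : HeightOneSpectrum (𝓞 F)) :
    ∑ i, f.primePowerTerm G ((p, i), 1) =
      G (2 * Real.log (primeNorm p)) / (primeNorm p : ℝ) * f.vonMangoldt p 2 := by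
  have hN := primeNorm_pos_real p
  have h1 : ((((primeNorm p : ℝ) ^ (1 / 2 : ℝ) : ℝ) : ℂ)) ^ 2 = (primeNorm p : ℝ) := by
    rw [← Complex.ofReal_pow, ← Real.rpow_natCast, ← Real.rpow_mul hN.le]
    norm_num
  rw [vonMangoldt, Finset.mul_sum, Finset.mul_sum]
  refine Finset.sum_congr rfl fun i _ => ?_
  rw [primePowerTerm, eulerTerm_half]
  simp only
  norm_num only [mul_pow, inv_pow, h1]
  push_cast
  ring

/-- The sum over squares weights `Λ_f(𝔭²)` by `G(2 log N)/N`. Small primes are bounded absolutely,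
large ones by Abel summation; the cut is chosen so that `c` enters only through `log log c`. -/
theorem exists_norm_tsum_prime_squares_sub_le (F : Type*) [Field F] [NumberField F] (d : ℕ)
    (K : ℝ) {c₀ : ℝ} (hc₀ : Real.exp 1 < c₀) :
    ∃ C, 0 ≤ C ∧ ∀ (f : NFLFunction F d) (δ : ℤ) (c : ℝ), f.RamanujanPetersson → c₀ ≤ c →
      f.PrimeSquareAsymptotic δ c K → ∀ (G : 𝓢(ℝ, ℂ)) (β : ℝ), (∀ u, ‖G u‖ ≤ β) →
      (∀ u, ‖SchwartzMap.derivCLM ℝ ℂ G u‖ ≤ β) →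
      ‖∑' x : HeightOneSpectrum (𝓞 F) × Fin d, f.primePowerTerm G (x, 1) -
        δ / 2 * ∫ u in Set.Ioi 0, G u‖ ≤ C * (β * (1 + Real.log (Real.log c))) := by
  set n : ℝ := (Module.finrank ℚ F : ℝ)
  have hn : 0 ≤ n := Nat.cast_nonneg _
  have hl4 : 0 ≤ Real.log 4 := Real.log_nonneg (by norm_num)
  -- The three summands bound the primes up to the cut `a`, the term `δ H(a)`, and the error of Abel
  -- summation beyond `a`.
  refine ⟨d * (16 * n) + d * (n * Real.log 4) * 4 + 3 * (8 * |K| + 768 * |K|), by positivity,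
    fun f δ c hRP hcc hasym G β hβ hβ' => ?_⟩
  have hc : Real.exp 1 < c := hc₀.trans_le hcc
  have hlc : 1 < Real.log c := by
    rw [← Real.log_exp 1]
    exact Real.log_lt_log (Real.exp_pos 1) hc
  have hβ0 : 0 ≤ β := (norm_nonneg _).trans (hβ 0)
  set LL := Real.log (Real.log c)
  have hLL : 0 < LL := Real.log_pos hlc
  set G1 : 𝓢(ℝ, ℂ) := SchwartzMap.derivCLM ℝ ℂ G
  set h : ℝ → ℂ := fun t => G (2 * Real.log t) / t
  set h' : ℝ → ℂ := fun t => (2 * G1 (2 * Real.log t) - G (2 * Real.log t)) / t ^ 2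
  -- This is the primitive of `h`: substituting `u = 2 log t` in `G(2 log t) dt/t` produces the
  -- factor `1/2`.
  set H : ℝ → ℂ := fun t => 1 / 2 * ∫ u in (0 : ℝ)..(2 * Real.log t), G u
  have hlog2 : ∀ t : ℝ, 0 < t → HasDerivAt (fun t => 2 * Real.log t) (2 * t⁻¹) t := fun t ht =>
    (Real.hasDerivAt_log ht.ne').const_mul 2
  have dh : ∀ t, 0 < t → HasDerivAt h (h' t) t := by
    intro t ht
    have ht' : (t : ℂ) ≠ 0 := by exact_mod_cast ht.ne'
    have h1 : HasDerivAt (fun t : ℝ => (t : ℂ)) 1 t := (hasDerivAt_id t).ofReal_comp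
    have h2 : HasDerivAt (fun t => G (2 * Real.log t)) ((2 * t⁻¹ : ℝ) • G1 (2 * Real.log t)) t :=
      (G.hasDerivAt_derivCLM (2 * Real.log t)).scomp t (hlog2 t ht)
    refine (h2.div h1 ht').congr_deriv ?_
    simp only [h']
    rw [Complex.real_smul]
    push_cast
    field_simp
  have dH : ∀ t, 0 < t → HasDerivAt H (h t) t := by
    intro t ht
    have ht' : (t : ℂ) ≠ 0 := by exact_mod_cast ht.ne'
    have h1 := intervalIntegral.integral_hasDerivAt_right (f := G) (a := 0) (b := 2 * Real.log t)
      (G.continuous.intervalIntegrable _ _)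
      (G.continuous.stronglyMeasurableAtFilter _ _) G.continuous.continuousAt
    refine ((h1.scomp t (hlog2 t ht)).const_mul (1 / 2 : ℂ)).congr_deriv ?_
    simp only [h]
    rw [Complex.real_smul]
    push_cast
    field_simp
  have ch' : ContinuousOn h' (Set.Ioi 0) := by
    intro t ht
    have ht0 : t ≠ 0 := (Set.mem_Ioi.1 ht).ne'
    have ht' : (t : ℂ) ^ 2 ≠ 0 := pow_ne_zero 2 (by exact_mod_cast ht0)
    have h1 : ContinuousAt (fun t => 2 * Real.log t) t := (Real.continuousAt_log ht0).const_mul 2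
    have h2 : ContinuousAt (fun t => G (2 * Real.log t)) t := G.continuous.continuousAt.comp h1
    have h3 : ContinuousAt (fun t => G1 (2 * Real.log t)) t := G1.continuous.continuousAt.comp h1
    have h4 : ContinuousAt (fun t : ℝ => (t : ℂ) ^ 2) t := by fun_prop
    exact (((h3.const_mul 2).sub h2).div h4 ht').continuousWithinAt
  have bh : ∀ t, 1 ≤ t → ‖h t‖ ≤ 3 * β * t ^ (-1 : ℝ) := by
    intro t ht
    have ht0 : 0 < t := by linarith
    rw [Real.rpow_neg_one, ← div_eq_mul_inv, norm_div, Complex.norm_real,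
      Real.norm_of_nonneg ht0.le]
    gcongr
    linarith [hβ (2 * Real.log t)]
  have bh' : ∀ t, 1 ≤ t → ‖h' t‖ ≤ 3 * β * t ^ (-2 : ℝ) := by
    intro t ht
    have ht0 : 0 < t := by linarith
    have e : t ^ (-2 : ℝ) = (t ^ 2)⁻¹ := by
      rw [Real.rpow_neg ht0.le]; norm_num
    rw [e, ← div_eq_mul_inv, norm_div, norm_pow, Complex.norm_real, Real.norm_of_nonneg ht0.le]
    gcongr
    refine (norm_sub_le _ _).trans ?_
    rw [norm_mul, Complex.norm_ofNat]
    linarith [hβ (2 * Real.log t), hβ' (2 * Real.log t)]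
  set W := Real.log c ^ 2
  have hW : 1 ≤ W := one_le_pow₀ hlc.le
  -- With `a = 2 log⁴ c` the factor `W = log² c` of the error is cancelled by `a^{-1/2}`, while `log
  -- a` is still only `log 2 + 4 log log c`.
  set a : ℝ := 2 * W ^ 2
  have ha : 2 ≤ a := by
    have := one_le_pow₀ hW (n := 2)
    simp only [a]; linarith
  have ha0 : 0 < a := by linarith
  have hla : Real.log a = Real.log 2 + 4 * LL := by
    simp only [a, W]
    rw [Real.log_mul two_ne_zero (by positivity), Real.log_pow, Real.log_pow]
    push_cast
    ring
  have hA : ∀ t : ℝ, 2 ≤ t → ‖∑ k ∈ Finset.Icc 0 ⌊t⌋₊, f.primeSquareCoeff k - (δ : ℂ) * t‖ ≤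
      2 * |K| * W * t ^ (1 / 2 : ℝ) + 128 * |K| * t ^ (3 / 4 : ℝ) := by
    intro t ht
    have h1 := f.sum_mul_primeSquareCoeff (fun _ => 1) ⌊t⌋₊
    simp only [one_mul] at h1
    rw [h1, ← primesLE_natFloor F (by linarith)]
    exact primeSquareAsymptotic_rpow hc hasym ht
  have hδ := norm_delta_le hRP hc hasym
  -- the contribution of the primes up to `a`
  have hT : ‖∑ k ∈ Finset.Icc 0 ⌊a⌋₊, h k * f.primeSquareCoeff k‖ ≤
      d * β * (4 * n * (Real.log a + Real.log 2)) := by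
    rw [f.sum_mul_primeSquareCoeff (fun k => h k), ← primesLE_natFloor F ha0.le]
    have h1 : ∀ p ∈ primesLE F a, ‖h (primeNorm p) * f.vonMangoldt p 2‖ ≤
        d * β * (Real.log (primeNorm p) / primeNorm p) := by
      intro p _
      have hN := primeNorm_pos_real p
      rw [norm_mul, norm_div, Complex.norm_real, Real.norm_of_nonneg hN.le]
      calc _ ≤ β / primeNorm p * (d * Real.log (primeNorm p)) := by
            gcongr
            · exact hβ _
            · exact norm_vonMangoldt_le hRP p 2
        _ = _ := by ring
    refine (norm_sum_le_of_le _ h1).trans ?_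
    rw [← Finset.mul_sum]
    exact mul_le_mul_of_nonneg_left (sum_log_primeNorm_div_le (by linarith)) (by positivity)
  have hHa : ‖H a‖ ≤ β * Real.log a := by
    have h0 : 0 ≤ Real.log a := Real.log_nonneg (by linarith)
    have h1 := intervalIntegral.norm_integral_le_of_norm_le_const (f := G) (a := 0)
      (b := 2 * Real.log a) (C := β) fun u _ => hβ u
    rw [sub_zero, abs_of_nonneg (by positivity)] at h1
    simp only [H]
    rw [norm_mul]
    have h2 : ‖(1 / 2 : ℂ)‖ = 1 / 2 := by norm_num
    rw [h2]
    linarith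
  have hWa : W * a ^ (-(1 / 2) : ℝ) ≤ 1 := by
    have h1 : W ≤ a ^ (1 / 2 : ℝ) := by
      rw [← Real.sqrt_eq_rpow]
      refine Real.le_sqrt_of_sq_le ?_
      simp only [a]
      nlinarith [sq_nonneg W]
    rw [Real.rpow_neg ha0.le, ← div_eq_mul_inv]
    exact (div_le_one (by positivity)).2 h1
  have ha4 : a ^ (-(1 / 4) : ℝ) ≤ 1 :=
    Real.rpow_le_one_of_one_le_of_nonpos (by linarith) (by norm_num)
  have hfin : ∀ Y : ℕ, a ≤ Y → ‖∑ p ∈ primesLE F Y, ∑ i, f.primePowerTerm G ((p, i), 1) -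
      δ * H Y‖ ≤ (d * (16 * n) + d * (n * Real.log 4) * 4 + 3 * (8 * |K| + 768 * |K|)) *
        (β * (1 + LL)) := by
    intro Y hY
    have hab := norm_sum_mul_sub_le_of_asymptotic f.primeSquareCoeff (δ := δ) dh dH ch'
      (by positivity : (0 : ℝ) ≤ 3 * β)
      (by positivity : (0 : ℝ) ≤ 2 * |K| * W) (by positivity : (0 : ℝ) ≤ 128 * |K|) bh bh' hA ha hY
    rw [Nat.floor_natCast] at hab
    have hsplit : ∑ p ∈ primesLE F Y, ∑ i, f.primePowerTerm G ((p, i), 1) =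
        ∑ k ∈ Finset.Icc 0 ⌊a⌋₊, h k * f.primeSquareCoeff k +
        ∑ k ∈ Finset.Ioc ⌊a⌋₊ Y, h k * f.primeSquareCoeff k := by
      have hdisj : Disjoint (Finset.Icc 0 ⌊a⌋₊) (Finset.Ioc ⌊a⌋₊ Y) := by
        rw [Finset.disjoint_left]
        intro k h1 h2
        rw [Finset.mem_Icc] at h1
        rw [Finset.mem_Ioc] at h2
        omega
      have hun : Finset.Icc 0 ⌊a⌋₊ ∪ Finset.Ioc ⌊a⌋₊ Y = Finset.Icc 0 Y := by
        have : ⌊a⌋₊ ≤ Y := Nat.floor_le_of_le hY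
        ext k
        rw [Finset.mem_union, Finset.mem_Icc, Finset.mem_Ioc, Finset.mem_Icc]
        omega
      rw [← Finset.sum_union hdisj, hun, f.sum_mul_primeSquareCoeff (fun k => h k)]
      exact Finset.sum_congr rfl fun p _ => f.sum_primePowerTerm_one G p
    have e : ∑ p ∈ primesLE F Y, ∑ i, f.primePowerTerm G ((p, i), 1) - δ * H Y =
        ∑ k ∈ Finset.Icc 0 ⌊a⌋₊, h k * f.primeSquareCoeff k - δ * H a +
        (∑ k ∈ Finset.Ioc ⌊a⌋₊ Y, h k * f.primeSquareCoeff k - δ * (H Y - H a)) := by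
      rw [hsplit]; ring
    rw [e]
    have hδH : ‖(δ : ℂ) * H a‖ ≤ d * (n * Real.log 4) * (β * Real.log a) := by
      rw [norm_mul]
      exact mul_le_mul hδ hHa (norm_nonneg _) (by positivity)
    have h2 := Real.log_two_lt_d9
    refine (norm_add_le _ _).trans
      ((add_le_add ((norm_sub_le _ _).trans (add_le_add hT hδH)) hab).trans ?_)
    rw [hla]
    have r1 : d * β * (4 * n * (Real.log 2 + 4 * LL + Real.log 2)) ≤
        d * (16 * n) * (β * (1 + LL)) := by
      calc d * β * (4 * n * (Real.log 2 + 4 * LL + Real.log 2))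
          ≤ d * β * (4 * n * (4 * (1 + LL))) := by gcongr; linarith
        _ = _ := by ring
    have r2 : d * (n * Real.log 4) * (β * (Real.log 2 + 4 * LL)) ≤
        d * (n * Real.log 4) * 4 * (β * (1 + LL)) := by
      calc d * (n * Real.log 4) * (β * (Real.log 2 + 4 * LL))
          ≤ d * (n * Real.log 4) * (β * (4 * (1 + LL))) := by gcongr; linarith
        _ = _ := by ring
    have r3 : 3 * β * (4 * (2 * |K| * W * a ^ (-(1 / 2) : ℝ)) +
        6 * (128 * |K| * a ^ (-(1 / 4) : ℝ))) ≤ 3 * (8 * |K| + 768 * |K|) * (β * (1 + LL)) := by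
      calc _ = 3 * β * (8 * |K| * (W * a ^ (-(1 / 2) : ℝ)) + 768 * |K| * a ^ (-(1 / 4) : ℝ)) := by
            ring
        _ ≤ 3 * β * (8 * |K| * 1 + 768 * |K| * 1) := by gcongr
        _ = 3 * (8 * |K| + 768 * |K|) * (β * 1) := by ring
        _ ≤ _ := by gcongr; linarith
    linarith
  -- passage to the limit
  have hsum : Summable fun x : HeightOneSpectrum (𝓞 F) × Fin d => f.primePowerTerm G (x, 1) :=
    (summable_primePowerTerm_succ hRP G).comp_injective (i := fun x => (x, 0))
      fun x y hxy => by simpa using hxy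
  have hlimS : Tendsto (fun Y : ℕ => ∑ p ∈ primesLE F Y, ∑ i, f.primePowerTerm G ((p, i), 1)) atTop
      (𝓝 (∑' x : HeightOneSpectrum (𝓞 F) × Fin d, f.primePowerTerm G (x, 1))) := by
    have hmono : Tendsto (fun Y : ℕ => primesLE F Y ×ˢ (Finset.univ : Finset (Fin d))) atTop
        atTop := by
      refine tendsto_atTop_finset_of_monotone (fun Y Z hYZ x hx => ?_) fun x => ?_
      · simp only [Finset.mem_product, mem_primesLE, Nat.cast_le, Finset.mem_univ, and_true] at hx ⊢
        exact hx.trans hYZ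
      · exact ⟨primeNorm x.1, by simp [mem_primesLE]⟩
    have := hsum.hasSum.comp hmono
    refine this.congr fun Y => ?_
    rw [Function.comp_apply, Finset.sum_product]
  have hlimH : Tendsto (fun Y : ℕ => H Y) atTop (𝓝 (1 / 2 * ∫ u in Set.Ioi 0, G u)) := by
    have h1 : Tendsto (fun Y : ℕ => 2 * Real.log Y) atTop atTop :=
      (Real.tendsto_log_atTop.comp tendsto_natCast_atTop_atTop).const_mul_atTop two_pos
    exact (intervalIntegral_tendsto_integral_Ioi 0 G.integrable.integrableOn h1).const_mul _
  have hlim := (hlimS.sub (hlimH.const_mul (δ : ℂ))).norm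
  have e : (δ : ℂ) / 2 * ∫ u in Set.Ioi 0, G u = δ * (1 / 2 * ∫ u in Set.Ioi 0, G u) := by ring
  rw [e]
  refine le_of_tendsto hlim ?_
  filter_upwards [tendsto_natCast_atTop_atTop.eventually_ge_atTop a] with Y hY
  exact hfin Y hY

/-- From the cube on, the local factors give `N(𝔭)^{-3/2}`, so absolute convergence needs no decay
of `G`. -/
theorem exists_norm_tsum_higher_powers_le (F : Type*) [Field F] [NumberField F] (d : ℕ) :
    ∃ C, 0 ≤ C ∧ ∀ f : NFLFunction F d, f.RamanujanPetersson →
      ∀ (G : ℝ → ℂ) (β : ℝ), (∀ u, ‖G u‖ ≤ β) →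
      ‖∑' x : (HeightOneSpectrum (𝓞 F) × Fin d) × ℕ, f.primePowerTerm G (x.1, x.2 + 2)‖ ≤
        C * β := by
  have h1 := summable_prod_fin (summable_log_primeNorm_mul_rpow (F := F) (σ := 3 / 2) (by norm_num))
    (fun p => mul_nonneg (log_primeNorm_pos p).le (by positivity)) d
  have h2 : Summable fun m : ℕ => ((2 : ℝ) ^ (-(1 / 2) : ℝ)) ^ m :=
    summable_geometric_of_lt_one two_rpow_neg_half_mem.1 two_rpow_neg_half_mem.2
  have h3 : Summable fun x : (HeightOneSpectrum (𝓞 F) × Fin d) × ℕ =>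
      Real.log (primeNorm x.1.1) * (primeNorm x.1.1 : ℝ) ^ (-(3 / 2) : ℝ) *
        ((2 : ℝ) ^ (-(1 / 2) : ℝ)) ^ x.2 :=
    h1.mul_of_nonneg h2 (fun x => mul_nonneg (log_primeNorm_pos x.1).le (by positivity))
      fun m => by positivity
  refine ⟨∑' x : (HeightOneSpectrum (𝓞 F) × Fin d) × ℕ,
      Real.log (primeNorm x.1.1) * (primeNorm x.1.1 : ℝ) ^ (-(3 / 2) : ℝ) *
        ((2 : ℝ) ^ (-(1 / 2) : ℝ)) ^ x.2, tsum_nonneg fun x => mul_nonneg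
    (mul_nonneg (log_primeNorm_pos x.1.1).le (by positivity)) (by positivity),
    fun f hRP G β hβ => ?_⟩
  rw [← tsum_mul_right]
  refine tsum_of_norm_bounded (h3.mul_right β).hasSum fun x => ?_
  have hl := (log_primeNorm_pos x.1.1).le
  have hN := primeNorm_pos_real x.1.1
  have hβ0 : 0 ≤ β := (norm_nonneg _).trans (hβ 0)
  have e1 := norm_eulerTerm_le hRP x.1 (1 / 2)
  have e2 := (norm_eulerTerm_half_le hRP x.1).2
  have e3 : ((1 / 2 : ℂ)).re = 1 / 2 := by simp
  rw [e3] at e1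
  have e4 : ‖f.eulerTerm x.1 (1 / 2)‖ ^ (x.2 + 2 + 1) ≤
      (primeNorm x.1.1 : ℝ) ^ (-(3 / 2) : ℝ) * ((2 : ℝ) ^ (-(1 / 2) : ℝ)) ^ x.2 := by
    have h5 : x.2 + 2 + 1 = 3 + x.2 := by ring
    have h6 : (primeNorm x.1.1 : ℝ) ^ (-(3 / 2) : ℝ) = ((primeNorm x.1.1 : ℝ) ^ (-(1 / 2) : ℝ)) ^ 3 := by
      rw [← Real.rpow_natCast, ← Real.rpow_mul hN.le]
      norm_num
    rw [h5, pow_add, h6]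
    gcongr
  rw [primePowerTerm, norm_mul, norm_mul, norm_pow, Complex.norm_real, Real.norm_of_nonneg hl]
  calc _ ≤ Real.log (primeNorm x.1.1) *
        ((primeNorm x.1.1 : ℝ) ^ (-(3 / 2) : ℝ) * ((2 : ℝ) ^ (-(1 / 2) : ℝ)) ^ x.2) * β := by
        gcongr
        exact hβ _
    _ = _ := by ring

end NFLFunction

/-! ### Assembly. -/

open MeasureTheory in
-- Collects the properties of the rescaled `φ̂` with one constant, each bound being `O(1/l)`. The
-- derivative is even `O(1/l²)`; one factor is given away using `l ≥ log 2 > 1/2`, which also makes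
-- the Lipschitz bound available.
theorem exists_scaled_fourier {φ : 𝓢(ℝ, ℂ)} (hφ : ∀ x, φ (-x) = φ x) :
    ∃ B, 0 ≤ B ∧ ∀ l : ℝ, Real.log 2 ≤ l → ∃ G : 𝓢(ℝ, ℂ),
      (∀ u, G u = (l : ℂ)⁻¹ * (𝓕 φ : 𝓢(ℝ, ℂ)) (u / l)) ∧ (∀ u, G (-u) = G u) ∧
      (∀ u, ‖G u‖ ≤ B / l) ∧ (∀ u, ‖SchwartzMap.derivCLM ℝ ℂ G u‖ ≤ B / l) ∧
      (∀ u, ‖G 0 - G u‖ ≤ B / l * |u|) ∧ ∫ u in Set.Ioi 0, G u = φ 0 / 2 ∧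
      (HasCompactSupport (𝓕 φ : 𝓢(ℝ, ℂ)) → HasCompactSupport G) := by
  set ψ : 𝓢(ℝ, ℂ) := 𝓕 φ
  set ψ1 : 𝓢(ℝ, ℂ) := SchwartzMap.derivCLM ℝ ℂ ψ
  obtain ⟨B0, hB0, hB0'⟩ := ψ.exists_norm_mul_one_add_abs_pow_le 0
  obtain ⟨B1, hB1, hB1'⟩ := ψ1.exists_norm_mul_one_add_abs_pow_le 0
  simp only [pow_zero, mul_one] at hB0' hB1'
  refine ⟨B0 + 2 * B1, by positivity, fun l hl => ?_⟩
  have hl2 := Real.log_two_gt_d9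
  have hl0 : 0 < l := by linarith
  have hlc : (l : ℂ) ≠ 0 := by exact_mod_cast hl0.ne'
  obtain ⟨G, hG⟩ := exists_scaled_schwartz ψ hl0
  have hder : ∀ u, ‖SchwartzMap.derivCLM ℝ ℂ G u‖ ≤ (B0 + 2 * B1) / l := by
    intro u
    have h1 : HasDerivAt G ((l : ℂ)⁻¹ * ((l⁻¹ : ℝ) • ψ1 (u / l))) u := by
      have h2 : HasDerivAt (fun u : ℝ => u / l) l⁻¹ u := by
        simpa using (hasDerivAt_id u).div_const l
      have h3 := ((ψ.hasDerivAt_derivCLM (u / l)).scomp u h2).const_mul (l : ℂ)⁻¹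
      exact h3.congr_of_eventuallyEq (Eventually.of_forall hG)
    rw [(G.hasDerivAt_derivCLM u).unique h1, norm_mul, norm_smul, norm_inv, Complex.norm_real,
      norm_inv, Real.norm_of_nonneg hl0.le, inv_mul_eq_div]
    gcongr
    have h4 : l⁻¹ ≤ 2 := by
      rw [inv_le_comm₀ hl0 two_pos]
      linarith
    calc _ ≤ 2 * B1 := by gcongr; exact hB1' _
      _ ≤ _ := by linarith
  refine ⟨G, hG, fun u => ?_, fun u => ?_, hder, fun u => ?_, ?_, fun hc => ?_⟩
  · rw [hG, hG, neg_div, fourier_even hφ]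
  · rw [hG, norm_mul, norm_inv, Complex.norm_real, Real.norm_of_nonneg hl0.le, inv_mul_eq_div]
    gcongr
    linarith [hB0' (u / l)]
  · have h := Convex.norm_image_sub_le_of_norm_hasDerivWithin_le (f := G) (s := Set.univ)
      (x := u) (y := 0) (fun x _ => (G.hasDerivAt_derivCLM x).hasDerivWithinAt)
      (fun x _ => hder x) convex_univ (Set.mem_univ _) (Set.mem_univ _)
    rwa [zero_sub, norm_neg, Real.norm_eq_abs] at h
  · have h := integral_comp_mul_left_Ioi ψ 0 (inv_pos.2 hl0)
    simp_rw [hG]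
    rw [integral_const_mul]
    simp_rw [div_eq_inv_mul]
    rw [h, mul_zero, inv_inv, integral_Ioi_fourier_eq hφ, Complex.real_smul,
      inv_mul_cancel_left₀ hlc]
    ring
  · have h1 : HasCompactSupport fun u : ℝ => ψ (u * l⁻¹) :=
      hc.comp_homeomorph (Homeomorph.mulRight₀ l⁻¹ (inv_ne_zero hl0.ne'))
    have h2 : (G : ℝ → ℂ) = fun u => (l : ℂ)⁻¹ * ψ (u * l⁻¹) := by
      ext u
      rw [hG, div_eq_mul_inv]
    rw [h2]
    exact h1.mul_left

theorem proposition2p1 {F : Type*} [Field F] [NumberField F] (d : ℕ)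
    (φ : 𝓢(ℝ, ℂ)) (hφ : ∀ x : ℝ, φ (-x) = φ x)
    (K c₀ κ₀ : ℝ) (hc₀ : Real.exp 1 < c₀) (hκ₀ : 0 < κ₀) :
    ∃ C : ℝ, ∀ (f : NFLFunction F d) (δ : ℤ) (c : ℝ),
      f.IsSelfDual →
      f.RamanujanPetersson →
      c₀ ≤ c → f.PrimeSquareAsymptotic δ c K →
      f.NoPoles →
      (∀ j, 0 < (f.κ j).re ∧ κ₀ ≤ ‖f.κ j‖) →
      (f.RiemannHypothesis ∨ HasCompactSupport (𝓕 φ : 𝓢(ℝ, ℂ))) →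
      ∀ R : ℝ, 2 ≤ R →
        Summable (f.densityTerm φ R) ∧
        ∃ P : ℂ, Tendsto (f.primeSum φ R) atTop (𝓝 P) ∧
          ‖f.oneLevelDensity φ R -
              (f.conductorTerm φ R - (δ : ℂ) / 2 * φ 0 - 2 / (Real.log R : ℂ) * P)‖
            ≤ C * (Real.log (Real.log c) / Real.log R) := by
  obtain ⟨B, hB, hG⟩ := exists_scaled_fourier hφ
  obtain ⟨C1, hC1, hγ⟩ := exists_norm_gammaTerm_sub_le hκ₀
  obtain ⟨C2, hC2, hsq⟩ := NFLFunction.exists_norm_tsum_prime_squares_sub_le F d K hc₀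
  obtain ⟨C3, hC3, hhigh⟩ := NFLFunction.exists_norm_tsum_higher_powers_le F d
  have hlc₀ : 1 < Real.log c₀ := by
    rw [← Real.log_exp 1]
    exact Real.log_lt_log (Real.exp_pos 1) hc₀
  set lam := Real.log (Real.log c₀)
  have hlam : 0 < lam := Real.log_pos hlc₀
  set m : ℝ := ((d * Module.finrank ℚ F : ℕ) : ℝ)
  have hm : 0 ≤ m := Nat.cast_nonneg _
  -- Bounded contributions are multiplied by `log log c / lam ≥ 1`; this is where `c₀ > e` is used
  -- to make `lam` positive.
  refine ⟨m * (2 * C1) * B / lam + 2 * C2 * B * (1 / lam + 1) + 2 * C3 * B / lam,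
    fun f δ c hf hRP hcc hasym hp hκ hRH R hR => ?_⟩
  have hκ' : ∀ j, 0 < (f.κ j).re := fun j => (hκ j).1
  set l := Real.log R
  have hl : Real.log 2 ≤ l := Real.log_le_log two_pos hR
  have hl0 : 0 < l := (Real.log_pos one_lt_two).trans_le hl
  have hlc : (l : ℂ) ≠ 0 := by exact_mod_cast hl0.ne'
  obtain ⟨G, hGe, hGev, hGb, hGd, hGl, hGi, hGc⟩ := hG l hl
  have hterm : f.densityTerm φ R =
      fun ρ : f.stripZeros => (f.zeroMult ρ : ℂ) * zeroTransform G ρ := by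
    ext ρ
    rw [NFLFunction.densityTerm, complexExtension_eq_zeroTransform φ hl0 hGe]
  obtain ⟨hs, hsγ, P, hP, hD⟩ := NFLFunction.explicit_formula_schwartz hf hp hRP hκ' G hGev
    (hRH.imp_right hGc)
  -- The factor `l` undoes the normalization `1/l` contained in `G`.
  refine ⟨hterm ▸ hs, l * P, ?_, ?_⟩
  · refine ((hP.comp tendsto_nat_floor_atTop).const_mul (l : ℂ)).congr' ?_
    filter_upwards [eventually_ge_atTop 0] with x hx
    rw [f.primeSum_eq φ hl0 hGe, NFLFunction.primesLE_natFloor F hx]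
    rfl
  set S2 := ∑' x : HeightOneSpectrum (𝓞 F) × Fin d, f.primePowerTerm G (x, 1)
  set S3 := ∑' x : (HeightOneSpectrum (𝓞 F) × Fin d) × ℕ, f.primePowerTerm G (x.1, x.2 + 2)
  have hS : ∑' x : (HeightOneSpectrum (𝓞 F) × Fin d) × ℕ, f.primePowerTerm G (x.1, x.2 + 1) =
      S2 + S3 := (NFLFunction.summable_primePowerTerm_succ hRP G).tsum_prod_nat_eq
  have hcond : f.conductorTerm φ R = G 0 * ((Real.log f.A : ℂ) -
      (d * Module.finrank ℚ F : ℕ) * (Real.log Real.pi : ℂ)) +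
      ∑ j, G 0 * Complex.log (f.κ j) := by
    rw [NFLFunction.conductorTerm, f.log_conductor_eq hκ', hGe, zero_div, ← Finset.mul_sum]
    ring
  -- The main terms cancel exactly, leaving the gamma errors, the error for the squares with `∫_0^∞
  -- G = φ(0)/2`, and the higher powers.
  have e : f.oneLevelDensity φ R -
      (f.conductorTerm φ R - (δ : ℂ) / 2 * φ 0 - 2 / (l : ℂ) * (l * P)) =
      ∑ j, (gammaTerm (f.κ j) G - G 0 * Complex.log (f.κ j)) -
        2 * (S2 - δ / 2 * (φ 0 / 2)) - 2 * S3 := by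
    rw [NFLFunction.oneLevelDensity, hterm, hD, hS, hcond, Finset.sum_sub_distrib]
    have : 2 / (l : ℂ) * (l * P) = 2 * P := by field_simp
    rw [this]
    ring
  set LL := Real.log (Real.log c)
  have hLL : lam ≤ LL := Real.log_le_log (by linarith)
    (Real.log_le_log ((Real.exp_pos 1).trans hc₀) hcc)
  have h1 : ‖∑ j, (gammaTerm (f.κ j) G - G 0 * Complex.log (f.κ j))‖ ≤
      m * (2 * C1 * (B / l)) := by
    have h2 : ∀ j ∈ Finset.univ, ‖gammaTerm (f.κ j) G - G 0 * Complex.log (f.κ j)‖ ≤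
        2 * C1 * (B / l) := fun j _ => by
      refine (hγ (f.κ j) (hκ j).1 (hκ j).2 G (B / l) hGl (hsγ j)).trans ?_
      calc _ ≤ C1 * (B / l + B / l) := by gcongr; exact hGb 0
        _ = _ := by ring
    refine (norm_sum_le_of_le _ h2).trans_eq ?_
    rw [Finset.sum_const, Finset.card_univ, Fintype.card_fin, nsmul_eq_mul]
  have h2 := hsq f δ c hRP hcc hasym G (B / l) hGb hGd
  rw [hGi] at h2
  have h3 := hhigh f hRP G (B / l) hGb
  have hone : 1 ≤ LL / lam := (one_le_div hlam).2 hLL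
  rw [e]
  have h4 : ‖(2 : ℂ) * (S2 - δ / 2 * (φ 0 / 2))‖ ≤ 2 * (C2 * (B / l * (1 + LL))) := by
    rw [norm_mul, Complex.norm_ofNat]
    linarith
  have h5 : ‖(2 : ℂ) * S3‖ ≤ 2 * (C3 * (B / l)) := by
    rw [norm_mul, Complex.norm_ofNat]
    linarith
  refine (norm_sub_le _ _).trans ((add_le_add ((norm_sub_le _ _).trans (add_le_add h1 h4)) h5).trans ?_)
  have k1 : m * (2 * C1 * (B / l)) ≤ m * (2 * C1 * (B / l)) * (LL / lam) :=
    le_mul_of_one_le_right (by positivity) hone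
  have k2 : 2 * (C2 * (B / l * (1 + LL))) ≤ 2 * (C2 * (B / l * (LL / lam + LL))) := by gcongr
  have k3 : 2 * (C3 * (B / l)) ≤ 2 * (C3 * (B / l)) * (LL / lam) :=
    le_mul_of_one_le_right (by positivity) hone
  refine (add_le_add (add_le_add k1 k2) k3).trans_eq ?_
  field_simp

end
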